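/- **Multi-dimensional density evolution for IRSA with NOMA.** There are $T$ types of users. A frame has $N$ slots and $K^{(t)}$ active users of type $t\in\{1,\dots,T\}$. Independently, each user of type $t$ draws a number $d$ of replicas from a distribution $(L^{(t)}_d)_{d\ge 0}$ and sends them in $d$ of the $N$ slots chosen uniformly at random. A pattern $c=(c_1,\dots,c_T)$ of nonnegative integers belongs to the type $t$ decodable set $\mathcal D^{(t)}$ if $c_t=1$, $c_s\le 1$ for $s<t$, $c_s\le s-t$ for $s>t$, and $\sum_{s>t}c_s\le T-t$. *Belief propagation (BP).* At iteration $0$ all slot-to-user messages are erasures. The message from a user to a slot is an erasure iff the messages to this user from all its other slots are. The message from a slot to a user $u$ of type $t$ at iteration $\ell+1$ is revealed iff the numbers, type by type, of $u$ itself and of the other users of the slot whose messages to the slot at iteration $\ell$ are erasures form a pattern in $\mathcal D^{(t)}$. A user is recovered at iteration $\ell$ if one of its incoming messages is revealed. *Modified peeling.* A slot is processed by resolving, for every $t$ for which the pattern of its unresolved users is in $\mathcal D^{(t)}$, its unresolved user of type $t$; resolved users are removed from all slots. For degree distributions $p$ write $\mathcal F[x]=\sum_d p_d x^d$ and $\mathcal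 F^{\{k\}}$ for its $k$-th derivative. Let $\mathcal L^{(t)},\mathcal R^{(t)}$ be these functions for $L^{(t)}$ and for right degree distributions $R^{(t)}$ ($R^{(t)}_d$ being the probability that $d$ users of type $t$ send in a slot), all with positive finite mean; let $\lambda^{(t)}[x]=\mathcal L^{(t)\{1\}}[x]/\mathcal L^{(t)\{1\}}[1]$ and $\rho^{(t)}[x]=\mathcal R^{(t)\{1\}}[x]/\mathcal R^{(t)\{1\}}[1]$. The density evolution recursion is $$y^{(t)}_{\ell+1}=1-\rho^{(t)}\big[1-\lambda^{(t)}[y^{(t)}_\ell]\big]\sum_{c\in\mathcal D^{(t)}}\ \prod_{\bar t\ne t}\frac{(\lambda^{(\bar t)}[y^{(\bar t)}_\ell])^{c_{\bar t}}}{c_{\bar t}!}\,(\mathcal R^{(\bar t)})^{\{c_{\bar t}\}}\big[1-\lambda^{(\bar t)}[y^{(\bar t)}_\ell]\big],\qquad y^{(t)}_0=1,\quad t\in\{1,\dots,T\}.\tag{DE}$$ 1. *Frames.* Let each $L^{(t)}$ have finite support, and let $N\to\infty$ with $K^{(t)}_N/N\to\eta^{(t)}>0$. Then for all $t$ and $d$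 the expected fraction of slots in which exactly $d$ users of type $t$ send converges to $R^{(t)}_d$ for a probability distribution $R^{(t)}$ with $\mathcal R^{(t)\{1\}}[1]=\eta^{(t)}\mathcal L^{(t)\{1\}}[1]$. For all $\ell$ and $t$, the average erasure probability of the slot-to-user messages along edges of type $t$ at BP iteration $\ell$ (expected number of erased messages divided by expected number of edges) converges to a limit $y^{(t)}_\ell$, and these limits satisfy (DE). 2. *Arbitrary degree distributions.* For arbitrary $L^{(t)},R^{(t)}$ with positive finite means, let $y_\ell^{(t)}$ be the probability that the BP message along an edge of type $t$ from a slot to a user is an erasure at iteration $\ell$ when the computation graph of the message is the random tree with these degree distributions: the slot has $d-1$ other users of type $t$ with probability $\rho^{(t)}_d=dR^{(t)}_d/\mathcal R^{(t)\{1\}}[1]$ and $d$ users of type $\bar t\neq t$ with probability $R^{(\bar t)}_d$; each of its users of type $s$ has $d-1$ other slots with probability $\lambda^{(s)}_d=dL^{(s)}_d/\mathcal L^{(s)\{1\}}[1]$; and so on, everything being independent. Then (DE) holds. 3. *Peeling.* For every frame and every $\ell$, the users resolved after $\ell$ rounds of modified peeling, each round processing all slots simultaneously, are exactly those recovered by BP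 at iteration $\ell$. If modified peeling processes one slot with a decodable pattern at a time, it can be run until no such slot is left, and whatever the order of the slots, the users resolved in the end are exactly those recovered by BP at all sufficiently large iterations. 4. *Two types.* For $T=2$ and with $\bar t$ the type other than $t$, the right-hand side of (DE) equals $$1-\rho^{(t)}\big[1-\lambda^{(t)}[y^{(t)}_\ell]\big]\Big(\mathcal R^{(\bar t)}\big[1-\lambda^{(\bar t)}[y^{(\bar t)}_\ell]\big]+\lambda^{(\bar t)}[y^{(\bar t)}_\ell]\,\mathcal R^{(\bar t)\{1\}}\big[1-\lambda^{(\bar t)}[y^{(\bar t)}_\ell]\big]\Big).$$ -/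

import Mathlib

open scoped ENNReal Nat Topology
open Filter

namespace IrsaNoma

noncomputable section

/-! ### Decodable patterns -/

/-- The transmission pattern `c` of a slot is type `t` decodable. Types are numbered from `0`,
so that the type `t : Fin T` is the `(t + 1)`-st in the decoding order. The third condition says
`c s ≤ s - t`, and the last one says that the entries after `t` add up to at most `T - (t + 1)`. -/
def IsDecodable {T : ℕ} (t : Fin T) (c : Fin T → ℕ) : Prop :=
  c t = 1 ∧ (∀ s, s < t → c s ≤ 1) ∧ (∀ s, t < s → c s + (t : ℕ) ≤ (s : ℕ)) ∧
    (∑ s ∈ Finset.Ioi t, c s) + ((t : ℕ) + 1) ≤ T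

/-- The set of type `t` decodable patterns. -/
def decodableSet {T : ℕ} (t : Fin T) : Set (Fin T → ℕ) := {c | IsDecodable t c}

theorem decodableSet_finite {T : ℕ} (t : Fin T) : (decodableSet t).Finite := by
  refine (Set.finite_Iic (fun _ : Fin T => T)).subset ?_
  rintro c ⟨h1, h2, h3, -⟩ s
  have hs := s.2
  rcases lt_trichotomy s t with h | h | h
  · have := h2 s h
    show c s ≤ T
    omega
  · subst h
    show c s ≤ T
    omega
  · have := h3 s h
    show c s ≤ T
    omega

/-! ### Degree distributions -/

/-- `gen p k x` is the `k`-th derivative, taken term by term, of the generating function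
`∑ d, p d * x ^ d` at `x`. -/
def gen (p : PMF ℕ) (k : ℕ) (x : ℝ) : ℝ :=
  ∑' d : ℕ, (p d).toReal * (d.descFactorial k : ℝ) * x ^ (d - k)

/-- The edge perspective generating function: with `F x = ∑ d, p d * x ^ d`, this is
`F' x / F' 1`. -/
def edgeGen (p : PMF ℕ) (x : ℝ) : ℝ := gen p 1 x / gen p 1 1

/-- The mean of the degree distribution is positive and finite. -/
def HasEdges (p : PMF ℕ) : Prop :=
  (∑' d : ℕ, (d : ℝ≥0∞) * p d) ≠ 0 ∧ (∑' d : ℕ, (d : ℝ≥0∞) * p d) ≠ ∞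

theorem tsum_shift (p : PMF ℕ) :
    (∑' d : ℕ, ((d + 1 : ℕ) : ℝ≥0∞) * p (d + 1)) = ∑' d : ℕ, (d : ℝ≥0∞) * p d := by
  rw [tsum_eq_zero_add' (f := fun d : ℕ => (d : ℝ≥0∞) * p d) ENNReal.summable]
  simp

/-- The number of further edges at the end of a uniformly chosen edge: it equals `d` with
probability `(d + 1) * p (d + 1) / ∑ k, k * p k`. -/
def residualLaw (p : PMF ℕ) (h : HasEdges p) : PMF ℕ :=
  PMF.normalize (fun d : ℕ => ((d + 1 : ℕ) : ℝ≥0∞) * p (d + 1))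
    (by rw [tsum_shift]; exact h.1) (by rw [tsum_shift]; exact h.2)

/-! ### The recursion -/

/-- One step of the multi-dimensional density evolution with left degree distributions `L` and
right degree distributions `R`, applied to the vector `y` of erasure probabilities. -/
def deMap {T : ℕ} (L R : Fin T → PMF ℕ) (y : Fin T → ℝ) (t : Fin T) : ℝ :=
  1 - edgeGen (R t) (1 - edgeGen (L t) (y t)) *
    ∑ c ∈ (decodableSet_finite t).toFinset, ∏ s ∈ Finset.univ.erase t,
      edgeGen (L s) (y s) ^ (c s) / ((c s)! : ℝ) * gen (R s) (c s) (1 - edgeGen (L s) (y s))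

/-! ### Frames and their decoding -/

/-- The active users: `K t` users of every type `t`. The type of `u` is `u.1`. -/
abbrev User {T : ℕ} (K : Fin T → ℕ) : Type := Σ t : Fin T, Fin (K t)

/-- A frame of `N` slots: the set of slots in which each user sends a replica. Equivalently the
bipartite graph between users and slots. -/
abbrev Frame {T : ℕ} (K : Fin T → ℕ) (N : ℕ) : Type := User K → Finset (Fin N)

open Classical in
/-- The pattern of slot `n` when the users in `A` are unresolved. -/
def pattern {T : ℕ} {K : Fin T → ℕ} {N : ℕ} (f : Frame K N) (n : Fin N) (A : Set (User K)) :
    Fin T → ℕ :=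
  fun s => (Finset.univ.filter (fun w : User K => w.1 = s ∧ n ∈ f w ∧ w ∈ A)).card

/-- Belief propagation: the message from slot `n` to user `u` is an erasure at iteration `ℓ`.
At first all messages are erasures. The message from a user `w` to the slot `n` is an erasure
if and only if the messages to `w` from all its other slots are; the message from `n` to `u` is
then revealed if and only if the pattern formed by `u` and those other users of the slot whose
messages are erasures is decodable for the type of `u`. -/
def slotErased {T : ℕ} {K : Fin T → ℕ} {N : ℕ} (f : Frame K N) : ℕ → User K → Fin N → Prop
  | 0, _, _ => True
  | ℓ + 1, u, n => ¬ IsDecodable u.1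
      (pattern f n {w | w = u ∨ ∀ m ∈ f w, m ≠ n → slotErased f ℓ w m})

/-- The users recovered by belief propagation at iteration `ℓ`. -/
def bpResolved {T : ℕ} {K : Fin T → ℕ} {N : ℕ} (f : Frame K N) (ℓ : ℕ) : Set (User K) :=
  {u | ∃ n ∈ f u, ¬ slotErased f ℓ u n}

/-- One iteration of the modified peeling decoder from the set `A` of resolved users to the set
`B`: some slot has a decodable remaining pattern, and all its unresolved users of the types for
which this pattern is decodable are resolved and removed from all their slots. -/
def PeelStep {T : ℕ} {K : Fin T → ℕ} {N : ℕ} (f : Frame K N) (A B : Set (User K)) : Prop :=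
  ∃ n : Fin N, (∃ t, pattern f n Aᶜ ∈ decodableSet t) ∧
    B = A ∪ {u | n ∈ f u ∧ pattern f n Aᶜ ∈ decodableSet u.1}

/-- `A` is a possible final set of resolved users of the modified peeling decoder. -/
def IsPeelingOutput {T : ℕ} {K : Fin T → ℕ} {N : ℕ} (f : Frame K N) (A : Set (User K)) : Prop :=
  Relation.ReflTransGen (PeelStep f) ∅ A ∧ ∀ B, ¬ PeelStep f A B

/-- The users resolved after `ℓ` rounds of modified peeling, when every round processes all slots
of the frame at once. -/
def peelRounds {T : ℕ} {K : Fin T → ℕ} {N : ℕ} (f : Frame K N) : ℕ → Set (User K)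
  | 0 => ∅
  | ℓ + 1 => peelRounds f ℓ ∪
      {u | ∃ n ∈ f u, pattern f n (peelRounds f ℓ)ᶜ ∈ decodableSet u.1}

/-! ### The random frame -/

/-- The probability of a frame when the users act independently and a user of type `t` draws a
number `d` of replicas from `L t` and then `d` of the `N` slots uniformly at random. (These are
probabilities as soon as `N` is at least the largest degree.) -/
def frameWeight {T : ℕ} (L : Fin T → PMF ℕ) {K : Fin T → ℕ} {N : ℕ} (f : Frame K N) : ℝ :=
  ∏ u : User K, (L u.1 (f u).card).toReal / (N.choose (f u).card : ℝ)

/-- The expectation of `X` over the random frame. -/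
def frameExp {T : ℕ} (L : Fin T → PMF ℕ) (K : Fin T → ℕ) (N : ℕ) (X : Frame K N → ℝ) : ℝ :=
  ∑ f : Frame K N, frameWeight L f * X f

open Classical in
/-- The number of edges of type `t`. -/
def edgeCount {T : ℕ} {K : Fin T → ℕ} {N : ℕ} (f : Frame K N) (t : Fin T) : ℕ :=
  (Finset.univ.filter (fun e : User K × Fin N => e.1.1 = t ∧ e.2 ∈ f e.1)).card

open Classical in
/-- The number of edges of type `t` whose slot-to-user message at iteration `ℓ` is an erasure. -/
def erasedCount {T : ℕ} {K : Fin T → ℕ} {N : ℕ} (f : Frame K N) (ℓ : ℕ) (t : Fin T) : ℕ :=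
  (Finset.univ.filter
    (fun e : User K × Fin N => e.1.1 = t ∧ e.2 ∈ f e.1 ∧ slotErased f ℓ e.1 e.2)).card

/-- The average erasure probability of the slot-to-user messages along the edges of type `t` at
iteration `ℓ`. -/
def avgErasure {T : ℕ} (L : Fin T → PMF ℕ) (K : Fin T → ℕ) (N ℓ : ℕ) (t : Fin T) : ℝ :=
  frameExp L K N (fun f => (erasedCount f ℓ t : ℝ)) /
    frameExp L K N (fun f => (edgeCount f t : ℝ))

open Classical in
/-- The node perspective right degree distribution of the random frame: the average fraction of
slots in which exactly `d` users of type `t` transmit. -/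
def rightDegree {T : ℕ} (L : Fin T → PMF ℕ) (K : Fin T → ℕ) (N : ℕ) (t : Fin T) (d : ℕ) : ℝ :=
  frameExp L K N (fun f =>
    ((Finset.univ.filter (fun n : Fin N => pattern f n Set.univ t = d)).card : ℝ)) / N

/-! ### The tree ensemble of a pair of degree distributions -/

/-- The computation tree of a slot-to-user message after `ℓ` iterations: for every type, the list
of the other users of that type in the slot, each of them given by the list of the computation
trees of the messages that it receives from its other slots. -/
def SlotTree (T : ℕ) : ℕ → Type
  | 0 => Unit
  | ℓ + 1 => Fin T → List (List (SlotTree T ℓ))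

open Classical in
/-- Belief propagation on a computation tree: the message to the root, a user of type `t`, is an
erasure. -/
def SlotTree.Erased {T : ℕ} : (ℓ : ℕ) → Fin T → SlotTree T ℓ → Prop
  | 0, _, _ => True
  | ℓ + 1, t, τ => ¬ IsDecodable t (fun s => (if s = t then 1 else 0) +
      List.countP (fun w : List (SlotTree T ℓ) => decide (∀ σ ∈ w, SlotTree.Erased ℓ s σ)) (τ s))

/-- A list of `n` independent samples from `p`. -/
def iidList {α : Type} (p : PMF α) : ℕ → PMF (List α)
  | 0 => PMF.pure []
  | n + 1 => p.bind fun a => (iidList p n).map fun l => a :: l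

/-- A family of independent samples from `p 0, …, p (n - 1)`. -/
def indepFamily {α : Type} : {n : ℕ} → (Fin n → PMF α) → PMF (Fin n → α)
  | 0, _ => PMF.pure Fin.elim0
  | _ + 1, p => (p 0).bind fun a => (indepFamily fun i => p i.succ).map fun v => Fin.cons a v

/-- The random computation tree of a message along an edge of type `t`. The slot has `d` further
users of type `t` with the edge perspective probability coming from `R t`, and, independently,
`d` users of another type `s` with probability `R s d`; each of its users of type `s` has `d`
further slots with the edge perspective probability coming from `L s`; all subtrees are
independent. -/
def treeLaw {T : ℕ} (L R : Fin T → PMF ℕ) (hL : ∀ t, HasEdges (L t)) (hR : ∀ t, HasEdges (R t)) :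
    (ℓ : ℕ) → Fin T → PMF (SlotTree T ℓ)
  | 0, _ => PMF.pure ()
  | ℓ + 1, t => indepFamily fun s =>
      (if s = t then residualLaw (R s) (hR s) else R s).bind
        (iidList ((residualLaw (L s) (hL s)).bind (iidList (treeLaw L R hL hR ℓ s))))

/-- The average erasure probability of the slot-to-user message of type `t` at iteration `ℓ` in
the tree ensemble. -/
def treeErasure {T : ℕ} (L R : Fin T → PMF ℕ) (hL : ∀ t, HasEdges (L t))
    (hR : ∀ t, HasEdges (R t)) (ℓ : ℕ) (t : Fin T) : ℝ :=
  ((treeLaw L R hL hR ℓ t).toOuterMeasure {τ | SlotTree.Erased ℓ t τ}).toReal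

end

end IrsaNoma

/-!
Peeling. Decodability is monotone: removing users other than the one to be decoded preserves it
(`IsDecodable.mono`). This gives one inclusion between parallel peeling and belief propagation, and
confluence of sequential peeling. The other inclusion is not formal, since the message from a slot
to a user ignores what that slot has revealed about the other users. If a user `w` was revealed by
the slot `n` itself, then the pattern from which this happened was decodable for `w` and contained
all users that count in the message from `n` to `u` now; this bounds the pattern for `u` as well
(`not_slotErased_of_isDecodable`). Decodability for two users of one type is impossible, so `u`
remains the only one of its type.

Trees. The number of erased further users of type `s` in a slot is a thinned version of its degree.
If the degree has generating function `F` and the users are erased with probability `q`, the thinned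
number equals `k` with probability `q ^ k / k! * F⁽ᵏ⁾ (1 - q)` (`thinned_apply`). Multiplying over
the independent types and summing over decodable patterns gives the recursion (`treeErasure_succ`).

Frames. In the limit, the numbers of users of the different types in a slot are Poisson, and the
right hand side of the recursion is the one of the tree ensemble with Poisson right degrees.
Instead of coupling the frame with a random tree, the proof uses the characterization of the Poisson
law by `ν * P (c - 1) = c * P c`. Belief propagation is replaced by cavity messages, for which
visited users are deleted (`cavityErased`). The users of a slot are divided into classes by their
type and by whether the messages from their other slots are all erasures. To count the users of a
class in a slot, sum over all users `w` the probability that `w` belongs to the class, choosing the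
slots of `w` anew. Up to events of probability of order `1 / N`, which are short cycles
(`frameProb_clash_le`), the new slots of `w` change none of the other messages and counts. So the
probability of class counts `c` at several slots, jointly with the values of messages from
further slots, satisfies `c * P c ≥ ν * P (c - 1) - o(1)` (`frameProb_jointEvent_ge`,
`JointLimit.succ`).

Starting from empty slots, whose probability is explicit, this yields lower bounds for the
probabilities of all counts; as the bounds add up to one, they are sharp, and lower bounds suffice
throughout. The messages of the next iteration are determined by the class counts
(`JointLimit.next`), and the total number of users in a slot has the same law at every iteration,
so the probability of empty slots, jointly with the new messages, is known and the induction
continues (`jointLimit`). Finally, choosing the slots of a user anew once more shows that the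
messages of belief propagation have the limit law of the cavity messages (`tendsto_avgErasure`).
-/

namespace IrsaNoma

/-! ### Peeling and belief propagation -/

section Peeling

/-- Decodability is inherited by smaller patterns that still contain the user to be decoded. -/
theorem IsDecodable.mono {T : ℕ} {t : Fin T} {c c' : Fin T → ℕ} (h : IsDecodable t c)
    (hle : ∀ s, c' s ≤ c s) (ht : 1 ≤ c' t) : IsDecodable t c' := by
  obtain ⟨h1, h2, h3, h4⟩ := h
  refine ⟨?_, fun s hs => (hle s).trans (h2 s hs), fun s hs => ?_, ?_⟩
  · have := hle t
    omega
  · have := hle s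
    have := h3 s hs
    omega
  · have : ∑ s ∈ Finset.Ioi t, c' s ≤ ∑ s ∈ Finset.Ioi t, c s :=
      Finset.sum_le_sum fun s _ => hle s
    omega

variable {T : ℕ} {K : Fin T → ℕ} {N : ℕ} (f : Frame K N)

theorem pattern_mono (n : Fin N) {A B : Set (User K)} (h : A ⊆ B) (s : Fin T) :
    pattern f n A s ≤ pattern f n B s := by
  classical
  unfold pattern
  refine Finset.card_le_card fun w hw => ?_
  simp only [Finset.mem_filter, Finset.mem_univ, true_and] at hw ⊢
  exact ⟨hw.1, hw.2.1, h hw.2.2⟩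

theorem pattern_congr (n : Fin N) {A B : Set (User K)} (s : Fin T)
    (h : ∀ w : User K, w.1 = s → n ∈ f w → (w ∈ A ↔ w ∈ B)) :
    pattern f n A s = pattern f n B s := by
  classical
  unfold pattern
  congr 1
  ext w
  simp only [Finset.mem_filter, Finset.mem_univ, true_and]
  constructor
  · rintro ⟨h1, h2, h3⟩
    exact ⟨h1, h2, (h w h1 h2).1 h3⟩
  · rintro ⟨h1, h2, h3⟩
    exact ⟨h1, h2, (h w h1 h2).2 h3⟩

theorem one_le_pattern {n : Fin N} {A : Set (User K)} {u : User K} (hn : n ∈ f u) (hu : u ∈ A) :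
    1 ≤ pattern f n A u.1 := by
  classical
  unfold pattern
  rw [Nat.one_le_iff_ne_zero, Ne, Finset.card_eq_zero]
  exact Finset.ne_empty_of_mem (a := u) (by simp [hn, hu])

/-- Two different users of the same type in a slot prevent both from being decoded. -/
theorem eq_of_pattern_eq_one {n : Fin N} {A : Set (User K)} {u w : User K} (hn : n ∈ f u)
    (hu : u ∈ A) (hn' : n ∈ f w) (hw : w ∈ A) (huw : w.1 = u.1) (h : pattern f n A u.1 = 1) :
    w = u := by
  classical
  unfold pattern at h
  exact Finset.card_le_one.1 h.le w (by simp [hn', hw, huw]) u (by simp [hn, hu])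

/-- An unresolved user that can be decoded stays decodable when more users are resolved. -/
theorem isDecodable_pattern_of_subset {n : Fin N} {A B : Set (User K)} {u : User K}
    (hAB : A ⊆ B) (hn : n ∈ f u) (hu : u ∉ B) (h : IsDecodable u.1 (pattern f n Aᶜ)) :
    IsDecodable u.1 (pattern f n Bᶜ) :=
  h.mono (pattern_mono f n (Set.compl_subset_compl.2 hAB)) (one_le_pattern f hn hu)

theorem slotErased_of_succ : ∀ (ℓ : ℕ) (u : User K) (n : Fin N), n ∈ f u →
    slotErased f (ℓ + 1) u n → slotErased f ℓ u n
  | 0, _, _, _, _ => trivial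
  | ℓ + 1, u, n, hn, h => by
    intro hd
    refine h (hd.mono (pattern_mono f n ?_) (one_le_pattern f hn (Or.inl rfl)))
    rintro w (rfl | hw)
    · exact Or.inl rfl
    · exact Or.inr fun m hm hmn => slotErased_of_succ ℓ w m hm (hw m hm hmn)

theorem bpResolved_subset_succ (ℓ : ℕ) : bpResolved f ℓ ⊆ bpResolved f (ℓ + 1) := by
  rintro u ⟨n, hn, h⟩
  exact ⟨n, hn, fun h' => h (slotErased_of_succ f ℓ u n hn h')⟩

/-- The extrinsic messages used by belief propagation lose nothing against the removal of all
resolved users: if the users of `n` still unresolved after `ℓ` iterations form a pattern that is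
decodable for the unresolved user `u`, then so do the users whose messages to `n` are erasures.
Any user `w` in which the two sets differ was itself revealed by the slot `n`, from a set of users
that contains the one considered for `u`; the conditions for `w` imply those for `u`. -/
theorem not_slotErased_of_isDecodable {ℓ : ℕ} {u : User K} {n : Fin N} (hn : n ∈ f u)
    (hu : u ∉ bpResolved f ℓ) (hd : IsDecodable u.1 (pattern f n (bpResolved f ℓ)ᶜ)) :
    ¬ slotErased f (ℓ + 1) u n := by
  intro hnd
  refine hnd ?_
  set E : Set (User K) := {w | w = u ∨ ∀ m ∈ f w, m ≠ n → slotErased f ℓ w m} with hE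
  have huE : u ∈ E := Or.inl rfl
  have hall : ∀ w ∈ E, n ∈ f w → w ∈ bpResolved f ℓ →
      ∃ F : Set (User K), IsDecodable w.1 (pattern f n F) ∧ w ∈ F ∧ E ⊆ F := by
    intro w hw hnw hres
    have hwu : w ≠ u := fun h => hu (h ▸ hres)
    obtain ⟨m, hm, hrev⟩ := hres
    have hmn : m = n := by
      by_contra hne
      exact hrev ((hw.resolve_left hwu) m hm hne)
    subst hmn
    cases ℓ with
    | zero => exact absurd trivial hrev
    | succ ℓ =>
      refine ⟨_, not_not.1 hrev, Or.inl rfl, ?_⟩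
      intro z hz
      refine Or.inr fun p hp hpm => slotErased_of_succ f ℓ z p hp ?_
      rcases hz with rfl | hz
      · by_contra hcon
        exact hu ⟨p, hp, hcon⟩
      · exact hz p hp hpm
  have hsame : ∀ s, (∀ w ∈ E, n ∈ f w → w.1 = s → w ∉ bpResolved f ℓ) →
      pattern f n E s = pattern f n (bpResolved f ℓ)ᶜ s := by
    intro s hs
    refine pattern_congr f n s fun w hws hnw => ⟨fun hw => hs w hw hnw hws, fun hw => ?_⟩
    refine Or.inr fun m hm _ => ?_
    by_contra hcon
    exact hw ⟨m, hm, hcon⟩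
  have hdiff : ∀ s, (∃ w ∈ E, n ∈ f w ∧ w.1 = s ∧ w ∈ bpResolved f ℓ) → pattern f n E s ≤ 1 := by
    rintro s ⟨w, hw, hnw, rfl, hres⟩
    obtain ⟨F, hF, -, hEF⟩ := hall w hw hnw hres
    exact (pattern_mono f n hEF _).trans hF.1.le
  have hcases : ∀ s, pattern f n E s = pattern f n (bpResolved f ℓ)ᶜ s ∨ pattern f n E s ≤ 1 := by
    intro s
    by_cases h : ∃ w ∈ E, n ∈ f w ∧ w.1 = s ∧ w ∈ bpResolved f ℓ
    · exact Or.inr (hdiff s h)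
    · push Not at h
      exact Or.inl (hsame s h)
  obtain ⟨h1, h2, h3, h4⟩ := hd
  refine ⟨?_, fun s hs => ?_, fun s hs => ?_, ?_⟩
  · rw [← h1]
    refine hsame _ fun w hw hnw hwt hres => ?_
    obtain ⟨F, hF, hwF, hEF⟩ := hall w hw hnw hres
    have := eq_of_pattern_eq_one f hnw hwF hn (hEF huE) hwt.symm hF.1
    exact hu (this ▸ hres)
  · rcases hcases s with h | h
    · exact h ▸ h2 s hs
    · exact h
  · rcases hcases s with h | h
    · exact h ▸ h3 s hs
    · have : (u.1 : ℕ) < s := hs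
      omega
  · by_cases h : ∃ w ∈ E, n ∈ f w ∧ u.1 < w.1 ∧ w ∈ bpResolved f ℓ
    · obtain ⟨w, hw, hnw, huw, hres⟩ := h
      obtain ⟨F, hF, -, hEF⟩ := hall w hw hnw hres
      -- the types up to that of `w` contribute at most one user each
      have hsplit : Finset.Ioi u.1 = Finset.Ioc u.1 w.1 ∪ Finset.Ioi w.1 := by
        ext s
        simp only [Finset.mem_Ioi, Finset.mem_union, Finset.mem_Ioc]
        constructor
        · intro hs
          exact (le_or_gt s w.1).imp (fun h => ⟨hs, h⟩) id
        · rintro (h | h)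
          · exact h.1
          · exact huw.trans h
      have hdisj : Disjoint (Finset.Ioc u.1 w.1) (Finset.Ioi w.1) := by
        rw [Finset.disjoint_left]
        intro s hs hs'
        exact absurd (Finset.mem_Ioc.1 hs).2 (not_le.2 (Finset.mem_Ioi.1 hs'))
      rw [hsplit, Finset.sum_union hdisj]
      have hA : ∑ s ∈ Finset.Ioc u.1 w.1, pattern f n E s ≤ (w.1 : ℕ) - u.1 := by
        calc ∑ s ∈ Finset.Ioc u.1 w.1, pattern f n E s ≤ ∑ s ∈ Finset.Ioc u.1 w.1, 1 := by
              refine Finset.sum_le_sum fun s hs => (pattern_mono f n hEF s).trans ?_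
              rcases (Finset.mem_Ioc.1 hs).2.lt_or_eq with h | h
              · exact hF.2.1 s h
              · exact h ▸ hF.1.le
          _ = (w.1 : ℕ) - u.1 := by simp
      have hB : ∑ s ∈ Finset.Ioi w.1, pattern f n E s ≤ ∑ s ∈ Finset.Ioi w.1, pattern f n F s :=
        Finset.sum_le_sum fun s _ => pattern_mono f n hEF s
      have hC := hF.2.2.2
      have : (u.1 : ℕ) < w.1 := huw
      omega
    · push Not at h
      rw [Finset.sum_congr rfl fun s hs => hsame s fun w hw hnw hws =>
        h w hw hnw (hws ▸ Finset.mem_Ioi.1 hs)]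
      exact h4

/-- Parallel peeling and belief propagation resolve the same users in every round, although a
peeling decoder also removes users resolved by the slot under consideration. -/
theorem peelRounds_eq_bpResolved : ∀ ℓ, peelRounds f ℓ = bpResolved f ℓ
  | 0 => by
    ext u
    simp [peelRounds, bpResolved, slotErased]
  | ℓ + 1 => by
    rw [peelRounds, peelRounds_eq_bpResolved ℓ]
    ext u
    constructor
    · rintro (hu | ⟨n, hn, hd⟩)
      · exact bpResolved_subset_succ f ℓ hu
      · by_cases hu : u ∈ bpResolved f ℓ
        · exact bpResolved_subset_succ f ℓ hu
        · exact ⟨n, hn, not_slotErased_of_isDecodable f hn hu hd⟩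
    · rintro ⟨n, hn, hd⟩
      by_cases hu : u ∈ bpResolved f ℓ
      · exact Or.inl hu
      · refine Or.inr ⟨n, hn, (not_not.1 hd).mono (pattern_mono f n fun w hw => ?_)
          (one_le_pattern f hn hu)⟩
        refine Or.inr fun m hm _ => ?_
        by_contra hcon
        exact hw ⟨m, hm, hcon⟩

theorem peelRounds_mono : Monotone (peelRounds f) :=
  monotone_nat_of_le_succ fun _ => Set.subset_union_left

theorem exists_peelRounds_stable :
    ∃ ℓ₀, ∀ ℓ, ℓ₀ ≤ ℓ → peelRounds f ℓ = peelRounds f ℓ₀ := by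
  obtain ⟨ℓ₀, h⟩ := WellFoundedGT.monotone_chain_condition
    (⟨peelRounds f, peelRounds_mono f⟩ : ℕ →o Set (User K))
  exact ⟨ℓ₀, fun ℓ hℓ => (h ℓ hℓ).symm⟩

theorem PeelStep.ssubset {f : Frame K N} {A B : Set (User K)} (h : PeelStep f A B) : A ⊂ B := by
  classical
  obtain ⟨n, ⟨t, ht⟩, rfl⟩ := h
  have hpos : 0 < pattern f n Aᶜ t := by
    rw [ht.1]
    exact one_pos
  unfold pattern at hpos
  obtain ⟨w, hw⟩ := Finset.card_pos.1 hpos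
  simp only [Finset.mem_filter, Finset.mem_univ, true_and] at hw
  obtain ⟨rfl, hnw, hwA⟩ := hw
  exact Set.ssubset_iff_exists.2 ⟨Set.subset_union_left, w, Or.inr ⟨hnw, ht⟩, hwA⟩

/-- Every step resolves a further user, so peeling ends. -/
theorem exists_isPeelingOutput : ∃ A, IsPeelingOutput f A := by
  obtain ⟨A, hA, hmax⟩ := Set.Finite.exists_maximal
    (Set.toFinite {A : Set (User K) | Relation.ReflTransGen (PeelStep f) ∅ A})
    ⟨∅, Relation.ReflTransGen.refl⟩
  refine ⟨A, hA, fun B hB => ?_⟩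
  exact hB.ssubset.2 (hmax (Relation.ReflTransGen.tail hA hB) hB.ssubset.1)

/-- Peeling in any order stays within every set that is closed under parallel rounds. -/
theorem subset_of_reflTransGen_peelStep {ℓ : ℕ} (hst : peelRounds f (ℓ + 1) = peelRounds f ℓ)
    {A : Set (User K)} (hA : Relation.ReflTransGen (PeelStep f) ∅ A) : A ⊆ peelRounds f ℓ := by
  induction hA with
  | refl => exact Set.empty_subset _
  | tail _ hstep ih =>
    obtain ⟨n, -, rfl⟩ := hstep
    refine Set.union_subset ih ?_
    rintro u ⟨hn, hd⟩
    by_contra hu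
    refine hu (hst ▸ Or.inr ⟨n, hn, ?_⟩)
    exact isDecodable_pattern_of_subset f ih hn hu hd

theorem peelRounds_subset_of_terminal {A : Set (User K)} (hA : ∀ B, ¬ PeelStep f A B) :
    ∀ ℓ, peelRounds f ℓ ⊆ A
  | 0 => Set.empty_subset _
  | ℓ + 1 => by
    have ih := peelRounds_subset_of_terminal hA ℓ
    refine Set.union_subset ih ?_
    rintro u ⟨n, hn, hd⟩
    by_contra hu
    exact hA _ ⟨n, ⟨u.1, isDecodable_pattern_of_subset f ih hn hu hd⟩, rfl⟩

theorem IsPeelingOutput.eq_bpResolved {f : Frame K N} {A : Set (User K)}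
    (hA : IsPeelingOutput f A) : ∃ ℓ₀ : ℕ, ∀ ℓ, ℓ₀ ≤ ℓ → bpResolved f ℓ = A := by
  obtain ⟨ℓ₀, h⟩ := exists_peelRounds_stable f
  refine ⟨ℓ₀, fun ℓ hℓ => ?_⟩
  rw [← peelRounds_eq_bpResolved, h ℓ hℓ]
  exact (peelRounds_subset_of_terminal f hA.2 ℓ₀).antisymm
    (subset_of_reflTransGen_peelStep f (h (ℓ₀ + 1) (Nat.le_succ _)) hA.1)

end Peeling

/-! ### Two types -/

/-- With two types, a slot is decodable for one of them if it has one user of that type and at most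
one of the other, in either order of the types. -/
theorem decodableSet_two (t : Fin 2) :
    (decodableSet_finite t).toFinset =
      {Function.update (fun _ => 1) t.rev 0, fun _ => 1} := by
  ext c
  simp only [Set.Finite.mem_toFinset, decodableSet, Set.mem_ofPred_eq, Finset.mem_insert,
    Finset.mem_singleton, funext_iff, Fin.forall_fin_two, IsDecodable]
  fin_cases t
  · have : Finset.Ioi (0 : Fin 2) = {1} := by decide
    simp [this, Fin.rev]
    omega
  · have : Finset.Ioi (1 : Fin 2) = ∅ := by decide
    simp [this, Fin.rev]
    omega

theorem deMap_two (L R : Fin 2 → PMF ℕ) (y : Fin 2 → ℝ) (t : Fin 2) :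
    deMap L R y t =
      1 - edgeGen (R t) (1 - edgeGen (L t) (y t)) *
        (gen (R t.rev) 0 (1 - edgeGen (L t.rev) (y t.rev)) +
          edgeGen (L t.rev) (y t.rev) * gen (R t.rev) 1 (1 - edgeGen (L t.rev) (y t.rev))) := by
  have hu : Finset.univ.erase t = {t.rev} := by
    fin_cases t <;> decide
  have hne : Function.update (fun _ => 1) t.rev 0 ≠ (fun _ : Fin 2 => 1) := by
    intro h
    simpa using congrFun h t.rev
  unfold deMap
  rw [decodableSet_two, Finset.sum_pair hne, hu]
  simp

/-! ### The tree ensemble -/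

section Tree

theorem toOuterMeasure_add_compl {α : Type} (p : PMF α) (s : Set α) :
    p.toOuterMeasure s + p.toOuterMeasure sᶜ = 1 := by
  rw [PMF.toOuterMeasure_apply, PMF.toOuterMeasure_apply, ← ENNReal.tsum_add, ← p.tsum_coe]
  refine tsum_congr fun a => ?_
  by_cases h : a ∈ s <;> simp [h]

theorem toReal_toOuterMeasure_compl {α : Type} (p : PMF α) (s : Set α) :
    (p.toOuterMeasure sᶜ).toReal = 1 - (p.toOuterMeasure s).toReal := by
  have h := toOuterMeasure_add_compl p s
  have h1 : p.toOuterMeasure s ≠ ∞ := fun h' => by simp [h'] at h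
  have h2 : p.toOuterMeasure sᶜ ≠ ∞ := fun h' => by simp [h'] at h
  have := congrArg ENNReal.toReal h
  rw [ENNReal.toReal_add h1 h2, ENNReal.toReal_one] at this
  linarith

theorem indepFamily_apply {α : Type} : ∀ {n : ℕ} (p : Fin n → PMF α) (v : Fin n → α),
    indepFamily p v = ∏ i, p i (v i)
  | 0, p, v => by
    have : v = Fin.elim0 := funext fun i => i.elim0
    simp [indepFamily, this]
  | n + 1, p, v => by
    classical
    rw [indepFamily, PMF.bind_apply, Fin.prod_univ_succ, tsum_eq_single (v 0)]
    · rw [PMF.map_apply, tsum_eq_single (Fin.tail v)]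
      · rw [if_pos (Fin.cons_self_tail v).symm, indepFamily_apply]
        rfl
      · intro w hw
        refine if_neg fun h => hw ?_
        rw [h, Fin.tail_cons]
    · intro a ha
      rw [PMF.map_apply, ENNReal.tsum_eq_zero.2, mul_zero]
      intro w
      refine if_neg fun h => ha ?_
      rw [h, Fin.cons_zero]

theorem indepFamily_map {α β : Type} : ∀ {n : ℕ} (p : Fin n → PMF α) (g : Fin n → α → β),
    (indepFamily p).map (fun v i => g i (v i)) = indepFamily fun i => (p i).map (g i)
  | 0, p, g => by
    rw [indepFamily, indepFamily, PMF.pure_map]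
    congr 1
    exact funext fun i => i.elim0
  | n + 1, p, g => by
    rw [indepFamily, indepFamily, PMF.map_bind, PMF.bind_map]
    congr 1
    funext a
    rw [Function.comp_apply, ← indepFamily_map, PMF.map_comp, PMF.map_comp]
    congr 1
    funext v
    funext i
    refine Fin.cases ?_ (fun j => ?_) i <;> simp

theorem tsum_mul_ite {α : Type} (u : PMF α) (P : α → Bool) (x y : ℝ≥0∞) :
    ∑' a, u a * (if P a then x else y) =
      u.toOuterMeasure {a | P a = true} * x + u.toOuterMeasure {a | P a = true}ᶜ * y := by
  rw [PMF.toOuterMeasure_apply, PMF.toOuterMeasure_apply, ← ENNReal.tsum_mul_right,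
    ← ENNReal.tsum_mul_right, ← ENNReal.tsum_add]
  refine tsum_congr fun a => ?_
  by_cases h : P a = true <;> simp [h]

/-- The number of samples with a given property among independent samples is binomial. -/
theorem iidList_map_countP {α : Type} (u : PMF α) (P : α → Bool) : ∀ n k : ℕ,
    ((iidList u n).map (List.countP P)) k =
      (n.choose k : ℝ≥0∞) * u.toOuterMeasure {a | P a = true} ^ k *
        u.toOuterMeasure {a | P a = true}ᶜ ^ (n - k)
  | 0, k => by
    rw [iidList, PMF.pure_map, PMF.pure_apply]
    cases k <;> simp
  | n + 1, k => by
    have key : ∀ a, ((iidList u n).map fun l => a :: l).map (List.countP P) =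
        ((iidList u n).map (List.countP P)).map (fun j => if P a then j + 1 else j) := by
      intro a
      rw [PMF.map_comp, PMF.map_comp]
      congr 1
      funext l
      by_cases h : P a = true <;> simp [h]
    rw [iidList, PMF.map_bind, PMF.bind_apply]
    simp_rw [key]
    cases k with
    | zero =>
      have h0 : ∀ a, (((iidList u n).map (List.countP P)).map
          (fun j => if P a then j + 1 else j)) 0 =
          if P a then 0 else ((iidList u n).map (List.countP P)) 0 := by
        intro a
        by_cases h : P a = true
        · simp [h, PMF.map_apply]
        · simp only [h, Bool.false_eq_true, if_false]
          exact congrArg (fun q : PMF ℕ => q 0) (PMF.map_id _)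
      simp_rw [h0]
      rw [tsum_mul_ite, iidList_map_countP u P n 0]
      simp [pow_succ, mul_comm]
    | succ k =>
      have h0 : ∀ a, (((iidList u n).map (List.countP P)).map
          (fun j => if P a then j + 1 else j)) (k + 1) =
          if P a then ((iidList u n).map (List.countP P)) k
            else ((iidList u n).map (List.countP P)) (k + 1) := by
        intro a
        by_cases h : P a = true
        · simp only [h, if_true]
          rw [PMF.map_apply, tsum_eq_single k]
          · simp
          · intro b hb
            refine if_neg fun h => hb ?_
            omega
        · simp only [h, Bool.false_eq_true, if_false]
          exact congrArg (fun q : PMF ℕ => q (k + 1)) (PMF.map_id _)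
      simp_rw [h0]
      rw [tsum_mul_ite, iidList_map_countP u P n k, iidList_map_countP u P n (k + 1),
        Nat.choose_succ_succ, Nat.add_sub_add_right]
      rcases lt_or_ge k n with hk | hk
      · have : n - k = n - (k + 1) + 1 := by omega
        rw [this]
        push_cast
        ring
      · rw [Nat.choose_eq_zero_of_lt (Nat.lt_succ_of_le hk)]
        push_cast
        ring

/-- Thinning: the number of samples with a property of probability `q` among a random number of
samples with law `p`. -/
theorem thinned_apply {α : Type} (p : PMF ℕ) (u : PMF α) (P : α → Bool) (k : ℕ) :
    (((p.bind (iidList u)).map (List.countP P)) k).toReal =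
      (u.toOuterMeasure {a | P a = true}).toReal ^ k / (k ! : ℝ) *
        gen p k (1 - (u.toOuterMeasure {a | P a = true}).toReal) := by
  have hle : ∀ s : Set α, u.toOuterMeasure s ≠ ∞ := fun s h => by
    have := toOuterMeasure_add_compl u s
    simp [h] at this
  rw [PMF.map_bind, PMF.bind_apply, ENNReal.tsum_toReal_eq, gen, ← tsum_mul_left]
  · refine tsum_congr fun d => ?_
    rw [iidList_map_countP, ← toReal_toOuterMeasure_compl,
      Nat.descFactorial_eq_factorial_mul_choose]
    simp only [ENNReal.toReal_mul, ENNReal.toReal_pow, ENNReal.toReal_natCast]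
    have : (k ! : ℝ) ≠ 0 := by positivity
    push_cast
    field_simp
  · intro d
    exact ENNReal.mul_ne_top (PMF.apply_ne_top _ _) (PMF.apply_ne_top _ _)

theorem gen_one_one (p : PMF ℕ) :
    gen p 1 1 = (∑' d : ℕ, (d : ℝ≥0∞) * p d).toReal := by
  rw [gen, ENNReal.tsum_toReal_eq]
  · refine tsum_congr fun d => ?_
    simp [mul_comm]
  · exact fun d => ENNReal.mul_ne_top (ENNReal.natCast_ne_top d) (PMF.apply_ne_top _ _)

theorem HasEdges.gen_one_one_pos {p : PMF ℕ} (h : HasEdges p) : 0 < gen p 1 1 := by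
  rw [gen_one_one]
  exact ENNReal.toReal_pos h.1 h.2

theorem gen_one_eq_tsum_succ (p : PMF ℕ) (x : ℝ) :
    gen p 1 x = ∑' d : ℕ, (p (d + 1)).toReal * ((d + 1 : ℕ) : ℝ) * x ^ d := by
  have h := (Nat.succ_injective).tsum_eq
    (f := fun d : ℕ => (p d).toReal * (d.descFactorial 1 : ℝ) * x ^ (d - 1)) ?_
  · rw [gen, ← h]
    refine tsum_congr fun d => ?_
    simp
  · intro d hd
    cases d with
    | zero => simp at hd
    | succ d => exact ⟨d, rfl⟩

/-- The edge perspective generating function belongs to the law of the further edges. -/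
theorem gen_residualLaw (p : PMF ℕ) (h : HasEdges p) (x : ℝ) :
    gen (residualLaw p h) 0 x = edgeGen p x := by
  rw [edgeGen, gen_one_eq_tsum_succ, div_eq_inv_mul, ← tsum_mul_left, gen, gen_one_one]
  refine tsum_congr fun d => ?_
  rw [residualLaw, PMF.normalize_apply, tsum_shift]
  simp only [ENNReal.toReal_mul, ENNReal.toReal_natCast, ENNReal.toReal_inv,
    Nat.descFactorial_zero, Nat.sub_zero, Nat.cast_one]
  ring

variable {T : ℕ} (L R : Fin T → PMF ℕ) (hL : ∀ t, HasEdges (L t)) (hR : ∀ t, HasEdges (R t))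

/-- The probability that all messages to a user from its other slots are erasures. -/
theorem user_erased_prob {α : Type} (p : PMF ℕ) (h : HasEdges p) (u : PMF α) (E : α → Prop)
    [DecidablePred fun w : List α => ∀ σ ∈ w, E σ] :
    (((residualLaw p h).bind (iidList u)).toOuterMeasure
      {w | decide (∀ σ ∈ w, E σ) = true}).toReal =
      edgeGen p (u.toOuterMeasure {σ | E σ}).toReal := by
  classical
  have hset : {w : List α | decide (∀ σ ∈ w, E σ) = true} =
      List.countP (fun σ => decide (¬ E σ)) ⁻¹' {0} := by
    ext w
    simp [List.countP_eq_zero]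
  have hcompl : {a : α | decide (¬ E a) = true} = {σ | E σ}ᶜ := by
    ext a
    simp
  rw [hset, ← PMF.toOuterMeasure_map_apply, PMF.toOuterMeasure_apply_singleton,
    thinned_apply, hcompl, toReal_toOuterMeasure_compl, gen_residualLaw]
  simp

theorem treeErasure_zero (t : Fin T) : treeErasure L R hL hR 0 t = 1 := by
  have : {τ : SlotTree T 0 | SlotTree.Erased 0 t τ} = Set.univ := Set.eq_univ_of_forall fun _ => by
    simp [SlotTree.Erased]
  rw [treeErasure, this]
  have h := toOuterMeasure_add_compl (treeLaw L R hL hR 0 t) Set.univ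
  rw [Set.compl_univ, MeasureTheory.measure_empty, add_zero] at h
  rw [h, ENNReal.toReal_one]

theorem treeErasure_mem_Icc (ℓ : ℕ) (t : Fin T) :
    treeErasure L R hL hR ℓ t ∈ Set.Icc (0 : ℝ) 1 := by
  refine ⟨ENNReal.toReal_nonneg, ?_⟩
  have h := toReal_toOuterMeasure_compl (treeLaw L R hL hR ℓ t)
    {τ | SlotTree.Erased ℓ t τ}
  have h0 : 0 ≤ ((treeLaw L R hL hR ℓ t).toOuterMeasure {τ | SlotTree.Erased ℓ t τ}ᶜ).toReal :=
    ENNReal.toReal_nonneg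
  rw [treeErasure]
  linarith

/-- The total mass of the vectors of further users that leave a decodable pattern together with
the user of type `t` at the end of the edge. -/
theorem sum_decodable_shift {M : Type*} [AddCommMonoid M] (t : Fin T) (w : (Fin T → ℕ) → M)
    (F : Finset (Fin T → ℕ))
    (hF : ∀ v, v ∈ F ↔ IsDecodable t (fun s => (if s = t then 1 else 0) + v s)) :
    ∑ v ∈ F, w v = ∑ c ∈ (decodableSet_finite t).toFinset, w (Function.update c t 0) := by
  refine Finset.sum_bij' (fun v _ => fun s => (if s = t then 1 else 0) + v s)
    (fun c _ => Function.update c t 0) ?_ ?_ ?_ ?_ ?_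
  · intro v hv
    exact (Set.Finite.mem_toFinset _).2 ((hF v).1 hv)
  · intro c hc
    have hc : IsDecodable t c := ((decodableSet_finite t).mem_toFinset).1 hc
    rw [hF]
    convert hc using 1
    funext s
    by_cases h : s = t
    · subst h
      simp [hc.1]
    · simp [h]
  · intro v hv
    have h1 := ((hF v).1 hv).1
    simp only [if_true] at h1
    funext s
    by_cases h : s = t
    · subst h
      simp
      omega
    · simp [h]
  · intro c hc
    have hc : IsDecodable t c := ((decodableSet_finite t).mem_toFinset).1 hc
    funext s
    by_cases h : s = t
    · subst h
      simp [hc.1]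
    · simp [h]
  · intro v hv
    have h1 := ((hF v).1 hv).1
    simp only [if_true] at h1
    congr 1
    funext s
    by_cases h : s = t
    · subst h
      simp
      omega
    · simp [h]

theorem finite_decodable_shift (t : Fin T) :
    {v : Fin T → ℕ | IsDecodable t (fun s => (if s = t then 1 else 0) + v s)}.Finite := by
  refine Set.Finite.preimage
    (f := fun (v : Fin T → ℕ) (s : Fin T) => (if s = t then 1 else 0) + v s)
    (Function.Injective.injOn ?_) (decodableSet_finite t)
  intro v w h
  funext s
  exact Nat.add_left_cancel (congrFun h s)

/-- The tree ensemble satisfies the recursion exactly: the numbers of erased further users of the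
different types at a slot are independent, and each of them is thinned. -/
theorem treeErasure_succ (ℓ : ℕ) (t : Fin T) :
    treeErasure L R hL hR (ℓ + 1) t = deMap L R (treeErasure L R hL hR ℓ) t := by
  classical
  set y := treeErasure L R hL hR ℓ with hy
  set p : Fin T → PMF (List (List (SlotTree T ℓ))) := fun s =>
    (if s = t then residualLaw (R s) (hR s) else R s).bind
        (iidList ((residualLaw (L s) (hL s)).bind (iidList (treeLaw L R hL hR ℓ s)))) with hp
  set g : (s : Fin T) → List (List (SlotTree T ℓ)) → ℕ := fun s =>
    List.countP (fun w : List (SlotTree T ℓ) => decide (∀ σ ∈ w, SlotTree.Erased ℓ s σ)) with hg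
  have hlaw : treeErasure L R hL hR (ℓ + 1) t = ((indepFamily p).toOuterMeasure
      {v : Fin T → List (List (SlotTree T ℓ)) | SlotTree.Erased (ℓ + 1) t v}).toReal := rfl
  set F := (finite_decodable_shift t).toFinset with hF
  have hset : {v : Fin T → List (List (SlotTree T ℓ)) | SlotTree.Erased (ℓ + 1) t v} =
      ((fun v s => g s (v s)) ⁻¹' (F : Set (Fin T → ℕ)))ᶜ := by
    ext τ
    rw [Set.mem_compl_iff, Set.mem_preimage, hF, Set.Finite.coe_toFinset]
    refine not_congr (iff_of_eq ?_)
    simp only [Set.mem_ofPred_eq, hg]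
  have hq : ∀ s k, ((p s).map (g s) k).toReal =
      edgeGen (L s) (y s) ^ k / (k ! : ℝ) *
        gen (if s = t then residualLaw (R s) (hR s) else R s) k (1 - edgeGen (L s) (y s)) := by
    intro s k
    rw [hp, hg, thinned_apply, user_erased_prob]
    rfl
  rw [hlaw, hset, toReal_toOuterMeasure_compl, ← PMF.toOuterMeasure_map_apply, indepFamily_map,
    PMF.toOuterMeasure_apply_finset,
    ENNReal.toReal_sum fun v _ => PMF.apply_ne_top _ _, deMap]
  congr 1
  rw [sum_decodable_shift t _ F (by simp [hF]), Finset.mul_sum]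
  refine Finset.sum_congr rfl fun c _ => ?_
  rw [indepFamily_apply, ENNReal.toReal_prod, ← Finset.mul_prod_erase _ _ (Finset.mem_univ t), hq]
  congr 1
  · simp [gen_residualLaw]
  · refine Finset.prod_congr rfl fun s hs => ?_
    have hst : s ≠ t := Finset.ne_of_mem_erase hs
    rw [hq, Function.update_of_ne hst, if_neg hst]

end Tree

/-! ### The random frame as a product measure -/

section Weights

/-- The probability that a user of type `t` transmits in the set `S` of slots. -/
noncomputable def userWeight {T : ℕ} (L : Fin T → PMF ℕ) (t : Fin T) {N : ℕ}
    (S : Finset (Fin N)) : ℝ :=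
  (L t S.card).toReal / (N.choose S.card : ℝ)

variable {T : ℕ} {L : Fin T → PMF ℕ} {N D : ℕ}

theorem userWeight_nonneg (t : Fin T) (S : Finset (Fin N)) : 0 ≤ userWeight L t S :=
  div_nonneg ENNReal.toReal_nonneg (Nat.cast_nonneg _)

theorem userWeight_eq_zero (hD : ∀ t d, D < d → L t d = 0) (t : Fin T) {S : Finset (Fin N)}
    (hS : D < S.card) : userWeight L t S = 0 := by
  simp [userWeight, hD t _ hS]

theorem sum_range_pmf (hD : ∀ t d, D < d → L t d = 0) (t : Fin T) {M : ℕ} (hM : D ≤ M) :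
    ∑ d ∈ Finset.range (M + 1), (L t d).toReal = 1 := by
  rw [← ENNReal.toReal_sum fun d _ => PMF.apply_ne_top _ _]
  have h := (L t).tsum_coe
  rw [tsum_eq_sum (s := Finset.range (M + 1))] at h
  · rw [h, ENNReal.toReal_one]
  · intro d hd
    exact hD t d (by simp at hd; omega)

theorem sum_range_eq (hD : ∀ t d, D < d → L t d = 0) (t : Fin T) {M : ℕ} (hM : D ≤ M)
    (g : ℕ → ℝ) :
    ∑ d ∈ Finset.range (M + 1), (L t d).toReal * g d =
      ∑ d ∈ Finset.range (D + 1), (L t d).toReal * g d := by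
  symm
  refine Finset.sum_subset (fun d hd => ?_) fun d _ hd => ?_
  · simp at hd ⊢
    omega
  · rw [hD t d (by simp at hd; omega)]
    simp

theorem sum_userWeight (hD : ∀ t d, D < d → L t d = 0) (hN : D ≤ N) (t : Fin T) :
    ∑ S : Finset (Fin N), userWeight L t S = 1 := by
  have h := Finset.sum_powerset_apply_card
    (fun d => (L t d).toReal / (N.choose d : ℝ)) (x := (Finset.univ : Finset (Fin N)))
  rw [Finset.powerset_univ, Finset.card_univ, Fintype.card_fin] at h
  rw [← sum_range_pmf hD t hN]
  refine h.trans (Finset.sum_congr rfl fun d hd => ?_)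
  have : (N.choose d : ℝ) ≠ 0 := by
    have := Nat.choose_pos (Nat.lt_succ_iff.1 (Finset.mem_range.1 hd))
    positivity
  rw [nsmul_eq_mul]
  field_simp

/-- A user of degree `d` transmits in a given slot with probability `d / N`. -/
theorem sum_userWeight_mem (hD : ∀ t d, D < d → L t d = 0) (hN : D ≤ N) (t : Fin T) (n : Fin N)
    (g : ℕ → ℝ) :
    ∑ S : Finset (Fin N) with n ∈ S, userWeight L t S * g S.card =
      (∑ d ∈ Finset.range (D + 1), (L t d).toReal * (d * g d)) / N := by
  classical
  obtain ⟨M, rfl⟩ : ∃ M, N = M + 1 := ⟨N - 1, by have := n.2; omega⟩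
  rw [← sum_range_eq hD t hN, Finset.sum_range_succ', Finset.sum_filter, ← Finset.powerset_univ,
    ← Finset.insert_erase (Finset.mem_univ n), Finset.sum_powerset_insert (by simp),
    Finset.sum_eq_zero, zero_add]
  · have h := Finset.sum_powerset_apply_card
      (fun d => (L t (d + 1)).toReal / ((M + 1).choose (d + 1) : ℝ) * g (d + 1))
      (x := Finset.univ.erase n)
    rw [Finset.card_erase_of_mem (Finset.mem_univ n), Finset.card_univ, Fintype.card_fin,
      Nat.add_sub_cancel] at h
    have h' : ∀ S ∈ (Finset.univ.erase n).powerset,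
        (if n ∈ insert n S then userWeight L t (insert n S) * g (insert n S).card else 0) =
          (L t (S.card + 1)).toReal / ((M + 1).choose (S.card + 1) : ℝ) * g (S.card + 1) := by
      intro S hS
      have hn : n ∉ S := fun hn => by simpa using Finset.mem_powerset.1 hS hn
      rw [if_pos (Finset.mem_insert_self n S), userWeight, Finset.card_insert_of_notMem hn]
    rw [Finset.sum_congr rfl h', h, add_div, Finset.sum_div]
    simp only [Nat.cast_zero, zero_mul, mul_zero, zero_div, add_zero]
    refine Finset.sum_congr rfl fun d hd => ?_
    have hpos : (0 : ℝ) < ((M + 1).choose (d + 1) : ℝ) := by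
      have := Nat.choose_pos (n := M + 1) (k := d + 1) (by simp at hd; omega)
      positivity
    have hid : ((M + 1 : ℕ) : ℝ) * (M.choose d : ℝ) =
        ((M + 1).choose (d + 1) : ℝ) * (d + 1 : ℕ) := by
      exact_mod_cast Nat.add_one_mul_choose_eq M d
    rw [nsmul_eq_mul]
    field_simp
    linear_combination ((L t (d + 1)).toReal * g (d + 1)) * hid
  · intro S hS
    refine if_neg fun hn => ?_
    simpa using Finset.mem_powerset.1 hS hn

theorem sum_userWeight_mem_le (hD : ∀ t d, D < d → L t d = 0) (hN : D ≤ N) (t : Fin T)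
    (n : Fin N) : ∑ S : Finset (Fin N) with n ∈ S, userWeight L t S ≤ D / N := by
  have h := sum_userWeight_mem hD hN t n (fun _ => 1)
  simp only [mul_one] at h
  rw [h]
  gcongr
  calc ∑ d ∈ Finset.range (D + 1), (L t d).toReal * d
      ≤ ∑ d ∈ Finset.range (D + 1), (L t d).toReal * D := by
        refine Finset.sum_le_sum fun d hd => ?_
        have : (d : ℝ) ≤ D := by
          exact_mod_cast Nat.lt_succ_iff.1 (Finset.mem_range.1 hd)
        gcongr
    _ = D := by rw [← Finset.sum_mul, sum_range_pmf hD t le_rfl, one_mul]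

/-- A user transmits in two given slots with probability of order `1 / N ^ 2`. -/
theorem sum_userWeight_mem_mem_le (hD : ∀ t d, D < d → L t d = 0) (hN : D ≤ N) (t : Fin T)
    {n m : Fin N} (hnm : m ≠ n) :
    ∑ S : Finset (Fin N) with n ∈ S ∧ m ∈ S, userWeight L t S ≤ (D : ℝ) ^ 2 / N ^ 2 := by
  classical
  obtain ⟨M, rfl⟩ : ∃ M, N = M + 2 := ⟨N - 2, by
    have h1 := n.2
    have h2 := m.2
    have : (n : ℕ) ≠ m := fun h => hnm (Fin.ext h.symm)
    omega⟩
  have hm : m ∈ Finset.univ.erase n := by simp [hnm]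
  have hz : ∀ (A : Finset (Fin (M + 2))) (F : Finset (Fin (M + 2)) → ℝ), ¬ (n ∈ A ∧ m ∈ A) →
      (if n ∈ A ∧ m ∈ A then F A else 0) = 0 := fun A F h => if_neg h
  rw [Finset.sum_filter, ← Finset.powerset_univ,
    ← Finset.insert_erase (Finset.mem_univ n), Finset.sum_powerset_insert (by simp),
    Finset.sum_eq_zero, zero_add, ← Finset.insert_erase hm, Finset.sum_powerset_insert (by simp),
    Finset.sum_eq_zero, zero_add]
  · have h := Finset.sum_powerset_apply_card
      (fun d => (L t (d + 2)).toReal / ((M + 2).choose (d + 2) : ℝ))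
      (x := (Finset.univ.erase n).erase m)
    rw [Finset.card_erase_of_mem hm, Finset.card_erase_of_mem (Finset.mem_univ n),
      Finset.card_univ, Fintype.card_fin, show M + 2 - 1 - 1 = M by omega] at h
    have h' : ∀ S ∈ ((Finset.univ.erase n).erase m).powerset,
        (if n ∈ insert n (insert m S) ∧ m ∈ insert n (insert m S) then
          userWeight L t (insert n (insert m S)) else 0) =
          (L t (S.card + 2)).toReal / ((M + 2).choose (S.card + 2) : ℝ) := by
      intro S hS
      have hmS : m ∉ S := fun h => by simpa using Finset.mem_powerset.1 hS h
      have hnS : n ∉ insert m S := fun h => by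
        rcases Finset.mem_insert.1 h with h | h
        · exact hnm h.symm
        · simpa using Finset.mem_powerset.1 hS h
      rw [if_pos (by simp), userWeight, Finset.card_insert_of_notMem hnS,
        Finset.card_insert_of_notMem hmS]
    rw [Finset.sum_congr rfl h', h]
    have hb : ∀ d ∈ Finset.range (M + 1),
        M.choose d • ((L t (d + 2)).toReal / ((M + 2).choose (d + 2) : ℝ)) ≤
          (L t (d + 2)).toReal * ((D : ℝ) ^ 2 / ((M + 2 : ℕ) : ℝ) ^ 2) := by
      intro d hd
      by_cases hdD : D < d + 2
      · simp [hD t _ hdD]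
      · have hdM : d ≤ M := Nat.lt_succ_iff.1 (Finset.mem_range.1 hd)
        have hpos : (0 : ℝ) < ((M + 2).choose (d + 2) : ℝ) := by
          have := Nat.choose_pos (n := M + 2) (k := d + 2) (by omega)
          positivity
        have h1 : ((M : ℝ) + 2) * ((M + 1).choose (d + 1) : ℝ) =
            ((M + 2).choose (d + 2) : ℝ) * (d + 2) := by
          exact_mod_cast Nat.add_one_mul_choose_eq (M + 1) (d + 1)
        have h2 : ((M : ℝ) + 1) * (M.choose d : ℝ) = ((M + 1).choose (d + 1) : ℝ) * (d + 1) := by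
          exact_mod_cast Nat.add_one_mul_choose_eq M d
        have hC : (M.choose d : ℝ) / ((M + 2).choose (d + 2) : ℝ) =
            ((d : ℝ) + 2) / (M + 2) * ((d + 1) / (M + 1)) := by
          field_simp
          linear_combination ((M : ℝ) + 2) * h2 + ((d : ℝ) + 1) * h1
        have hdM' : (d : ℝ) ≤ M := by exact_mod_cast hdM
        have hdD' : (d : ℝ) + 2 ≤ D := by exact_mod_cast not_lt.1 hdD
        have h3 : ((d : ℝ) + 1) / (M + 1) ≤ (d + 2) / (M + 2) := by
          rw [div_le_div_iff₀ (by positivity) (by positivity)]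
          nlinarith
        have h4 : ((d : ℝ) + 2) / (M + 2) ≤ D / (M + 2) := by gcongr
        calc M.choose d • ((L t (d + 2)).toReal / ((M + 2).choose (d + 2) : ℝ))
            = (L t (d + 2)).toReal * ((M.choose d : ℝ) / ((M + 2).choose (d + 2) : ℝ)) := by
              rw [nsmul_eq_mul]
              ring
          _ ≤ (L t (d + 2)).toReal * ((D : ℝ) / (M + 2) * (D / (M + 2))) := by
              rw [hC]
              exact mul_le_mul_of_nonneg_left
                (mul_le_mul h4 (h3.trans h4) (by positivity) (by positivity)) ENNReal.toReal_nonneg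
          _ = _ := by
              push_cast
              rw [div_mul_div_comm, sq, sq]
    refine (Finset.sum_le_sum hb).trans ?_
    rw [← Finset.sum_mul]
    refine mul_le_of_le_one_left (by positivity) ?_
    have := sum_range_pmf hD t hN
    rw [Finset.sum_range_succ', Finset.sum_range_succ'] at this
    have e1 : (0 : ℝ) ≤ (L t 0).toReal := ENNReal.toReal_nonneg
    have e2 : (0 : ℝ) ≤ (L t (0 + 1)).toReal := ENNReal.toReal_nonneg
    linarith
  · intro S hS
    refine hz _ _ fun hn => ?_
    rcases Finset.mem_insert.1 hn.2 with h | h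
    · exact hnm h
    · simpa using Finset.mem_powerset.1 hS h
  · intro S hS
    refine hz _ _ fun hn => ?_
    simpa using Finset.mem_powerset.1 hS hn.1

end Weights

section Frames

variable {T : ℕ} {L : Fin T → PMF ℕ} {K : Fin T → ℕ} {N D : ℕ}

theorem frameWeight_eq (f : Frame K N) :
    frameWeight L f = ∏ u : User K, userWeight L u.1 (f u) := rfl

theorem frameWeight_nonneg (f : Frame K N) : 0 ≤ frameWeight L f :=
  Finset.prod_nonneg fun u _ => userWeight_nonneg u.1 (f u)

theorem frameExp_mono {X Y : Frame K N → ℝ} (h : ∀ f, X f ≤ Y f) :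
    frameExp L K N X ≤ frameExp L K N Y :=
  Finset.sum_le_sum fun f _ => mul_le_mul_of_nonneg_left (h f) (frameWeight_nonneg f)

theorem frameExp_sum {ι : Type*} (s : Finset ι) (X : ι → Frame K N → ℝ) :
    frameExp L K N (fun f => ∑ i ∈ s, X i f) = ∑ i ∈ s, frameExp L K N (X i) := by
  simp only [frameExp, Finset.mul_sum]
  exact Finset.sum_comm

theorem frameExp_const_mul (a : ℝ) (X : Frame K N → ℝ) :
    frameExp L K N (fun f => a * X f) = a * frameExp L K N X := by
  simp only [frameExp, Finset.mul_sum]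
  exact Finset.sum_congr rfl fun f _ => by ring

theorem frameExp_add (X Y : Frame K N → ℝ) :
    frameExp L K N (fun f => X f + Y f) = frameExp L K N X + frameExp L K N Y := by
  simp only [frameExp, mul_add, Finset.sum_add_distrib]

/-- The expectation of a product over the users factorizes. -/
theorem frameExp_prod (g : (u : User K) → Finset (Fin N) → ℝ) :
    frameExp L K N (fun f => ∏ u, g u (f u)) =
      ∏ u : User K, ∑ S, userWeight L u.1 S * g u S := by
  rw [Finset.prod_univ_sum, Fintype.piFinset_univ, frameExp]
  refine Finset.sum_congr rfl fun f _ => ?_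
  rw [frameWeight_eq, ← Finset.prod_mul_distrib]

/-- The slots of one user can be resampled. -/
theorem frameExp_resample (hD : ∀ t d, D < d → L t d = 0) (hN : D ≤ N) (u : User K)
    (X : Frame K N → ℝ) :
    frameExp L K N X = ∑ S, userWeight L u.1 S *
      frameExp L K N (fun f => X (Function.update f u S)) := by
  have h1 : ∑ S, userWeight L u.1 S * frameExp L K N (fun f => X (Function.update f u S)) =
      ∑ a : Finset (Fin N) × Frame K N,
        userWeight L u.1 a.1 * frameWeight L a.2 * X (Function.update a.2 u a.1) := by
    rw [Fintype.sum_prod_type]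
    refine Finset.sum_congr rfl fun S _ => ?_
    rw [frameExp, Finset.mul_sum]
    exact Finset.sum_congr rfl fun f _ => by ring
  have h2 : frameExp L K N X = ∑ a : Finset (Fin N) × Frame K N,
      userWeight L u.1 a.1 * frameWeight L a.2 * X a.2 := by
    rw [Fintype.sum_prod_type]
    simp only [mul_assoc, ← Finset.mul_sum]
    rw [← Finset.sum_mul, sum_userWeight hD hN, one_mul, frameExp]
  rw [h1, h2]
  -- exchange the slots of `u` with the new ones
  refine Finset.sum_nbij' (fun a => (a.2 u, Function.update a.2 u a.1))
    (fun a => (a.2 u, Function.update a.2 u a.1)) (by simp) (by simp) (by simp) (by simp) ?_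
  rintro ⟨S, f⟩ -
  simp only [Function.update_idem, Function.update_eq_self]
  congr 1
  rw [frameWeight_eq, frameWeight_eq, ← Finset.mul_prod_erase _ _ (Finset.mem_univ u),
    ← Finset.mul_prod_erase _ _ (Finset.mem_univ u), Function.update_self]
  have : ∏ v ∈ Finset.univ.erase u, userWeight L v.1 (Function.update f u S v) =
      ∏ v ∈ Finset.univ.erase u, userWeight L v.1 (f v) :=
    Finset.prod_congr rfl fun v hv => by rw [Function.update_of_ne (Finset.ne_of_mem_erase hv)]
  rw [this]
  ring

open Classical in
/-- The probability of an event of the random frame. -/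
noncomputable def frameProb (L : Fin T → PMF ℕ) (K : Fin T → ℕ) (N : ℕ) (p : Frame K N → Prop) :
    ℝ :=
  frameExp L K N fun f => if p f then 1 else 0

theorem frameExp_one (hD : ∀ t d, D < d → L t d = 0) (hN : D ≤ N) :
    frameExp L K N (fun _ => 1) = 1 := by
  have h := frameExp_prod (L := L) (K := K) (N := N) (fun _ _ => 1)
  simp only [Finset.prod_const_one, mul_one] at h
  rw [h]
  exact Finset.prod_eq_one fun u _ => sum_userWeight hD hN u.1

theorem frameProb_nonneg (p : Frame K N → Prop) : 0 ≤ frameProb L K N p := by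
  classical
  refine Finset.sum_nonneg fun f _ => mul_nonneg (frameWeight_nonneg f) ?_
  dsimp only
  split_ifs <;> simp

theorem frameProb_mono {p q : Frame K N → Prop} (h : ∀ f, p f → q f) :
    frameProb L K N p ≤ frameProb L K N q := by
  classical
  refine frameExp_mono fun f => ?_
  by_cases hp : p f
  · simp [hp, h f hp]
  · simp only [hp, if_false]
    split_ifs <;> simp

theorem frameProb_le_one (hD : ∀ t d, D < d → L t d = 0) (hN : D ≤ N) (p : Frame K N → Prop) :
    frameProb L K N p ≤ 1 := by
  classical
  rw [← frameExp_one (K := K) hD hN]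
  refine frameExp_mono fun f => ?_
  split_ifs <;> simp

theorem frameProb_add_not (hD : ∀ t d, D < d → L t d = 0) (hN : D ≤ N) (p : Frame K N → Prop) :
    frameProb L K N p + frameProb L K N (fun f => ¬ p f) = 1 := by
  classical
  rw [frameProb, frameProb, ← frameExp_add]
  refine Eq.trans ?_ (frameExp_one (K := K) hD hN)
  congr 1
  funext f
  by_cases h : p f <;> simp [h]

theorem frameProb_or_le (p q : Frame K N → Prop) :
    frameProb L K N (fun f => p f ∨ q f) ≤ frameProb L K N p + frameProb L K N q := by
  classical
  rw [frameProb, frameProb, frameProb, ← frameExp_add]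
  refine frameExp_mono fun f => ?_
  by_cases h : p f <;> by_cases h' : q f <;> simp [h, h']

theorem frameProb_exists_le {ι : Type*} (s : Finset ι) (p : ι → Frame K N → Prop) :
    frameProb L K N (fun f => ∃ i ∈ s, p i f) ≤ ∑ i ∈ s, frameProb L K N (p i) := by
  classical
  unfold frameProb
  rw [← frameExp_sum]
  refine frameExp_mono fun f => ?_
  have h0 : ∀ i ∈ s, (0 : ℝ) ≤ if p i f then 1 else 0 := fun i _ => by split_ifs <;> simp
  split_ifs with h
  · obtain ⟨i, hi, hp⟩ := h
    refine le_trans ?_ (Finset.single_le_sum h0 hi)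
    simp [hp]
  · exact Finset.sum_nonneg h0

/-- Pairwise exclusive events inside `p` have total probability at most that of `p`. -/
theorem sum_frameProb_le {ι : Type*} (s : Finset ι) (q : ι → Frame K N → Prop)
    (p : Frame K N → Prop) (hsub : ∀ i ∈ s, ∀ f, q i f → p f)
    (hex : ∀ i ∈ s, ∀ j ∈ s, ∀ f, q i f → q j f → i = j) :
    ∑ i ∈ s, frameProb L K N (q i) ≤ frameProb L K N p := by
  classical
  unfold frameProb
  rw [← frameExp_sum]
  refine frameExp_mono fun f => ?_
  by_cases h : ∃ i ∈ s, q i f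
  · obtain ⟨i, hi, hq⟩ := h
    rw [Finset.sum_eq_single_of_mem i hi, if_pos hq, if_pos (hsub i hi f hq)]
    intro j hj hji
    exact if_neg fun hqj => hji (hex j hj i hi f hqj hq)
  · push Not at h
    rw [Finset.sum_eq_zero fun i hi => if_neg (h i hi)]
    split_ifs <;> simp

theorem frameProb_resample (hD : ∀ t d, D < d → L t d = 0) (hN : D ≤ N) (u : User K)
    (p : Frame K N → Prop) :
    frameProb L K N p = ∑ S, userWeight L u.1 S *
      frameProb L K N (fun f => p (Function.update f u S)) :=
  frameExp_resample hD hN u _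

/-- A bound for an event that forces the slots of `u` into `Q` and, given that they are `S`,
implies an event `q S` that does not refer to the slots of `u` any more. -/
theorem frameProb_le_of_resample (hD : ∀ t d, D < d → L t d = 0) (hN : D ≤ N) (u : User K)
    {p : Frame K N → Prop} (Q : Finset (Finset (Fin N))) (q : Finset (Fin N) → Frame K N → Prop)
    (h : ∀ f S, p (Function.update f u S) → S ∈ Q ∧ q S f) {b : ℝ}
    (hb : ∀ S ∈ Q, S.card ≤ D → frameProb L K N (q S) ≤ b) :
    frameProb L K N p ≤ (∑ S ∈ Q, userWeight L u.1 S) * b := by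
  classical
  rw [frameProb_resample hD hN u, Finset.sum_mul, ← Finset.sum_filter_add_sum_filter_not _ (· ∈ Q),
    Finset.filter_univ_mem, Finset.sum_eq_zero (s := Finset.univ.filter (· ∉ Q)), add_zero]
  · refine Finset.sum_le_sum fun S hS => ?_
    rcases lt_or_ge D S.card with hc | hc
    · rw [userWeight_eq_zero hD _ hc, zero_mul, zero_mul]
    · exact mul_le_mul_of_nonneg_left ((frameProb_mono fun f hf => (h f S hf).2).trans
        (hb S hS hc)) (userWeight_nonneg _ _)
  · intro S hS
    refine mul_eq_zero_of_right _ (le_antisymm ?_ (frameProb_nonneg _))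
    have : frameProb L K N (fun _ => False) = 0 := by simp [frameProb, frameExp]
    rw [← this]
    exact frameProb_mono fun f hf => (Finset.mem_filter.1 hS).2 (h f S hf).1

theorem frameProb_mem_le (hD : ∀ t d, D < d → L t d = 0) (hN : D ≤ N) (u : User K) (n : Fin N) :
    frameProb L K N (fun f => n ∈ f u) ≤ D / N := by
  classical
  refine (frameProb_le_of_resample hD hN u (Finset.univ.filter (n ∈ ·)) (fun _ _ => True)
    (fun f S h => ⟨by simpa using h, trivial⟩)
    (fun S _ _ => frameProb_le_one hD hN _)).trans ?_
  rw [mul_one]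
  exact sum_userWeight_mem_le hD hN u.1 n

end Frames

/-! ### Cavity messages and their locality -/

section Cavity

variable {T : ℕ} {K : Fin T → ℕ} {N : ℕ}

open Classical in
/-- The message from the slot `n` to an additional user of type `t`, when belief propagation is
replaced by the recursion in which every user is deleted from the frame once it has been visited.
On frames without short cycles this is the message of belief propagation, and unlike the latter it
depends on the deleted users in no way. -/
noncomputable def cavityErased : ℕ → Frame K N → Fin N → Fin T → Prop
  | 0, _, _, _ => True
  | ℓ + 1, f, n, t => ¬ IsDecodable t (fun s => (if s = t then 1 else 0) +
      (Finset.univ.filter (fun w : User K => w.1 = s ∧ n ∈ f w ∧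
        ∀ m ∈ f w, m ≠ n → cavityErased ℓ (Function.update f w ∅) m w.1)).card)

/-- All messages to the user `w` from its slots other than `n` are erasures. -/
def UserErased (ℓ : ℕ) (f : Frame K N) (w : User K) (n : Fin N) : Prop :=
  ∀ m ∈ f w, m ≠ n → cavityErased ℓ (Function.update f w ∅) m w.1

/-- The user `w` sends in the slot `n`, and belongs to the class `i`: its type is `i.1`, and
`i.2` tells whether all messages from its other slots are erasures. -/
def InClass (ℓ : ℕ) (f : Frame K N) (n : Fin N) (i : Fin T × Bool) (w : User K) : Prop :=
  w.1 = i.1 ∧ n ∈ f w ∧ (UserErased ℓ f w n ↔ i.2 = true)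

open Classical in
/-- The number of users of class `i` in the slot `n`. -/
noncomputable def cavityCount (ℓ : ℕ) (f : Frame K N) (n : Fin N) (i : Fin T × Bool) : ℕ :=
  (Finset.univ.filter (InClass ℓ f n i)).card

theorem cavityErased_succ (ℓ : ℕ) (f : Frame K N) (n : Fin N) (t : Fin T) :
    cavityErased (ℓ + 1) f n t ↔ ¬ IsDecodable t (fun s => (if s = t then 1 else 0) +
      cavityCount ℓ f n (s, true)) := by
  classical
  rw [cavityErased]
  refine not_congr (iff_of_eq ?_)
  congr 1
  funext s
  congr 1
  unfold cavityCount
  congr 1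
  ext w
  simp only [Finset.mem_filter, Finset.mem_univ, true_and, InClass, UserErased, iff_true]

/-- The exploration of the frame from the slot `n` up to depth `ℓ`, which deletes the visited
users, comes back to an already visited slot or meets one of the slots of `X`. The starting slot
itself is not tested. -/
def Clash : ℕ → Frame K N → Finset (Fin N) → Fin N → Prop
  | 0, _, _, _ => False
  | ℓ + 1, f, X, n => ∃ z, n ∈ f z ∧ ∃ m ∈ f z, m ≠ n ∧
      (m ∈ X ∨ Clash ℓ (Function.update f z ∅) (X ∪ f z) m)

theorem Clash.succ : ∀ {ℓ : ℕ} {f : Frame K N} {X : Finset (Fin N)} {n : Fin N},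
    Clash ℓ f X n → Clash (ℓ + 1) f X n
  | 0, _, _, _, h => h.elim
  | _ + 1, _, _, _, ⟨z, hz, m, hm, hmn, h⟩ => ⟨z, hz, m, hm, hmn, h.imp id Clash.succ⟩

/-- A user at distance more than `ℓ` from the slot `p` does not influence the message. -/
theorem cavityErased_update_iff : ∀ {ℓ : ℕ} {g : Frame K N} {w : User K} {X : Finset (Fin N)}
    {p : Fin N} (_ : p ∉ g w) (_ : g w ⊆ X)
    (_ : ¬ Clash ℓ (Function.update g w ∅) X p) (t : Fin T),
    cavityErased ℓ g p t ↔ cavityErased ℓ (Function.update g w ∅) p t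
  | 0, _, _, _, _, _, _, _, _ => Iff.rfl
  | ℓ + 1, g, w, X, p, hp, hX, hC, t => by
    rw [cavityErased, cavityErased]
    refine not_congr (iff_of_eq ?_)
    congr 1
    funext s
    congr 2
    ext z
    simp only [Finset.mem_filter, Finset.mem_univ, true_and]
    by_cases hzw : z = w
    · subst hzw
      simp [hp]
    · rw [Function.update_of_ne hzw]
      refine and_congr_right fun hzs => and_congr_right fun hpz => ?_
      refine forall₂_congr fun m hm => forall_congr' fun hmp => ?_
      have hgz : (Function.update g w ∅) z = g z := Function.update_of_ne hzw _ _
      have hno : ¬ (m ∈ X ∨ Clash ℓ (Function.update (Function.update g w ∅) z ∅) (X ∪ g z) m) :=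
        fun h => hC ⟨z, by rwa [hgz], m, by rwa [hgz], hmp, by rwa [hgz]⟩
      push Not at hno
      have hgw : (Function.update g z ∅) w = g w := Function.update_of_ne (Ne.symm hzw) _ _
      rw [Function.update_comm (Ne.symm hzw)] at hno ⊢
      refine cavityErased_update_iff (X := X ∪ g z) ?_ ?_ hno.2 z.1
      · rw [hgw]
        exact fun h => hno.1 (hX h)
      · rw [hgw]
        exact hX.trans Finset.subset_union_left

theorem cavityErased_update_iff' {ℓ : ℕ} {g : Frame K N} {w : User K} {p : Fin N} (hp : p ∉ g w)
    (h : ¬ Clash (ℓ + 1) (Function.update g w ∅) (g w) p) (t : Fin T) :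
    cavityErased ℓ g p t ↔ cavityErased ℓ (Function.update g w ∅) p t :=
  cavityErased_update_iff hp subset_rfl (fun hc => h hc.succ) t

open Classical in
/-- In the absence of a clash, a user only counts in its own slots. -/
theorem cavityCount_eq_add {ℓ : ℕ} {g : Frame K N} {w : User K} {p : Fin N}
    (hC : ¬ Clash (ℓ + 1) (Function.update g w ∅) (g w) p) (i : Fin T × Bool) :
    cavityCount ℓ g p i = cavityCount ℓ (Function.update g w ∅) p i +
      if InClass ℓ g p i w then 1 else 0 := by
  have hsame : ∀ z, z ≠ w → (InClass ℓ g p i z ↔ InClass ℓ (Function.update g w ∅) p i z) := by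
    intro z hzw
    have hgz : (Function.update g w ∅) z = g z := Function.update_of_ne hzw _ _
    unfold InClass UserErased
    rw [hgz]
    refine and_congr_right fun hzs => and_congr_right fun hpz => ?_
    refine iff_congr ?_ Iff.rfl
    refine forall₂_congr fun m hm => forall_congr' fun hmp => ?_
    have hno : ¬ (m ∈ g w ∨
        Clash ℓ (Function.update (Function.update g w ∅) z ∅) (g w ∪ g z) m) :=
      fun h => hC ⟨z, by rwa [hgz], m, by rwa [hgz], hmp, by rwa [hgz]⟩
    push Not at hno
    have hgw : (Function.update g z ∅) w = g w := Function.update_of_ne (Ne.symm hzw) _ _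
    rw [Function.update_comm (Ne.symm hzw)] at hno ⊢
    refine cavityErased_update_iff (X := g w ∪ g z) ?_ ?_ hno.2 z.1
    · rw [hgw]
      exact hno.1
    · rw [hgw]
      exact Finset.subset_union_left
  have hw : ¬ InClass ℓ (Function.update g w ∅) p i w := by
    simp [InClass]
  unfold cavityCount
  split_ifs with h
  · have : Finset.univ.filter (InClass ℓ g p i) =
        insert w (Finset.univ.filter (InClass ℓ (Function.update g w ∅) p i)) := by
      ext z
      by_cases hz : z = w
      · subst hz
        simp [h]
      · simp [hz, hsame z hz]
    rw [this, Finset.card_insert_of_notMem (by simp [hw])]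
  · rw [add_zero]
    congr 1
    ext z
    by_cases hz : z = w
    · subst hz
      simp [h, hw]
    · simp [hsame z hz]

/-- The frame with the users of `Z` deleted. -/
def deleteUsers (Z : Finset (User K)) (f : Frame K N) : Frame K N :=
  fun u => if u ∈ Z then ∅ else f u

theorem deleteUsers_insert (Z : Finset (User K)) (z : User K) (f : Frame K N) :
    deleteUsers (insert z Z) f = Function.update (deleteUsers Z f) z ∅ := by
  funext u
  by_cases h : u = z
  · subst h
    simp [deleteUsers]
  · simp [deleteUsers, h]

theorem deleteUsers_update {Z : Finset (User K)} {z : User K} (hz : z ∈ Z) (f : Frame K N)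
    (S : Finset (Fin N)) : deleteUsers Z (Function.update f z S) = deleteUsers Z f := by
  funext u
  by_cases h : u = z
  · subst h
    simp [deleteUsers, hz]
  · simp [deleteUsers, h]

theorem deleteUsers_empty (f : Frame K N) : deleteUsers ∅ f = f := by
  funext u
  simp [deleteUsers]

theorem deleteUsers_singleton (z : User K) (f : Frame K N) :
    deleteUsers {z} f = Function.update f z ∅ := by
  rw [← insert_empty_eq, deleteUsers_insert, deleteUsers_empty]

/-- In the absence of a clash, the message of belief propagation to a user `u` that has been
reached through the users of `Y` is the cavity message. -/
theorem slotErased_iff_cavityErased : ∀ {ℓ : ℕ} {f : Frame K N} {Y : Finset (User K)}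
    {X : Finset (Fin N)} {u : User K} {n : Fin N} (_ : u ∈ Y) (_ : n ∈ f u)
    (_ : ∀ y ∈ Y, y ≠ u → n ∉ f y) (_ : ∀ y ∈ Y, f y ⊆ X)
    (_ : ¬ Clash ℓ (deleteUsers Y f) X n),
    slotErased f ℓ u n ↔ cavityErased ℓ (deleteUsers Y f) n u.1
  | 0, _, _, _, _, _, _, _, _, _, _ => Iff.rfl
  | ℓ + 1, f, Y, X, u, n, hu, hn, hY, hX, hC => by
    classical
    rw [slotErased, cavityErased]
    refine not_congr (iff_of_eq ?_)
    congr 1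
    funext s
    have key : ∀ w : User K, w ≠ u → n ∈ f w →
        ((∀ m ∈ f w, m ≠ n → slotErased f ℓ w m) ↔ (n ∈ deleteUsers Y f w ∧
          ∀ m ∈ deleteUsers Y f w, m ≠ n →
            cavityErased ℓ (Function.update (deleteUsers Y f) w ∅) m w.1)) := by
      intro w hwu hnw
      have hwY : w ∉ Y := fun h => hY w h hwu hnw
      have hfw : deleteUsers Y f w = f w := by simp [deleteUsers, hwY]
      rw [hfw, and_iff_right hnw]
      refine forall₂_congr fun m hm => forall_congr' fun hmn => ?_
      have hno : ¬ (m ∈ X ∨ Clash ℓ (Function.update (deleteUsers Y f) w ∅) (X ∪ f w) m) :=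
        fun h => hC ⟨w, by rwa [hfw], m, by rwa [hfw], hmn, by rwa [hfw]⟩
      push Not at hno
      rw [← deleteUsers_insert] at hno ⊢
      refine slotErased_iff_cavityErased (X := X ∪ f w) (Finset.mem_insert_self w Y) hm ?_ ?_ hno.2
      · intro y hy hyw hmy
        exact hno.1 (hX y (Finset.mem_of_mem_insert_of_ne hy hyw) hmy)
      · intro y hy
        rcases Finset.mem_insert.1 hy with rfl | hy
        · exact Finset.subset_union_right
        · exact (hX y hy).trans Finset.subset_union_left
    have hdel : ∀ w : User K, n ∈ deleteUsers Y f w → w ≠ u ∧ n ∈ f w := by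
      intro w hw
      by_cases hwY : w ∈ Y
      · simp [deleteUsers, hwY] at hw
      · exact ⟨fun h => hwY (h ▸ hu), by simpa [deleteUsers, hwY] using hw⟩
    have hrest : pattern f n {w | w = u ∨ ∀ m ∈ f w, m ≠ n → slotErased f ℓ w m} s =
        (Finset.univ.filter (fun w : User K => w.1 = s ∧ w = u)).card +
        (Finset.univ.filter (fun w : User K => w.1 = s ∧ n ∈ deleteUsers Y f w ∧
          ∀ m ∈ deleteUsers Y f w, m ≠ n →
            cavityErased ℓ (Function.update (deleteUsers Y f) w ∅) m w.1)).card := by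
      unfold pattern
      rw [← Finset.card_union_of_disjoint]
      · congr 1
        ext w
        simp only [Finset.mem_filter, Finset.mem_univ, true_and, Finset.mem_union,
          Set.mem_ofPred_eq]
        by_cases hwu : w = u
        · subst hwu
          simp only [true_or, and_true, hn]
          constructor
          · exact fun h => Or.inl h
          · rintro (h | h)
            · exact h
            · exact h.1
        · simp only [hwu, false_or, and_false]
          refine and_congr_right fun _ => ?_
          constructor
          · rintro ⟨h1, h2⟩
            exact (key w hwu h1).1 h2
          · intro h
            have h1 := (hdel w h.1).2
            exact ⟨h1, (key w hwu h1).2 h⟩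
      · rw [Finset.disjoint_left]
        intro w hw hw'
        simp only [Finset.mem_filter, Finset.mem_univ, true_and] at hw hw'
        exact (hdel w hw'.2.1).1 hw.2
    rw [hrest]
    congr 1
    by_cases hs : s = u.1
    · rw [if_pos hs, Finset.card_eq_one]
      refine ⟨u, ?_⟩
      ext w
      simp only [Finset.mem_filter, Finset.mem_univ, true_and, Finset.mem_singleton]
      exact ⟨fun h => h.2, fun h => ⟨h ▸ hs.symm, h⟩⟩
    · rw [if_neg hs, Finset.card_eq_zero]
      refine Finset.filter_eq_empty_iff.2 ?_
      rintro w - ⟨h1, rfl⟩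
      exact hs h1.symm

/-- The constant in the bound of order `1 / N` for the probability of a clash, when there are at
most `κ * N` users of degree at most `D`, and `B` slots to be avoided. -/
def clashBound (D : ℕ) (κ : ℝ) : ℕ → ℕ → ℝ
  | 0, _ => 0
  | ℓ + 1, B => κ * D ^ 2 * (B + clashBound D κ ℓ (B + D))

theorem clashBound_nonneg (D : ℕ) {κ : ℝ} (hκ : 0 ≤ κ) : ∀ ℓ B, 0 ≤ clashBound D κ ℓ B
  | 0, _ => le_rfl
  | ℓ + 1, B => by
    have := clashBound_nonneg D hκ ℓ (B + D)
    rw [clashBound]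
    positivity

theorem clashBound_mono (D : ℕ) {κ : ℝ} (hκ : 0 ≤ κ) : ∀ ℓ, Monotone (clashBound D κ ℓ)
  | 0 => fun _ _ _ => le_rfl
  | ℓ + 1 => fun a b h => by
    have h1 := clashBound_mono D hκ ℓ (Nat.add_le_add_right h D)
    have h2 : (a : ℝ) ≤ b := by exact_mod_cast h
    rw [clashBound, clashBound]
    gcongr

variable {L : Fin T → PMF ℕ} {D : ℕ}

/-- Short cycles are rare. Every step of the exploration chooses the slots of one new user afresh,
and such a user meets two given slots with probability of order `1 / N ^ 2`. -/
theorem frameProb_clash_le (hD : ∀ t d, D < d → L t d = 0) (hN : D ≤ N) {κ : ℝ} (hκ : 0 ≤ κ)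
    (hK : (Fintype.card (User K) : ℝ) ≤ κ * N) :
    ∀ (ℓ : ℕ) (Z : Finset (User K)) (X : Finset (Fin N)) (n : Fin N),
      frameProb L K N (fun f => Clash ℓ (deleteUsers Z f) X n) ≤ clashBound D κ ℓ X.card / N
  | 0, Z, X, n => by
    simp [Clash, frameProb, frameExp, clashBound]
  | ℓ + 1, Z, X, n => by
    classical
    have hNpos : (0 : ℝ) < N := by
      have := n.2
      exact_mod_cast (by omega : 0 < N)
    set C := clashBound D κ ℓ (X.card + D) with hC
    have hC0 : 0 ≤ C := clashBound_nonneg D hκ ℓ _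
    -- the first step of the exploration goes through the user `z` to the slot `m`
    have hstep : ∀ (z : User K) (m : Fin N), frameProb L K N (fun f => m ≠ n ∧ z ∉ Z ∧ n ∈ f z ∧
        m ∈ f z ∧ (m ∈ X ∨ Clash ℓ (deleteUsers (insert z Z) f) (X ∪ f z) m)) ≤
        (D : ℝ) ^ 2 / N ^ 2 * ((if m ∈ X then 1 else 0) + C / N) := by
      intro z m
      by_cases hmn : m = n
      · have h0 : frameProb L K N (fun f => m ≠ n ∧ z ∉ Z ∧ n ∈ f z ∧
            m ∈ f z ∧ (m ∈ X ∨ Clash ℓ (deleteUsers (insert z Z) f) (X ∪ f z) m)) = 0 := by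
          simp [hmn, frameProb, frameExp]
        rw [h0]
        split_ifs <;> positivity
      refine (frameProb_le_of_resample hD hN z (Finset.univ.filter fun S => n ∈ S ∧ m ∈ S)
        (fun S f => m ∈ X ∨ Clash ℓ (deleteUsers (insert z Z) f) (X ∪ S) m)
        (b := (if m ∈ X then 1 else 0) + C / N) ?_ ?_).trans ?_
      · rintro f S ⟨-, -, h1, h2, h3⟩
        rw [Function.update_self] at h1 h2 h3
        rw [deleteUsers_update (Finset.mem_insert_self z Z)] at h3
        exact ⟨by simp [h1, h2], h3⟩
      · intro S _ hS
        refine (frameProb_or_le _ _).trans (add_le_add ?_ ?_)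
        · split_ifs with hm
          · exact frameProb_le_one hD hN _
          · simp [hm, frameProb, frameExp]
        · refine (frameProb_clash_le hD hN hκ hK ℓ (insert z Z) (X ∪ S) m).trans ?_
          have := clashBound_mono D hκ ℓ ((Finset.card_union_le X S).trans
            (Nat.add_le_add_left hS _))
          gcongr
      · refine mul_le_mul_of_nonneg_right (sum_userWeight_mem_mem_le hD hN z.1 hmn) ?_
        split_ifs <;> positivity
    calc frameProb L K N (fun f => Clash (ℓ + 1) (deleteUsers Z f) X n)
        ≤ frameProb L K N (fun f => ∃ a ∈ (Finset.univ : Finset (User K × Fin N)),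
            a.2 ≠ n ∧ a.1 ∉ Z ∧ n ∈ f a.1 ∧ a.2 ∈ f a.1 ∧
              (a.2 ∈ X ∨ Clash ℓ (deleteUsers (insert a.1 Z) f) (X ∪ f a.1) a.2)) := by
          refine frameProb_mono fun f hf => ?_
          obtain ⟨z, hz, m, hm, hmn, h⟩ := hf
          have hzZ : z ∉ Z := fun h => by simp [deleteUsers, h] at hz
          have hfz : deleteUsers Z f z = f z := by simp [deleteUsers, hzZ]
          rw [hfz] at hz hm h
          rw [← deleteUsers_insert] at h
          exact ⟨(z, m), Finset.mem_univ _, hmn, hzZ, hz, hm, h⟩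
      _ ≤ ∑ a : User K × Fin N, (D : ℝ) ^ 2 / N ^ 2 * ((if a.2 ∈ X then 1 else 0) + C / N) :=
          (frameProb_exists_le _ _).trans (Finset.sum_le_sum fun a _ => hstep a.1 a.2)
      _ = Fintype.card (User K) * ((D : ℝ) ^ 2 / N ^ 2 * (X.card + C)) := by
          refine (Fintype.sum_prod_type' (fun (_ : User K) (m : Fin N) =>
            (D : ℝ) ^ 2 / N ^ 2 * ((if m ∈ X then 1 else 0) + C / N))).trans ?_
          rw [Finset.sum_const, Finset.card_univ, nsmul_eq_mul, ← Finset.mul_sum,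
            Finset.sum_add_distrib]
          simp only [Finset.sum_ite_mem, Finset.univ_inter, Finset.sum_const, nsmul_eq_mul,
            mul_one, Finset.card_univ, Fintype.card_fin]
          congr 3
          field_simp
      _ ≤ κ * N * ((D : ℝ) ^ 2 / N ^ 2 * (X.card + C)) := by gcongr
      _ = clashBound D κ (ℓ + 1) X.card / N := by
          rw [clashBound, ← hC]
          field_simp

/-- The event that the user `w`, or its new set `S` of slots, lies close to one of the slots of
`P`. -/
def Interferes (ℓ : ℕ) (f : Frame K N) (w : User K) (S P : Finset (Fin N)) : Prop :=
  ∃ p ∈ P, p ∈ f w ∨ Clash (ℓ + 1) (Function.update f w ∅) (f w) p ∨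
    Clash (ℓ + 1) (Function.update f w ∅) S p

theorem frameProb_interferes_le (hD : ∀ t d, D < d → L t d = 0) (hN : D ≤ N) {κ : ℝ} (hκ : 0 ≤ κ)
    (hK : (Fintype.card (User K) : ℝ) ≤ κ * N) (ℓ : ℕ) (w : User K) {S : Finset (Fin N)}
    (hS : S.card ≤ D) (P : Finset (Fin N)) :
    frameProb L K N (fun f => Interferes ℓ f w S P) ≤
      P.card * (D + 2 * clashBound D κ (ℓ + 1) D) / N := by
  have hb : ∀ S' : Finset (Fin N), S'.card ≤ D → ∀ p : Fin N,
      frameProb L K N (fun f => Clash (ℓ + 1) (Function.update f w ∅) S' p) ≤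
        clashBound D κ (ℓ + 1) D / N := by
    intro S' hS' p
    have := frameProb_clash_le hD hN hκ hK (ℓ + 1) {w} S' p
    simp only [deleteUsers_singleton] at this
    refine this.trans ?_
    gcongr
    exact clashBound_mono D hκ _ hS'
  have h1 : ∀ p : Fin N, frameProb L K N (fun f => p ∈ f w ∨
      Clash (ℓ + 1) (Function.update f w ∅) (f w) p ∨
      Clash (ℓ + 1) (Function.update f w ∅) S p) ≤
      (D + 2 * clashBound D κ (ℓ + 1) D) / N := by
    intro p
    have hc : frameProb L K N (fun f => Clash (ℓ + 1) (Function.update f w ∅) (f w) p) ≤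
        clashBound D κ (ℓ + 1) D / N := by
      refine (frameProb_le_of_resample hD hN w Finset.univ
        (fun S' f => Clash (ℓ + 1) (Function.update f w ∅) S' p)
        (fun f S' h => ⟨Finset.mem_univ _, by simpa using h⟩)
        fun S' _ hS' => hb S' hS' p).trans_eq ?_
      rw [sum_userWeight hD hN, one_mul]
    refine (frameProb_or_le _ _).trans ((add_le_add (frameProb_mem_le hD hN w p)
      ((frameProb_or_le _ _).trans (add_le_add hc (hb S hS p)))).trans_eq ?_)
    ring
  refine (frameProb_exists_le P _).trans ((Finset.sum_le_sum fun p _ => h1 p).trans_eq ?_)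
  rw [Finset.sum_const, nsmul_eq_mul, mul_div_assoc]

end Cavity

/-! ### Removing one user from the joint event -/

section Mecke

variable {T : ℕ} {K : Fin T → ℕ} {N : ℕ}

/-- The slots `n` of `M` have the class counts `c n`, and for the slots `m` of `M'` the message to
an additional user of type `τ m` is an erasure or not, as prescribed by `v m`. -/
def JointEvent (ℓ : ℕ) (M M' : Finset (Fin N)) (c : Fin N → Fin T × Bool → ℕ) (τ : Fin N → Fin T)
    (v : Fin N → Bool) (f : Frame K N) : Prop :=
  (∀ n ∈ M, ∀ i, cavityCount ℓ f n i = c n i) ∧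
    ∀ m ∈ M', (cavityErased ℓ f m (τ m) ↔ v m = true)

/-- Giving the user `w` a set `S` of slots that meets the slots under consideration in `n` only
adds one user to the class of `w` at `n`, and changes nothing else. -/
theorem JointEvent.update {ℓ : ℕ} {M M' : Finset (Fin N)} {c c₀ : Fin N → Fin T × Bool → ℕ}
    {τ : Fin N → Fin T} {v : Fin N → Bool} {f : Frame K N} {n : Fin N} {i : Fin T × Bool}
    (hc : ∀ j, c n j = c₀ n j + if j = i then 1 else 0) (hc' : ∀ m, m ≠ n → c m = c₀ m)
    (hn : n ∈ M) {w : User K} (hw : w.1 = i.1) {S : Finset (Fin N)} (hnS : n ∈ S)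
    (hS : ∀ m ∈ M ∪ M', m ≠ n → m ∉ S) (hnM' : n ∉ M')
    (hI : ¬ Interferes ℓ f w S (M ∪ M' ∪ S)) (h : JointEvent ℓ M M' c₀ τ v f)
    (hcl : (∀ m ∈ S, m ≠ n → cavityErased ℓ f m i.1) ↔ i.2 = true) :
    JointEvent ℓ M M' c τ v (Function.update f w S) ∧ InClass ℓ (Function.update f w S) n i w := by
  classical
  set g := Function.update f w S with hg
  have hgw : g w = S := Function.update_self ..
  have hgd : Function.update g w ∅ = Function.update f w ∅ := by rw [hg, Function.update_idem]
  unfold Interferes at hI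
  push Not at hI
  have hM : ∀ m ∈ M, m ∈ M ∪ M' ∪ S := fun m hm => by simp [hm]
  have hM' : ∀ m ∈ M', m ∈ M ∪ M' ∪ S := fun m hm => by simp [hm]
  have hSS : ∀ m ∈ S, m ∈ M ∪ M' ∪ S := fun m hm => by simp [hm]
  have hErf : ∀ p ∈ M ∪ M' ∪ S, ∀ t,
      (cavityErased ℓ f p t ↔ cavityErased ℓ (Function.update f w ∅) p t) := fun p hp t =>
    cavityErased_update_iff' (hI p hp).1 (hI p hp).2.1 t
  have hcountf : ∀ p ∈ M ∪ M' ∪ S, ∀ j,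
      cavityCount ℓ f p j = cavityCount ℓ (Function.update f w ∅) p j := by
    intro p hp j
    rw [cavityCount_eq_add (hI p hp).2.1 j, if_neg, add_zero]
    exact fun h => (hI p hp).1 h.2.1
  have hcountg : ∀ p ∈ M ∪ M' ∪ S, ∀ j, cavityCount ℓ g p j =
      cavityCount ℓ f p j + if InClass ℓ g p j w then 1 else 0 := by
    intro p hp j
    rw [cavityCount_eq_add (w := w) ?_ j, hgd, hcountf p hp]
    rw [hgd, hgw]
    exact (hI p hp).2.2
  have herased : UserErased ℓ g w n ↔ i.2 = true := by
    rw [← hcl, UserErased, hgw, hgd]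
    refine forall₂_congr fun m hm => forall_congr' fun _ => ?_
    rw [hw]
    exact (hErf m (hSS m hm) i.1).symm
  have hclass : ∀ j, InClass ℓ g n j w ↔ j = i := by
    intro j
    unfold InClass
    rw [herased, hgw, hw]
    constructor
    · rintro ⟨h1, -, h2⟩
      exact Prod.ext h1.symm (Bool.eq_iff_iff.2 h2.symm)
    · rintro rfl
      exact ⟨rfl, hnS, Iff.rfl⟩
  refine ⟨⟨fun m hm j => ?_, fun m hm => ?_⟩, (hclass i).2 rfl⟩
  · rw [hcountg m (hM m hm), h.1 m hm]
    by_cases hmn : m = n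
    · subst hmn
      rw [hc]
      simp only [hclass]
    · rw [hc' m hmn, if_neg, add_zero]
      intro hcon
      exact hS m (Finset.mem_union_left _ hm) hmn (hgw ▸ hcon.2.1)
  · have hmn : m ≠ n := fun h => hnM' (h ▸ hm)
    rw [← h.2 m hm, hErf m (hM' m hm), ← hgd]
    refine cavityErased_update_iff' ?_ ?_ _
    · rw [hgw]
      exact hS m (Finset.mem_union_right _ hm) hmn
    · rw [hgd, hgw]
      exact (hI m (hM' m hm)).2.2

variable {L : Fin T → PMF ℕ} {D : ℕ}

/-- Counting the users of the class `i` in the slot `n`. -/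
theorem count_mul_frameProb {ℓ : ℕ} {M M' : Finset (Fin N)} {c : Fin N → Fin T × Bool → ℕ}
    {τ : Fin N → Fin T} {v : Fin N → Bool} {n : Fin N} (hn : n ∈ M) (i : Fin T × Bool) :
    (c n i : ℝ) * frameProb L K N (JointEvent ℓ M M' c τ v) =
      ∑ w : User K, frameProb L K N
        (fun f => JointEvent ℓ M M' c τ v f ∧ InClass ℓ f n i w) := by
  classical
  unfold frameProb
  rw [← frameExp_const_mul, ← frameExp_sum]
  congr 1
  funext f
  by_cases h : JointEvent ℓ M M' c τ v f
  · simp only [h, if_true, true_and, mul_one, Finset.sum_boole]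
    rw [← h.1 n hn i, cavityCount]
  · simp [h]

/-- The constant in the bound of order `1 / N` for the probability that a user interferes with
`k` slots. -/
def interferenceBound (D : ℕ) (κ : ℝ) (ℓ k : ℕ) : ℝ := k * (D + 2 * clashBound D κ (ℓ + 1) D)

/-- A lower bound for the probability that the joint event holds with `w` in the class `i` at the
slot `n`, obtained by choosing the slots of `w` anew. Given that `w` sends in `n`, the set `S` of
its slots has size `d` with probability proportional to `d * L d`, the requirement that `w` be of
class `i` depends on the messages from the other slots of `S`, and all other cases and effects
have probability of order `1 / N`. -/
theorem frameProb_inClass_ge (hD : ∀ t d, D < d → L t d = 0) (hN : D ≤ N) {κ : ℝ} (hκ : 0 ≤ κ)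
    (hK : (Fintype.card (User K) : ℝ) ≤ κ * N) {ℓ k : ℕ} {M M' : Finset (Fin N)}
    {c c₀ : Fin N → Fin T × Bool → ℕ} {τ : Fin N → Fin T} {v : Fin N → Bool} {n : Fin N}
    {i : Fin T × Bool} (hc : ∀ j, c n j = c₀ n j + if j = i then 1 else 0)
    (hc' : ∀ m, m ≠ n → c m = c₀ m) (hn : n ∈ M) {w : User K} (hw : w.1 = i.1) (hnM' : n ∉ M')
    (hk : M.card + M'.card ≤ k) {ε p : ℝ} (hε : 0 ≤ ε) {g : ℕ → ℝ} (hg : ∀ d, p * g d ≤ 1)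
    (hp : ∀ S : Finset (Fin N), n ∈ S → S.card ≤ D → (∀ m ∈ M ∪ M', m ≠ n → m ∉ S) →
      p * g S.card - ε ≤ frameProb L K N (fun f => JointEvent ℓ M M' c₀ τ v f ∧
        ((∀ m ∈ S, m ≠ n → cavityErased ℓ f m i.1) ↔ i.2 = true))) :
    p * (∑ d ∈ Finset.range (D + 1), (L i.1 d).toReal * (d * g d)) / N -
        D / N * (ε + interferenceBound D κ ℓ (k + D) / N) - k * (D ^ 2 / N ^ 2) ≤
      frameProb L K N (fun f => JointEvent ℓ M M' c τ v f ∧ InClass ℓ f n i w) := by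
  classical
  set β := interferenceBound D κ ℓ (k + D) with hβ
  have hcb := clashBound_nonneg D hκ (ℓ + 1) D
  have hβ0 : 0 ≤ β := by
    rw [hβ, interferenceBound]
    positivity
  have hlow : ∀ S : Finset (Fin N), n ∈ S → userWeight L i.1 S * (p * g S.card) -
      userWeight L i.1 S * (ε + β / N) -
      ∑ m ∈ (M ∪ M').erase n, (if m ∈ S then userWeight L i.1 S else 0) ≤
      userWeight L i.1 S * frameProb L K N (fun f =>
        JointEvent ℓ M M' c τ v (Function.update f w S) ∧
          InClass ℓ (Function.update f w S) n i w) := by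
    intro S hnS
    have hw0 : 0 ≤ userWeight L i.1 S := userWeight_nonneg _ _
    have hsum0 : ∀ m ∈ (M ∪ M').erase n, 0 ≤ if m ∈ S then userWeight L i.1 S else 0 := by
      intro m _
      split_ifs
      · exact hw0
      · exact le_rfl
    rcases lt_or_ge D S.card with hSD | hSD
    · rw [userWeight_eq_zero hD _ hSD]
      simp
    by_cases hS : ∀ m ∈ M ∪ M', m ≠ n → m ∉ S
    · have h1 := hp S hnS hSD hS
      have h2 : frameProb L K N (fun f => JointEvent ℓ M M' c₀ τ v f ∧
          ((∀ m ∈ S, m ≠ n → cavityErased ℓ f m i.1) ↔ i.2 = true)) ≤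
          frameProb L K N (fun f => JointEvent ℓ M M' c τ v (Function.update f w S) ∧
            InClass ℓ (Function.update f w S) n i w) +
          frameProb L K N (fun f => Interferes ℓ f w S (M ∪ M' ∪ S)) := by
        refine (frameProb_mono fun f hf => ?_).trans (frameProb_or_le _ _)
        by_cases hI : Interferes ℓ f w S (M ∪ M' ∪ S)
        · exact Or.inr hI
        · exact Or.inl (JointEvent.update hc hc' hn hw hnS hS hnM' hI hf.1 hf.2)
      have h3 : frameProb L K N (fun f => Interferes ℓ f w S (M ∪ M' ∪ S)) ≤ β / N := by
        refine (frameProb_interferes_le hD hN hκ hK ℓ w hSD _).trans ?_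
        rw [hβ, interferenceBound]
        have : ((M ∪ M' ∪ S).card : ℝ) ≤ (k + D : ℕ) := by
          have h4 := Finset.card_union_le M M'
          have h5 := Finset.card_union_le (M ∪ M') S
          exact_mod_cast (by omega : (M ∪ M' ∪ S).card ≤ k + D)
        gcongr
      have h4 := Finset.sum_nonneg hsum0
      have h5 : userWeight L i.1 S * (p * g S.card - (ε + β / N)) ≤
          userWeight L i.1 S * frameProb L K N (fun f =>
            JointEvent ℓ M M' c τ v (Function.update f w S) ∧
            InClass ℓ (Function.update f w S) n i w) := by
        refine mul_le_mul_of_nonneg_left ?_ hw0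
        linarith
      linarith
    · push Not at hS
      obtain ⟨m, hm, hmn, hmS⟩ := hS
      have h4 : userWeight L i.1 S ≤
          ∑ m ∈ (M ∪ M').erase n, if m ∈ S then userWeight L i.1 S else 0 := by
        refine le_trans ?_ (Finset.single_le_sum hsum0 (Finset.mem_erase.2 ⟨hmn, hm⟩))
        rw [if_pos hmS]
      have h5 : userWeight L i.1 S * (p * g S.card) ≤ userWeight L i.1 S :=
        mul_le_of_le_one_right hw0 (hg _)
      have h6 : 0 ≤ userWeight L i.1 S * (ε + β / N) := by positivity
      have h7 : 0 ≤ userWeight L i.1 S * frameProb L K N (fun f =>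
            JointEvent ℓ M M' c τ v (Function.update f w S) ∧
            InClass ℓ (Function.update f w S) n i w) :=
        mul_nonneg hw0 (frameProb_nonneg _)
      linarith
  have hmain : ∑ S : Finset (Fin N) with n ∈ S, userWeight L i.1 S * (p * g S.card) =
      p * (∑ d ∈ Finset.range (D + 1), (L i.1 d).toReal * (d * g d)) / N := by
    rw [sum_userWeight_mem hD hN i.1 n (fun d => p * g d), Finset.mul_sum]
    congr 1
    exact Finset.sum_congr rfl fun d _ => by ring
  have hhit : ∑ S : Finset (Fin N) with n ∈ S, ∑ m ∈ (M ∪ M').erase n,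
      (if m ∈ S then userWeight L i.1 S else 0) ≤ k * (D ^ 2 / N ^ 2) := by
    rw [Finset.sum_comm]
    calc ∑ m ∈ (M ∪ M').erase n, ∑ S : Finset (Fin N) with n ∈ S,
          (if m ∈ S then userWeight L i.1 S else 0)
        ≤ ∑ m ∈ (M ∪ M').erase n, (D : ℝ) ^ 2 / N ^ 2 := by
          refine Finset.sum_le_sum fun m hm => ?_
          rw [← Finset.sum_filter, Finset.filter_filter]
          exact sum_userWeight_mem_mem_le hD hN i.1 (Finset.ne_of_mem_erase hm)
      _ ≤ k * (D ^ 2 / N ^ 2) := by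
          rw [Finset.sum_const, nsmul_eq_mul]
          have : (((M ∪ M').erase n).card : ℝ) ≤ k := by
            have h4 := Finset.card_union_le M M'
            have h5 := Finset.card_erase_le (s := M ∪ M') (a := n)
            exact_mod_cast (by omega : ((M ∪ M').erase n).card ≤ k)
          gcongr
  have hrest : ∑ S : Finset (Fin N) with n ∈ S, userWeight L i.1 S * (ε + β / N) ≤
      D / N * (ε + β / N) := by
    rw [← Finset.sum_mul]
    exact mul_le_mul_of_nonneg_right (sum_userWeight_mem_le hD hN i.1 n) (by positivity)
  rw [frameProb_resample hD hN w, hw]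
  calc _ ≤ ∑ S : Finset (Fin N) with n ∈ S, (userWeight L i.1 S * (p * g S.card) -
        userWeight L i.1 S * (ε + β / N) -
        ∑ m ∈ (M ∪ M').erase n, (if m ∈ S then userWeight L i.1 S else 0)) := by
        rw [Finset.sum_sub_distrib, Finset.sum_sub_distrib, hmain]
        linarith
    _ ≤ ∑ S : Finset (Fin N) with n ∈ S, userWeight L i.1 S * frameProb L K N (fun f =>
          JointEvent ℓ M M' c τ v (Function.update f w S) ∧
            InClass ℓ (Function.update f w S) n i w) :=
        Finset.sum_le_sum fun S hS => hlow S (Finset.mem_filter.1 hS).2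
    _ ≤ _ := Finset.sum_le_sum_of_subset_of_nonneg (Finset.filter_subset _ _)
        fun S _ _ => mul_nonneg (userWeight_nonneg _ _) (frameProb_nonneg _)

/-- The lower bound summed over all users of the right type. -/
theorem frameProb_jointEvent_ge (hD : ∀ t d, D < d → L t d = 0) (hN : D ≤ N) {κ : ℝ} (hκ : 0 ≤ κ)
    (hK : (Fintype.card (User K) : ℝ) ≤ κ * N) {ℓ k : ℕ} {M M' : Finset (Fin N)}
    {c c₀ : Fin N → Fin T × Bool → ℕ} {τ : Fin N → Fin T} {v : Fin N → Bool} {n : Fin N}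
    {i : Fin T × Bool} (hc : ∀ j, c n j = c₀ n j + if j = i then 1 else 0)
    (hc' : ∀ m, m ≠ n → c m = c₀ m) (hn : n ∈ M) (hnM' : n ∉ M')
    (hk : M.card + M'.card ≤ k) {ε p : ℝ} (hε : 0 ≤ ε) {g : ℕ → ℝ} (hg : ∀ d, p * g d ≤ 1)
    (hp : ∀ S : Finset (Fin N), n ∈ S → S.card ≤ D → (∀ m ∈ M ∪ M', m ≠ n → m ∉ S) →
      p * g S.card - ε ≤ frameProb L K N (fun f => JointEvent ℓ M M' c₀ τ v f ∧
        ((∀ m ∈ S, m ≠ n → cavityErased ℓ f m i.1) ↔ i.2 = true))) :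
    (K i.1 : ℝ) / N * (p * (∑ d ∈ Finset.range (D + 1), (L i.1 d).toReal * (d * g d)) -
        (D * (ε + interferenceBound D κ ℓ (k + D) / N) + k * (D ^ 2 / N))) ≤
      c n i * frameProb L K N (JointEvent ℓ M M' c τ v) := by
  classical
  rw [count_mul_frameProb hn, Fintype.sum_sigma]
  refine le_trans ?_ (Finset.single_le_sum (fun t _ => Finset.sum_nonneg fun j _ =>
    frameProb_nonneg _) (Finset.mem_univ i.1))
  have h := fun j : Fin (K i.1) => frameProb_inClass_ge hD hN hκ hK hc hc' hn
    (w := (⟨i.1, j⟩ : User K)) rfl hnM' hk hε hg hp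
  refine le_trans (le_of_eq ?_) (Finset.sum_le_sum fun j _ => h j)
  rw [Finset.sum_const, Finset.card_univ, Fintype.card_fin, nsmul_eq_mul]
  have hNpos : (N : ℝ) ≠ 0 := by
    have := n.2
    exact_mod_cast (by omega : N ≠ 0)
  field_simp
  ring

end Mecke

/-! ### Limits of the probabilities of joint events -/

section Limit

/-- The probability of the counts `c` for independent Poisson variables with means `ν`. -/
noncomputable def poissonWeight {ι : Type*} [Fintype ι] (ν : ι → ℝ) (c : ι → ℕ) : ℝ :=
  ∏ i, Real.exp (-ν i) * ν i ^ c i / ((c i)! : ℝ)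

theorem poissonWeight_nonneg {ι : Type*} [Fintype ι] {ν : ι → ℝ} (hν : ∀ i, 0 ≤ ν i) (c : ι → ℕ) :
    0 ≤ poissonWeight ν c :=
  Finset.prod_nonneg fun i _ => by
    have := hν i
    positivity

theorem poissonWeight_le_one {ι : Type*} [Fintype ι] {ν : ι → ℝ} (hν : ∀ i, 0 ≤ ν i)
    (c : ι → ℕ) : poissonWeight ν c ≤ 1 := by
  refine Finset.prod_le_one (fun i _ => ?_) fun i _ => ?_
  · have := hν i
    positivity
  · have h := Real.pow_div_factorial_le_exp (ν i) (hν i) (c i)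
    rw [mul_div_assoc]
    calc Real.exp (-ν i) * (ν i ^ c i / ((c i)! : ℝ)) ≤ Real.exp (-ν i) * Real.exp (ν i) := by
          gcongr
      _ = 1 := by rw [← Real.exp_add, neg_add_cancel, Real.exp_zero]

theorem poissonWeight_zero {ι : Type*} [Fintype ι] (ν : ι → ℝ) :
    poissonWeight ν (fun _ => 0) = Real.exp (-∑ i, ν i) := by
  simp [poissonWeight, Real.exp_sum, ← Finset.sum_neg_distrib]

/-- The recursion that characterizes the Poisson weights. -/
theorem poissonWeight_mul_rate {ι : Type*} [Fintype ι] [DecidableEq ι] (ν : ι → ℝ) {c c₀ : ι → ℕ}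
    {i : ι} (hc : ∀ j, c j = c₀ j + if j = i then 1 else 0) :
    poissonWeight ν c₀ * ν i = c i * poissonWeight ν c := by
  unfold poissonWeight
  rw [← Finset.mul_prod_erase _ _ (Finset.mem_univ i),
    ← Finset.mul_prod_erase (Finset.univ) (fun j => Real.exp (-ν j) * ν j ^ c j / ((c j)! : ℝ))
      (Finset.mem_univ i)]
  have h : ∏ j ∈ Finset.univ.erase i, Real.exp (-ν j) * ν j ^ c j / ((c j)! : ℝ) =
      ∏ j ∈ Finset.univ.erase i, Real.exp (-ν j) * ν j ^ c₀ j / ((c₀ j)! : ℝ) :=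
    Finset.prod_congr rfl fun j hj => by rw [hc j, if_neg (Finset.ne_of_mem_erase hj), add_zero]
  rw [h, hc i, if_pos rfl, Nat.factorial_succ]
  push_cast
  have h1 : ((c₀ i)! : ℝ) ≠ 0 := by positivity
  have h2 : (c₀ i : ℝ) + 1 ≠ 0 := by positivity
  field_simp
  ring

/-- The probability that a message of type `t` is an erasure (`b = true`) or not. -/
def erasureLaw {T : ℕ} (y : Fin T → ℝ) (t : Fin T) (b : Bool) : ℝ := if b then y t else 1 - y t

/-- The probability that the messages from all further slots of a user of degree `d` are erasures
(`b = true`), or that one of them is not. -/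
def allErasedLaw (x : ℝ) (b : Bool) (d : ℕ) : ℝ := if b then x ^ (d - 1) else 1 - x ^ (d - 1)

variable {T : ℕ}

/-- The mean number of users of class `i` in a slot, in the limit. -/
def classRate (L : Fin T → PMF ℕ) (D : ℕ) (η y : Fin T → ℝ) (i : Fin T × Bool) : ℝ :=
  η i.1 * ∑ d ∈ Finset.range (D + 1), (L i.1 d).toReal * (d * allErasedLaw (y i.1) i.2 d)

/-- In the limit the class counts at different slots are independent and Poisson distributed, and
independent of the messages from further slots; only the lower bounds are needed. The total of the
counts is `B`, and the estimate is uniform over the slots. -/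
def JointLimit (L : Fin T → PMF ℕ) (D : ℕ) (η : Fin T → ℝ) (K : ℕ → Fin T → ℕ) (y : Fin T → ℝ)
    (ℓ B : ℕ) : Prop :=
  ∀ (k : ℕ) (ε : ℝ), 0 < ε → ∀ᶠ N : ℕ in atTop, ∀ (M M' : Finset (Fin N))
    (c : Fin N → Fin T × Bool → ℕ) (τ : Fin N → Fin T) (v : Fin N → Bool),
    Disjoint M M' → M.card ≤ k → M'.card ≤ k → ∑ n ∈ M, ∑ i, c n i = B →
    (∏ n ∈ M, poissonWeight (classRate L D η y) (c n)) * ∏ m ∈ M', erasureLaw y (τ m) (v m) - ε ≤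
      frameProb L (K N) N (JointEvent ℓ M M' c τ v)

theorem erasureLaw_mem_Icc {y : Fin T → ℝ} (hy : ∀ t, y t ∈ Set.Icc (0 : ℝ) 1) (t : Fin T)
    (b : Bool) : erasureLaw y t b ∈ Set.Icc (0 : ℝ) 1 := by
  obtain ⟨h1, h2⟩ := hy t
  unfold erasureLaw
  cases b <;> simp [h1, h2]

theorem allErasedLaw_mem_Icc {x : ℝ} (hx : x ∈ Set.Icc (0 : ℝ) 1) (b : Bool) (d : ℕ) :
    allErasedLaw x b d ∈ Set.Icc (0 : ℝ) 1 := by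
  have h1 : 0 ≤ x ^ (d - 1) := pow_nonneg hx.1 _
  have h2 : x ^ (d - 1) ≤ 1 := pow_le_one₀ hx.1 hx.2
  unfold allErasedLaw
  cases b <;> simp [h1, h2]

theorem classSum_mem_Icc {L : Fin T → PMF ℕ} {D : ℕ} (hD : ∀ t d, D < d → L t d = 0) (t : Fin T)
    {g : ℕ → ℝ} (hg : ∀ d, g d ∈ Set.Icc (0 : ℝ) 1) :
    ∑ d ∈ Finset.range (D + 1), (L t d).toReal * (d * g d) ∈ Set.Icc (0 : ℝ) D := by
  constructor
  · exact Finset.sum_nonneg fun d _ =>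
      mul_nonneg ENNReal.toReal_nonneg (mul_nonneg (Nat.cast_nonneg d) (hg d).1)
  · calc ∑ d ∈ Finset.range (D + 1), (L t d).toReal * (d * g d)
        ≤ ∑ d ∈ Finset.range (D + 1), (L t d).toReal * D := by
          refine Finset.sum_le_sum fun d hd => ?_
          have h1 : (d : ℝ) ≤ D := by exact_mod_cast Nat.lt_succ_iff.1 (Finset.mem_range.1 hd)
          have h2 : (d : ℝ) * g d ≤ d := mul_le_of_le_one_right (Nat.cast_nonneg d) (hg d).2
          exact mul_le_mul_of_nonneg_left (h2.trans h1) ENNReal.toReal_nonneg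
      _ = D := by rw [← Finset.sum_mul, sum_range_pmf hD t le_rfl, one_mul]

theorem classRate_nonneg {L : Fin T → PMF ℕ} {D : ℕ} (hD : ∀ t d, D < d → L t d = 0)
    {η y : Fin T → ℝ} (hη : ∀ t, 0 ≤ η t) (hy : ∀ t, y t ∈ Set.Icc (0 : ℝ) 1)
    (i : Fin T × Bool) : 0 ≤ classRate L D η y i :=
  mul_nonneg (hη _) (classSum_mem_Icc hD i.1 (allErasedLaw_mem_Icc (hy i.1) i.2)).1

theorem sum_powerset_prod_ite {α : Type*} [DecidableEq α] (x : ℝ) (A : Finset α) :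
    ∑ V ∈ A.powerset, ∏ m ∈ A, (if m ∈ V then x else 1 - x) = 1 := by
  have h := Finset.prod_add (fun _ : α => x) (fun _ => 1 - x) A
  simp only [add_sub_cancel, Finset.prod_const_one] at h
  refine Eq.trans (Finset.sum_congr rfl fun V hV => ?_) h.symm
  rw [Finset.prod_ite, Finset.filter_mem_eq_inter,
    Finset.inter_eq_right.2 (Finset.mem_powerset.1 hV), Finset.filter_notMem_eq_sdiff]

/-- Summing over the sets `V` of those messages, out of a family `A` of independent ones, that are
erasures. -/
theorem sum_powerset_erased {α : Type*} [DecidableEq α] (x : ℝ) (A : Finset α) (b : Bool) :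
    ∑ V ∈ A.powerset with (V = A ↔ b = true), ∏ m ∈ A, (if m ∈ V then x else 1 - x) =
      allErasedLaw x b (A.card + 1) := by
  have hA : A.powerset.filter (· = A) = {A} := by
    ext V
    simp only [Finset.mem_filter, Finset.mem_powerset, Finset.mem_singleton]
    exact ⟨fun h => h.2, fun h => ⟨h.subset, h⟩⟩
  have hall : ∑ V ∈ A.powerset with V = A, ∏ m ∈ A, (if m ∈ V then x else 1 - x) =
      x ^ A.card := by
    rw [hA, Finset.sum_singleton, Finset.prod_congr rfl fun m hm => if_pos hm, Finset.prod_const]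
  have htot := sum_powerset_prod_ite x A
  rw [← Finset.sum_filter_add_sum_filter_not _ (· = A), hall] at htot
  cases b
  · simp only [Bool.false_eq_true, iff_false, allErasedLaw, if_false, Nat.add_sub_cancel]
    linarith
  · simp only [iff_true, allErasedLaw, if_true, Nat.add_sub_cancel]
    exact hall

/-- The probability that moreover all or not all of the messages from the slots of `A` to a user
of type `t` are erasures, bounded below through the possible values of all these messages. -/
theorem jointLimit_extend {L : Fin T → PMF ℕ} {D k ℓ : ℕ} {K : Fin T → ℕ} {N : ℕ}
    {y : Fin T → ℝ} {W ε : ℝ} {M M' A : Finset (Fin N)} {c : Fin N → Fin T × Bool → ℕ}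
    {τ : Fin N → Fin T} {v : Fin N → Bool} (t : Fin T) (b : Bool) (hε : 0 ≤ ε)
    (hA : A.card ≤ D) (hM'A : Disjoint M' A) (hMA : Disjoint M (M' ∪ A)) (hM' : M'.card ≤ k)
    (h : ∀ (M'' : Finset (Fin N)) (τ' : Fin N → Fin T) (v' : Fin N → Bool), Disjoint M M'' →
      M''.card ≤ k + D → W * ∏ m ∈ M'', erasureLaw y (τ' m) (v' m) - ε ≤
        frameProb L K N (JointEvent ℓ M M'' c τ' v')) :
    W * (∏ m ∈ M', erasureLaw y (τ m) (v m)) * allErasedLaw (y t) b (A.card + 1) - 2 ^ D * ε ≤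
      frameProb L K N (fun f => JointEvent ℓ M M' c τ v f ∧
        ((∀ m ∈ A, cavityErased ℓ f m t) ↔ b = true)) := by
  classical
  set τ' : Fin N → Fin T := fun m => if m ∈ A then t else τ m with hτ'
  set v' : Finset (Fin N) → Fin N → Bool := fun V m => if m ∈ A then decide (m ∈ V) else v m
    with hv'
  have hnA : ∀ m ∈ M', m ∉ A := fun m hm => Finset.disjoint_left.1 hM'A hm
  have hle : ∀ V ∈ A.powerset.filter (fun V => V = A ↔ b = true),
      W * (∏ m ∈ M', erasureLaw y (τ m) (v m)) *
        (∏ m ∈ A, (if m ∈ V then y t else 1 - y t)) - ε ≤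
        frameProb L K N (JointEvent ℓ M (M' ∪ A) c τ' (v' V)) := by
    intro V _
    refine le_trans (le_of_eq ?_) (h (M' ∪ A) τ' (v' V) hMA
      ((Finset.card_union_le _ _).trans (add_le_add hM' hA)))
    rw [Finset.prod_union hM'A, mul_assoc]
    congr 3
    · refine Finset.prod_congr rfl fun m hm => ?_
      simp [hτ', hv', hnA m hm]
    · refine Finset.prod_congr rfl fun m hm => ?_
      simp [hτ', hv', hm, erasureLaw]
  have hcard : (((A.powerset.filter (fun V => V = A ↔ b = true)).card : ℕ) : ℝ) ≤ 2 ^ D := by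
    have h1 := Finset.card_filter_le A.powerset (fun V => V = A ↔ b = true)
    rw [Finset.card_powerset] at h1
    exact_mod_cast h1.trans (Nat.pow_le_pow_right two_pos hA)
  refine le_trans ?_ ((Finset.sum_le_sum hle).trans (sum_frameProb_le _ _ _ ?_ ?_))
  · rw [Finset.sum_sub_distrib, ← Finset.mul_sum, sum_powerset_erased, Finset.sum_const,
      nsmul_eq_mul]
    have := mul_le_mul_of_nonneg_right hcard hε
    linarith
  · rintro V hV f ⟨h1, h2⟩
    obtain ⟨hVA, hVb⟩ := Finset.mem_filter.1 hV
    rw [Finset.mem_powerset] at hVA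
    refine ⟨⟨h1, fun m hm => ?_⟩, ?_⟩
    · have := h2 m (Finset.mem_union_left _ hm)
      simpa [hτ', hv', hnA m hm] using this
    · rw [← hVb]
      have h3 : ∀ m ∈ A, (cavityErased ℓ f m t ↔ m ∈ V) := by
        intro m hm
        have := h2 m (Finset.mem_union_right _ hm)
        simpa [hτ', hv', hm] using this
      constructor
      · intro h4
        exact hVA.antisymm fun m hm => (h3 m hm).1 (h4 m hm)
      · rintro rfl m hm
        exact (h3 m hm).2 hm
  · intro V hV V' hV' f h1 h2
    have hVA := Finset.mem_powerset.1 (Finset.mem_filter.1 hV).1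
    have hVA' := Finset.mem_powerset.1 (Finset.mem_filter.1 hV').1
    have h3 : ∀ m ∈ A, (m ∈ V ↔ m ∈ V') := by
      intro m hm
      have e1 := h1.2 m (Finset.mem_union_right _ hm)
      have e2 := h2.2 m (Finset.mem_union_right _ hm)
      simp only [hτ', hv', hm, if_true, decide_eq_true_eq] at e1 e2
      exact e1.symm.trans e2
    ext m
    exact ⟨fun hm => (h3 m (hVA hm)).1 hm, fun hm => (h3 m (hVA' hm)).2 hm⟩

variable {L : Fin T → PMF ℕ} {D : ℕ} {η : Fin T → ℝ} {K : ℕ → Fin T → ℕ}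

theorem eventually_card_user_le
    (hK : ∀ t, Tendsto (fun N : ℕ => (K N t : ℝ) / (N : ℝ)) atTop (𝓝 (η t))) :
    ∀ᶠ N : ℕ in atTop, (Fintype.card (User (K N)) : ℝ) ≤ (∑ t, η t + 1) * N := by
  have h1 := tendsto_finsetSum Finset.univ fun t _ => hK t
  have h2 := h1.eventually (gt_mem_nhds (lt_add_one (∑ t, η t)))
  filter_upwards [h2, eventually_gt_atTop 0] with N hN hN0
  have hN0' : (0 : ℝ) < N := by exact_mod_cast hN0
  rw [← Finset.sum_div, div_lt_iff₀ hN0'] at hN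
  refine le_trans (le_of_eq ?_) hN.le
  simp

/-- Adding one user to the counts. -/
theorem JointLimit.succ (hD : ∀ t d, D < d → L t d = 0) (hη : ∀ t, 0 ≤ η t)
    (hK : ∀ t, Tendsto (fun N : ℕ => (K N t : ℝ) / (N : ℝ)) atTop (𝓝 (η t)))
    {y : Fin T → ℝ} (hy : ∀ t, y t ∈ Set.Icc (0 : ℝ) 1) {ℓ B : ℕ}
    (h : JointLimit L D η K y ℓ B) : JointLimit L D η K y ℓ (B + 1) := by
  classical
  intro k ε hε
  set κ : ℝ := ∑ t, η t + 1 with hκ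
  have hκ0 : 0 ≤ κ := add_nonneg (Finset.sum_nonneg fun t _ => hη t) zero_le_one
  set ε' : ℝ := ε / (4 * (κ * D * 2 ^ D + 1)) with hε'
  have hε'0 : 0 < ε' := by positivity
  set β : ℝ := interferenceBound D κ ℓ (2 * k + D) with hβ
  have hrate : ∀ t, ∀ᶠ N : ℕ in atTop, |(K N t : ℝ) / N - η t| * D ≤ ε / 4 := by
    intro t
    have h1 : Tendsto (fun N : ℕ => |(K N t : ℝ) / N - η t| * D) atTop (𝓝 0) := by
      have h2 := (((hK t).sub_const (η t)).abs).mul_const (D : ℝ)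
      simpa using h2
    filter_upwards [h1.eventually (gt_mem_nhds (by positivity : 0 < ε / 4))] with N hN using hN.le
  have hsmall : ∀ᶠ N : ℕ in atTop,
      κ * (D * (β / N) + (2 * k : ℕ) * ((D : ℝ) ^ 2 / N)) ≤ ε / 4 := by
    have h1 : Tendsto (fun N : ℕ => κ * (D * (β / N) + (2 * k : ℕ) * ((D : ℝ) ^ 2 / N))) atTop
        (𝓝 0) := by
      have h2 := (((tendsto_const_div_atTop_nhds_zero_nat β).const_mul (D : ℝ)).add
        ((tendsto_const_div_atTop_nhds_zero_nat ((D : ℝ) ^ 2)).const_mul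
          ((2 * k : ℕ) : ℝ))).const_mul κ
      simpa using h2
    filter_upwards [h1.eventually (gt_mem_nhds (by positivity : 0 < ε / 4))] with N hN using hN.le
  filter_upwards [h (k + D) ε' hε'0, eventually_card_user_le hK, eventually_ge_atTop D,
    eventually_all.2 hrate, hsmall, eventually_gt_atTop 0] with N hN hcard hND hr hs hN0
  intro M M' c τ v hdisj hMk hM'k hcB
  have hN0' : (0 : ℝ) < N := by exact_mod_cast hN0
  have hKle : ∀ t, (K N t : ℝ) / N ≤ κ := by
    intro t
    rw [div_le_iff₀ hN0']
    refine le_trans ?_ hcard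
    have : K N t ≤ ∑ s, K N s :=
      Finset.single_le_sum (fun s _ => Nat.zero_le _) (Finset.mem_univ t)
    simpa using (Nat.cast_le (α := ℝ)).2 this
  -- a user to be removed
  obtain ⟨n, hnM, i, hci⟩ : ∃ n ∈ M, ∃ i, c n i ≠ 0 := by
    by_contra hcon
    push Not at hcon
    rw [Finset.sum_eq_zero fun n hn => Finset.sum_eq_zero fun i _ => hcon n hn i] at hcB
    omega
  set c₀ : Fin N → Fin T × Bool → ℕ := Function.update c n (Function.update (c n) i (c n i - 1))
    with hc₀
  have hc : ∀ j, c n j = c₀ n j + if j = i then 1 else 0 := by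
    intro j
    rw [hc₀, Function.update_self]
    by_cases hj : j = i
    · subst hj
      rw [Function.update_self, if_pos rfl]
      omega
    · rw [Function.update_of_ne hj, if_neg hj, add_zero]
  have hc' : ∀ m, m ≠ n → c m = c₀ m := fun m hm => by rw [hc₀, Function.update_of_ne hm]
  have hc₀B : ∑ m ∈ M, ∑ j, c₀ m j = B := by
    have e1 : ∑ j, c n j = ∑ j, c₀ n j + 1 := by
      rw [Finset.sum_congr rfl fun j _ => hc j, Finset.sum_add_distrib]
      simp
    have e2 : ∑ m ∈ M.erase n, ∑ j, c m j = ∑ m ∈ M.erase n, ∑ j, c₀ m j :=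
      Finset.sum_congr rfl fun m hm => by rw [hc' m (Finset.ne_of_mem_erase hm)]
    rw [← Finset.add_sum_erase _ _ hnM] at hcB ⊢
    omega
  have hnM' : n ∉ M' := Finset.disjoint_left.1 hdisj hnM
  have hν := classRate_nonneg (L := L) (D := D) hD hη hy
  set ν := classRate L D η y with hνdef
  set W : ℝ := ∏ m ∈ M, poissonWeight ν (c₀ m) with hW
  have hW0 : 0 ≤ W := Finset.prod_nonneg fun m _ => poissonWeight_nonneg hν _
  have hW1 : W ≤ 1 := Finset.prod_le_one (fun m _ => poissonWeight_nonneg hν _)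
    fun m _ => poissonWeight_le_one hν _
  set V : ℝ := ∏ m ∈ M', erasureLaw y (τ m) (v m) with hV
  have hV0 : 0 ≤ V := Finset.prod_nonneg fun m _ => (erasureLaw_mem_Icc hy _ _).1
  have hV1 : V ≤ 1 := Finset.prod_le_one (fun m _ => (erasureLaw_mem_Icc hy _ _).1)
    fun m _ => (erasureLaw_mem_Icc hy _ _).2
  have hWV0 : 0 ≤ W * V := mul_nonneg hW0 hV0
  have hWV1 : W * V ≤ 1 := mul_le_one₀ hW1 hV0 hV1
  have hg := fun d => allErasedLaw_mem_Icc (hy i.1) i.2 d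
  have hmain := frameProb_jointEvent_ge (k := 2 * k) hD hND hκ0 hcard hc hc' hnM hnM' (by omega)
    (ε := 2 ^ D * ε') (p := W * V) (g := allErasedLaw (y i.1) i.2) (τ := τ) (v := v) (ℓ := ℓ)
    (by positivity) (fun d => mul_le_one₀ hWV1 (hg d).1 (hg d).2) ?_
  swap
  · intro S hnS hSD hS
    have hcardA : (S.erase n).card + 1 = S.card := Finset.card_erase_add_one hnS
    have hx := jointLimit_extend (L := L) (D := D) (k := k) (ℓ := ℓ) (K := K N) (y := y) (W := W)
      (ε := ε') (M := M) (M' := M') (A := S.erase n) (c := c₀) (τ := τ) (v := v) i.1 i.2 hε'0.le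
      (by omega) ?_ ?_ hM'k fun M'' τ' v' hd'' hk'' =>
        hN M M'' c₀ τ' v' hd'' (hMk.trans (Nat.le_add_right _ _)) hk'' hc₀B
    · rw [hcardA] at hx
      refine hx.trans (frameProb_mono fun f hf => ⟨hf.1, ?_⟩)
      rw [← hf.2]
      constructor
      · intro h1 m hm
        exact h1 m (Finset.mem_of_mem_erase hm) (Finset.ne_of_mem_erase hm)
      · intro h1 m hm hmn
        exact h1 m (Finset.mem_erase.2 ⟨hmn, hm⟩)
    · rw [Finset.disjoint_left]
      intro m hm hmS
      exact hS m (Finset.mem_union_right _ hm) (Finset.ne_of_mem_erase hmS)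
        (Finset.mem_of_mem_erase hmS)
    · rw [Finset.disjoint_union_right]
      refine ⟨hdisj, ?_⟩
      rw [Finset.disjoint_left]
      intro m hm hmS
      exact hS m (Finset.mem_union_left _ hm) (Finset.ne_of_mem_erase hmS)
        (Finset.mem_of_mem_erase hmS)
  set P := frameProb L (K N) N (JointEvent ℓ M M' c τ v) with hP
  set m₀ : ℝ := ∑ d ∈ Finset.range (D + 1), (L i.1 d).toReal *
    (d * allErasedLaw (y i.1) i.2 d) with hm₀
  have hm₀mem := classSum_mem_Icc hD i.1 hg
  have hνi : ν i = η i.1 * m₀ := rfl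
  set W' : ℝ := ∏ m ∈ M, poissonWeight ν (c m) with hW'
  have hWW' : W * ν i = c n i * W' := by
    have hrest : ∏ m ∈ M.erase n, poissonWeight ν (c₀ m) = ∏ m ∈ M.erase n, poissonWeight ν (c m) :=
      Finset.prod_congr rfl fun m hm => by rw [hc' m (Finset.ne_of_mem_erase hm)]
    rw [hW, hW', ← Finset.mul_prod_erase _ _ hnM, ← Finset.mul_prod_erase _ _ hnM,
      mul_right_comm, poissonWeight_mul_rate ν hc, hrest]
    ring
  set a : ℝ := (K N i.1 : ℝ) / N with ha
  have ha0 : 0 ≤ a := by positivity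
  have e1 : W * V * (η i.1 * m₀) - |a - η i.1| * D ≤ a * (W * V * m₀) := by
    have h1 : W * V * m₀ ≤ D := by
      calc W * V * m₀ ≤ 1 * D := mul_le_mul hWV1 hm₀mem.2 hm₀mem.1 zero_le_one
        _ = D := one_mul _
    have h2 : 0 ≤ W * V * m₀ := mul_nonneg hWV0 hm₀mem.1
    have h3 : (η i.1 - a) * (W * V * m₀) ≤ |a - η i.1| * D := by
      calc (η i.1 - a) * (W * V * m₀) ≤ |a - η i.1| * (W * V * m₀) := by
            refine mul_le_mul_of_nonneg_right ?_ h2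
            rw [abs_sub_comm]
            exact le_abs_self _
        _ ≤ _ := mul_le_mul_of_nonneg_left h1 (abs_nonneg _)
    linarith
  have hβ0 : 0 ≤ β := by
    have := clashBound_nonneg D hκ0 (ℓ + 1) D
    rw [hβ, interferenceBound]
    positivity
  have e2 : a * (D * (2 ^ D * ε' + β / N) + (2 * k : ℕ) * ((D : ℝ) ^ 2 / N)) ≤ ε / 2 := by
    have h1 : κ * (D * (2 ^ D * ε')) ≤ ε / 4 := by
      have : κ * (D * (2 ^ D * ε')) = (ε / 4) * ((κ * D * 2 ^ D) / (κ * D * 2 ^ D + 1)) := by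
        rw [hε']
        field_simp
      rw [this]
      refine mul_le_of_le_one_right (by positivity) ?_
      rw [div_le_one (by positivity)]
      linarith
    calc a * (D * (2 ^ D * ε' + β / N) + (2 * k : ℕ) * ((D : ℝ) ^ 2 / N))
        ≤ κ * (D * (2 ^ D * ε' + β / N) + (2 * k : ℕ) * ((D : ℝ) ^ 2 / N)) := by
          refine mul_le_mul_of_nonneg_right (hKle i.1) ?_
          positivity
      _ ≤ ε / 2 := by linarith
  have e3 := hr i.1
  have e4 : (c n i : ℝ) * (W' * V) - ε ≤ c n i * P := by
    have : W * V * (η i.1 * m₀) = c n i * (W' * V) := by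
      rw [← hνi, mul_right_comm, hWW']
      ring
    rw [mul_sub] at hmain
    linarith
  have hcpos : (1 : ℝ) ≤ c n i := by exact_mod_cast Nat.one_le_iff_ne_zero.2 hci
  have e5 : (c n i : ℝ) * (W' * V - ε) ≤ c n i * P := by
    have : ε ≤ c n i * ε := le_mul_of_one_le_left hε.le hcpos
    linarith
  exact le_of_mul_le_mul_left e5 (by linarith)

end Limit

/-! ### Products of Poisson measures and the next iteration -/

section PoissonProduct

open MeasureTheory ProbabilityTheory

/-- The joint law of independent Poisson variables with means `ν`. -/
noncomputable def poissonPi {ι : Type*} [Fintype ι] (ν : ι → ℝ) : Measure (ι → ℕ) :=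
  Measure.pi fun i => poissonMeasure (ν i).toNNReal

instance {ι : Type*} [Fintype ι] (ν : ι → ℝ) : IsProbabilityMeasure (poissonPi ν) := by
  unfold poissonPi
  infer_instance

variable {ι : Type*} [Fintype ι] {ν : ι → ℝ}

theorem poissonPi_real_singleton (hν : ∀ i, 0 ≤ ν i) (c : ι → ℕ) :
    (poissonPi ν).real {c} = poissonWeight ν c := by
  rw [measureReal_def, poissonPi, Measure.pi_singleton, ENNReal.toReal_prod]
  refine Finset.prod_congr rfl fun i _ => ?_
  rw [← measureReal_def, poissonMeasure_real_singleton, Real.coe_toNNReal _ (hν i)]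

theorem hasSum_poissonWeight (hν : ∀ i, 0 ≤ ν i) (C : Set (ι → ℕ)) :
    HasSum (C.indicator (poissonWeight ν)) ((poissonPi ν).real C) := by
  have h := Measure.tsum_indicator_apply_singleton (poissonPi ν) C
    (Set.to_countable C).measurableSet
  have hne : ∀ c, C.indicator (fun x => poissonPi ν {x}) c ≠ ∞ := by
    intro c
    by_cases hc : c ∈ C
    · rw [Set.indicator_of_mem hc]
      exact measure_ne_top _ _
    · rw [Set.indicator_of_notMem hc]
      exact ENNReal.zero_ne_top
  have h1 := ENNReal.hasSum_toReal (f := C.indicator fun x => poissonPi ν {x})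
    (by rw [h]; exact measure_ne_top _ _)
  rw [← ENNReal.tsum_toReal_eq hne, h] at h1
  rw [measureReal_def]
  convert h1 using 1
  funext c
  by_cases hc : c ∈ C
  · rw [Set.indicator_of_mem hc, Set.indicator_of_mem hc, ← measureReal_def,
      poissonPi_real_singleton hν]
  · rw [Set.indicator_of_notMem hc, Set.indicator_of_notMem hc, ENNReal.toReal_zero]

theorem sum_poissonWeight_le_one (hν : ∀ i, 0 ≤ ν i) (F : Finset (ι → ℕ)) :
    ∑ c ∈ F, poissonWeight ν c ≤ 1 := by
  have h := hasSum_poissonWeight hν Set.univ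
  rw [probReal_univ, Set.indicator_univ] at h
  exact sum_le_hasSum F (fun c _ => poissonWeight_nonneg hν c) h

theorem exists_finset_poissonWeight (hν : ∀ i, 0 ≤ ν i) (C : Set (ι → ℕ)) {ε : ℝ} (hε : 0 < ε) :
    ∃ F : Finset (ι → ℕ), (∀ c ∈ F, c ∈ C) ∧
      (poissonPi ν).real C - ε ≤ ∑ c ∈ F, poissonWeight ν c := by
  classical
  have h := hasSum_poissonWeight hν C
  obtain ⟨F, hF⟩ := (h.eventually (lt_mem_nhds (sub_lt_self _ hε))).exists
  refine ⟨F.filter (· ∈ C), fun c hc => (Finset.mem_filter.1 hc).2, hF.le.trans (le_of_eq ?_)⟩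
  rw [Finset.sum_filter]
  exact Finset.sum_congr rfl fun c _ => Set.indicator_apply _ _ _

/-- The marginal law of some of the coordinates. -/
theorem poissonPi_real_fst (ν : ι × Bool → ℝ) (hν : ∀ i, 0 ≤ ν i) (v : ι → ℕ) :
    (poissonPi ν).real {c | ∀ s, c (s, true) = v s} =
      poissonWeight (fun s => ν (s, true)) v := by
  have hset : {c : ι × Bool → ℕ | ∀ s, c (s, true) = v s} =
      Set.pi Set.univ fun i => if i.2 = true then {v i.1} else Set.univ := by
    ext c
    simp [Set.mem_pi]
  rw [hset, measureReal_def, poissonPi, Measure.pi_pi, ENNReal.toReal_prod, Fintype.prod_prod_type]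
  refine Finset.prod_congr rfl fun s _ => ?_
  rw [Fintype.prod_bool]
  simp only [if_true, Bool.false_eq_true, if_false, measure_univ, ENNReal.toReal_one, mul_one]
  rw [← measureReal_def, poissonMeasure_real_singleton, Real.coe_toNNReal _ (hν _)]

theorem prod_sub_prod_le {α : Type*} (M : Finset α) {a b : α → ℝ} {ε : ℝ} (hε : 0 ≤ ε)
    (ha : ∀ m ∈ M, a m ∈ Set.Icc (0 : ℝ) 1) (hb : ∀ m ∈ M, b m ∈ Set.Icc (0 : ℝ) 1)
    (hab : ∀ m ∈ M, a m - ε ≤ b m) : ∏ m ∈ M, a m - M.card * ε ≤ ∏ m ∈ M, b m := by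
  classical
  induction M using Finset.induction_on with
  | empty => simp
  | insert x M hx ih =>
    rw [Finset.prod_insert hx, Finset.prod_insert hx, Finset.card_insert_of_notMem hx]
    have ih := ih (fun m hm => ha m (Finset.mem_insert_of_mem hm))
      (fun m hm => hb m (Finset.mem_insert_of_mem hm))
      fun m hm => hab m (Finset.mem_insert_of_mem hm)
    have hx1 := hb x (Finset.mem_insert_self x M)
    have hx2 := hab x (Finset.mem_insert_self x M)
    have hA0 : 0 ≤ ∏ m ∈ M, a m :=
      Finset.prod_nonneg fun m hm => (ha m (Finset.mem_insert_of_mem hm)).1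
    have hA1 : ∏ m ∈ M, a m ≤ 1 :=
      Finset.prod_le_one (fun m hm => (ha m (Finset.mem_insert_of_mem hm)).1)
        fun m hm => (ha m (Finset.mem_insert_of_mem hm)).2
    have h1 : (a x - b x) * ∏ m ∈ M, a m ≤ ε :=
      (mul_le_mul_of_nonneg_right (by linarith : a x - b x ≤ ε) hA0).trans
        (mul_le_of_le_one_right hε hA1)
    have h2 : b x * (∏ m ∈ M, a m - ∏ m ∈ M, b m) ≤ M.card * ε :=
      (mul_le_mul_of_nonneg_left (by linarith : _ ≤ (M.card : ℝ) * ε) hx1.1).trans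
        (mul_le_of_le_one_left (by positivity) hx1.2)
    push_cast
    linarith

end PoissonProduct

section Iteration

variable {T : ℕ} {L : Fin T → PMF ℕ} {D : ℕ} {η : Fin T → ℝ} {K : ℕ → Fin T → ℕ}

theorem sum_classRate (y : Fin T → ℝ) :
    ∑ i, classRate L D η y i =
      ∑ t, η t * ∑ d ∈ Finset.range (D + 1), (L t d).toReal * d := by
  rw [Fintype.sum_prod_type]
  refine Finset.sum_congr rfl fun t _ => ?_
  rw [Fintype.sum_bool, classRate, classRate, ← mul_add, ← Finset.sum_add_distrib]
  congr 1
  refine Finset.sum_congr rfl fun d _ => ?_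
  simp only [allErasedLaw, if_true, Bool.false_eq_true, if_false]
  ring

theorem cavityCount_eq_zero_iff {K : Fin T → ℕ} {N : ℕ} (ℓ : ℕ) (f : Frame K N) (n : Fin N) :
    (∀ i, cavityCount ℓ f n i = 0) ↔ ∀ u, n ∉ f u := by
  classical
  constructor
  · intro h u hu
    have := h (u.1, decide (UserErased ℓ f u n))
    rw [cavityCount, Finset.card_eq_zero, Finset.filter_eq_empty_iff] at this
    exact this (Finset.mem_univ u) ⟨rfl, hu, by simp⟩
  · intro h i
    rw [cavityCount, Finset.card_eq_zero, Finset.filter_eq_empty_iff]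
    exact fun u _ hu => h u hu.2.1

/-- The probability that the slots of `M` are empty. -/
theorem prod_le_frameProb_empty (hD : ∀ t d, D < d → L t d = 0) {K : Fin T → ℕ} {N : ℕ}
    (hN : D ≤ N) (M : Finset (Fin N))
    (hM : ∀ t, (M.card : ℝ) *
      (∑ d ∈ Finset.range (D + 1), (L t d).toReal * d) / N ≤ 1) :
    ∏ t, (1 - (M.card : ℝ) * (∑ d ∈ Finset.range (D + 1), (L t d).toReal * d) / N) ^ K t ≤
      frameProb L K N (fun f => ∀ n ∈ M, ∀ u, n ∉ f u) := by
  classical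
  have h1 : frameProb L K N (fun f => ∀ n ∈ M, ∀ u, n ∉ f u) =
      ∏ u : User K, ∑ S, userWeight L u.1 S * if ∀ n ∈ M, n ∉ S then 1 else 0 := by
    rw [← frameExp_prod, frameProb]
    congr 1
    funext f
    rw [Finset.prod_boole]
    have hiff : (∀ n ∈ M, ∀ u, n ∉ f u) ↔ ∀ u ∈ Finset.univ, ∀ n ∈ M, n ∉ f u :=
      ⟨fun h u _ n hn => h n hn u, fun h n hn u => h u (Finset.mem_univ u) n hn⟩
    by_cases h : ∀ n ∈ M, ∀ u, n ∉ f u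
    · rw [if_pos h, if_pos (hiff.1 h)]
    · rw [if_neg h, if_neg fun h' => h (hiff.2 h')]
  rw [h1, Fintype.prod_sigma]
  refine Finset.prod_le_prod (fun t _ => pow_nonneg (sub_nonneg.2 (hM t)) _) fun t _ => ?_
  change _ ≤ ∏ _j : Fin (K t), ∑ S : Finset (Fin N),
    userWeight L t S * if ∀ n ∈ M, n ∉ S then (1 : ℝ) else 0
  rw [Finset.prod_const, Finset.card_univ, Fintype.card_fin]
  refine pow_le_pow_left₀ (sub_nonneg.2 (hM t)) ?_ _
  have h2 : ∀ n, ∑ S : Finset (Fin N), (if n ∈ S then userWeight L t S else 0) =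
      (∑ d ∈ Finset.range (D + 1), (L t d).toReal * d) / N := by
    intro n
    have := sum_userWeight_mem hD hN t n (fun _ => 1)
    simp only [mul_one] at this
    rw [← this, Finset.sum_filter]
  calc _ = ∑ S : Finset (Fin N), (userWeight L t S -
        ∑ n ∈ M, if n ∈ S then userWeight L t S else 0) := by
        rw [Finset.sum_sub_distrib, sum_userWeight hD hN, Finset.sum_comm,
          Finset.sum_congr rfl fun n _ => h2 n, Finset.sum_const, nsmul_eq_mul, mul_div_assoc]
    _ ≤ _ := by
        refine Finset.sum_le_sum fun S _ => ?_
        have hw := userWeight_nonneg (L := L) t S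
        have h0 : ∀ n ∈ M, 0 ≤ if n ∈ S then userWeight L t S else 0 := by
          intro n _
          split_ifs
          · exact hw
          · exact le_rfl
        split_ifs with h
        · have := Finset.sum_nonneg h0
          linarith
        · push Not at h
          obtain ⟨n, hn, hnS⟩ := h
          have := Finset.single_le_sum h0 hn
          rw [if_pos hnS] at this
          linarith

theorem tendsto_one_sub_div_pow (a : ℝ) (t : Fin T)
    (hK : Tendsto (fun N : ℕ => (K N t : ℝ) / (N : ℝ)) atTop (𝓝 (η t))) :
    Tendsto (fun N : ℕ => (1 - a / N) ^ K N t) atTop (𝓝 (Real.exp (-(η t * a)))) := by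
  have h1 : Tendsto (fun N : ℕ => (1 + (-a) / (N : ℝ)) ^ N) atTop (𝓝 (Real.exp (-a))) :=
    Real.tendsto_one_add_div_pow_exp (-a)
  have h2 := h1.rpow hK (Or.inl (Real.exp_pos _).ne')
  rw [← Real.exp_mul, show -a * η t = -(η t * a) by ring] at h2
  have h3 : Tendsto (fun N : ℕ => 1 - a / (N : ℝ)) atTop (𝓝 1) := by
    have := (tendsto_const_div_atTop_nhds_zero_nat a).const_sub 1
    simpa using this
  refine h2.congr' ?_
  filter_upwards [h3.eventually (lt_mem_nhds zero_lt_one), eventually_gt_atTop 0] with N hN hN0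
  have hN0' : (N : ℝ) ≠ 0 := by exact_mod_cast hN0.ne'
  rw [show 1 + -a / (N : ℝ) = 1 - a / N by ring, ← Real.rpow_natCast _ N, ← Real.rpow_mul hN.le,
    mul_div_cancel₀ _ hN0', Real.rpow_natCast]

/-- Before the first iteration all messages are erasures, and the only event to be estimated is
that given slots are empty; its probability is computed directly. -/
theorem JointLimit.zero (hD : ∀ t d, D < d → L t d = 0)
    (hK : ∀ t, Tendsto (fun N : ℕ => (K N t : ℝ) / (N : ℝ)) atTop (𝓝 (η t)))
    {y : Fin T → ℝ} (hy : ∀ t, y t = 1) : JointLimit L D η K y 0 0 := by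
  intro k ε hε
  set mbar : Fin T → ℝ := fun t => ∑ d ∈ Finset.range (D + 1), (L t d).toReal * d with hm
  have hlim : ∀ j : ℕ, Tendsto (fun N : ℕ => ∏ t, (1 - (j : ℝ) * mbar t / N) ^ K N t) atTop
      (𝓝 (∏ t, Real.exp (-(η t * (j * mbar t))))) := fun j =>
    tendsto_finsetProd _ fun t _ => tendsto_one_sub_div_pow _ t (hK t)
  have hev : ∀ᶠ N : ℕ in atTop, ∀ j ∈ Finset.range (k + 1),
      (∏ t, Real.exp (-(η t * (j * mbar t)))) - ε ≤ ∏ t, (1 - (j : ℝ) * mbar t / N) ^ K N t ∧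
        ∀ t, (j : ℝ) * mbar t / N ≤ 1 := by
    rw [Filter.eventually_all_finset]
    intro j _
    refine (((hlim j).eventually (lt_mem_nhds (sub_lt_self _ hε))).mono fun N h => h.le).and ?_
    rw [Filter.eventually_all]
    intro t
    exact ((tendsto_const_div_atTop_nhds_zero_nat ((j : ℝ) * mbar t)).eventually
      (gt_mem_nhds zero_lt_one)).mono fun N h => h.le
  filter_upwards [hev, eventually_ge_atTop D] with N hN hND
  intro M M' c τ v _ hMk _ hcB
  have hc0 : ∀ n ∈ M, c n = fun _ => 0 := by
    intro n hn
    funext i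
    rw [Finset.sum_eq_zero_iff] at hcB
    exact (Finset.sum_eq_zero_iff.1 (hcB n hn)) i (Finset.mem_univ i)
  by_cases hv : ∀ m ∈ M', v m = true
  · have h1 : ∏ m ∈ M', erasureLaw y (τ m) (v m) = 1 :=
      Finset.prod_eq_one fun m hm => by simp [erasureLaw, hv m hm, hy]
    obtain ⟨h2, h3⟩ := hN M.card (Finset.mem_range.2 (Nat.lt_succ_of_le hMk))
    rw [h1, mul_one, Finset.prod_congr rfl fun n hn => by rw [hc0 n hn, poissonWeight_zero],
      Finset.prod_const, ← Real.exp_nat_mul, sum_classRate]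
    rw [← Real.exp_sum] at h2
    refine le_trans ?_ (h2.trans ((prod_le_frameProb_empty hD hND M h3).trans
      (frameProb_mono fun f hf => ⟨fun n hn i => ?_, fun m hm => ?_⟩)))
    · refine sub_le_sub_right (le_of_eq ?_) _
      congr 1
      rw [Finset.sum_neg_distrib, mul_neg, Finset.mul_sum]
      congr 1
      exact Finset.sum_congr rfl fun t _ => by simp only [hm]; ring
    · rw [hc0 n hn]
      exact (cavityCount_eq_zero_iff 0 f n).2 (hf n hn) i
    · simp [cavityErased, hv m hm]
  · push Not at hv
    obtain ⟨m, hm, hvm⟩ := hv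
    have h1 : ∏ m ∈ M', erasureLaw y (τ m) (v m) = 0 :=
      Finset.prod_eq_zero hm (by simp [erasureLaw, hvm, hy])
    rw [h1, mul_zero]
    have := frameProb_nonneg (L := L) (K := K N) (N := N) (JointEvent 0 M M' c τ v)
    linarith

/-- The limit law of the class counts, for events that may allow infinitely many counts. -/
theorem JointLimit.sets (hD : ∀ t d, D < d → L t d = 0) (hη : ∀ t, 0 ≤ η t) {y : Fin T → ℝ}
    (hy : ∀ t, y t ∈ Set.Icc (0 : ℝ) 1) {ℓ : ℕ} (h : ∀ B, JointLimit L D η K y ℓ B) (t₀ : Fin T)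
    {J : Type*} [Fintype J] (C : J → Set (Fin T × Bool → ℕ)) (k : ℕ) {ε : ℝ} (hε : 0 < ε) :
    ∀ᶠ N : ℕ in atTop, ∀ (M : Finset (Fin N)) (j : Fin N → J), M.card ≤ k →
      ∏ n ∈ M, (poissonPi (classRate L D η y)).real (C (j n)) - ε ≤
        frameProb L (K N) N (fun f => ∀ n ∈ M, cavityCount ℓ f n ∈ C (j n)) := by
  classical
  have hν := classRate_nonneg (L := L) (D := D) hD hη hy
  set ν := classRate L D η y with hνdef
  obtain ⟨ε₁, hε₁⟩ : ∃ e : ℝ, e = ε / (2 * (k + 1)) := ⟨_, rfl⟩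
  have hε₁0 : 0 < ε₁ := hε₁ ▸ by positivity
  choose F hFC hF using fun j => exists_finset_poissonWeight hν (C j) hε₁0
  obtain ⟨Q, hQ⟩ : ∃ Q : ℕ, Q = ∑ j, (F j).card + 1 := ⟨_, rfl⟩
  obtain ⟨b, hb⟩ : ∃ b : ℕ, b = ∑ j, ∑ c ∈ F j, ∑ i, c i := ⟨_, rfl⟩
  obtain ⟨ε₂, hε₂⟩ : ∃ e : ℝ, e = ε / (2 * (Q : ℝ) ^ k) := ⟨_, rfl⟩
  have hQ0 : (0 : ℝ) < Q := by exact_mod_cast (by omega : 0 < Q)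
  have hε₂0 : 0 < ε₂ := hε₂ ▸ div_pos hε (mul_pos two_pos (pow_pos hQ0 k))
  have hall : ∀ᶠ N : ℕ in atTop, ∀ B ∈ Finset.range (k * b + 1), ∀ (M M' : Finset (Fin N))
      (c : Fin N → Fin T × Bool → ℕ) (τ : Fin N → Fin T) (v : Fin N → Bool),
      Disjoint M M' → M.card ≤ k → M'.card ≤ k → ∑ n ∈ M, ∑ i, c n i = B →
      (∏ n ∈ M, poissonWeight ν (c n)) * ∏ m ∈ M', erasureLaw y (τ m) (v m) - ε₂ ≤
        frameProb L (K N) N (JointEvent ℓ M M' c τ v) := by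
    rw [Filter.eventually_all_finset]
    intro B _
    exact h B k ε₂ hε₂0
  filter_upwards [hall] with N hN
  intro M j hMk
  set G : Fin N → Finset (Fin T × Bool → ℕ) := fun n => if n ∈ M then F (j n) else {fun _ => 0}
    with hG
  have hmem : ∀ c ∈ Fintype.piFinset G, ∀ n ∈ M, c n ∈ F (j n) := by
    intro c hc n hn
    have := Fintype.mem_piFinset.1 hc n
    simpa only [hG, hn, if_true] using this
  have hlow : ∀ c ∈ Fintype.piFinset G, ∏ n ∈ M, poissonWeight ν (c n) - ε₂ ≤
      frameProb L (K N) N (JointEvent ℓ M ∅ c (fun _ => t₀) (fun _ => true)) := by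
    intro c hc
    have hcb : ∑ n ∈ M, ∑ i, c n i ≤ k * b := by
      refine (Finset.sum_le_card_nsmul M _ b fun n hn => ?_).trans ?_
      · have hcn : c n ∈ F (j n) := hmem c hc n hn
        refine (Finset.single_le_sum (f := fun c : Fin T × Bool → ℕ => ∑ i, c i)
          (fun _ _ => Nat.zero_le _) hcn).trans ?_
        rw [hb]
        exact Finset.single_le_sum (f := fun j => ∑ c ∈ F j, ∑ i, c i)
          (fun _ _ => Nat.zero_le _) (Finset.mem_univ (j n))
      · rw [smul_eq_mul]
        exact Nat.mul_le_mul_right b hMk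
    have := hN _ (Finset.mem_range.2 (Nat.lt_succ_of_le hcb)) M ∅ c (fun _ => t₀) (fun _ => true)
      (Finset.disjoint_empty_right M) hMk (Nat.zero_le _) rfl
    simpa using this
  have hsum : ∑ c ∈ Fintype.piFinset G, ∏ n ∈ M, poissonWeight ν (c n) =
      ∏ n ∈ M, ∑ x ∈ F (j n), poissonWeight ν x := by
    have h1 : ∀ c : Fin N → Fin T × Bool → ℕ, ∏ n ∈ M, poissonWeight ν (c n) =
        ∏ n, if n ∈ M then poissonWeight ν (c n) else 1 := by
      intro c
      rw [Finset.prod_ite_mem, Finset.univ_inter]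
    rw [Finset.sum_congr rfl fun c _ => h1 c,
      ← Finset.prod_univ_sum G (fun n x => if n ∈ M then poissonWeight ν x else 1),
      ← Finset.univ_inter M, ← Finset.prod_ite_mem, Finset.univ_inter]
    refine Finset.prod_congr rfl fun n _ => ?_
    by_cases hn : n ∈ M
    · simp [hG, hn]
    · simp [hG, hn]
  have hcard : ((Fintype.piFinset G).card : ℝ) ≤ (Q : ℝ) ^ k := by
    have h1 : (Fintype.piFinset G).card ≤ Q ^ M.card := by
      rw [Fintype.card_piFinset, ← Finset.prod_const, ← Finset.univ_inter M, ← Finset.prod_ite_mem]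
      refine Finset.prod_le_prod' fun n _ => ?_
      by_cases hn : n ∈ M
      · simp only [hG, hn, if_true]
        have := Finset.single_le_sum (f := fun j => (F j).card) (fun _ _ => Nat.zero_le _)
          (Finset.mem_univ (j n))
        omega
      · simp [hG, hn]
    exact_mod_cast h1.trans (Nat.pow_le_pow_right (by omega) hMk)
  have hprod := prod_sub_prod_le M (a := fun n => (poissonPi ν).real (C (j n)))
    (b := fun n => ∑ x ∈ F (j n), poissonWeight ν x) hε₁0.le
    (fun n _ => ⟨MeasureTheory.measureReal_nonneg, MeasureTheory.measureReal_le_one⟩)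
    (fun n _ => ⟨Finset.sum_nonneg fun x _ => poissonWeight_nonneg hν x,
      sum_poissonWeight_le_one hν _⟩) fun n _ => hF (j n)
  have he1 : (M.card : ℝ) * ε₁ ≤ ε / 2 := by
    have h1 : (M.card : ℝ) ≤ k + 1 := by exact_mod_cast hMk.trans (Nat.le_succ k)
    calc (M.card : ℝ) * ε₁ ≤ (k + 1) * ε₁ := by gcongr
      _ = ε / 2 := by
        rw [hε₁]
        field_simp
  have he2 : ((Fintype.piFinset G).card : ℝ) * ε₂ ≤ ε / 2 := by
    calc ((Fintype.piFinset G).card : ℝ) * ε₂ ≤ (Q : ℝ) ^ k * ε₂ := by gcongr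
      _ = ε / 2 := by
        rw [hε₂]
        field_simp
  refine le_trans ?_ ((Finset.sum_le_sum hlow).trans (sum_frameProb_le _ _ _ ?_ ?_))
  · rw [Finset.sum_sub_distrib, hsum, Finset.sum_const, nsmul_eq_mul]
    linarith
  · intro c hc f hf n hn
    have hcn : c n ∈ F (j n) := hmem c hc n hn
    have : cavityCount ℓ f n = c n := funext (hf.1 n hn)
    rw [this]
    exact hFC _ _ hcn
  · intro c hc c' hc' f hf hf'
    funext n
    by_cases hn : n ∈ M
    · funext i
      rw [← hf.1 n hn i, hf'.1 n hn i]
    · have h1 := Fintype.mem_piFinset.1 hc n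
      have h2 := Fintype.mem_piFinset.1 hc' n
      rw [hG] at h1 h2
      simp only [hn, if_false, Finset.mem_singleton] at h1 h2
      rw [h1, h2]

/-- The class counts whose erased users leave the message to a user of type `t` decodable. -/
def decodableCounts {T : ℕ} (t : Fin T) : Set (Fin T × Bool → ℕ) :=
  {c | IsDecodable t (fun s => (if s = t then 1 else 0) + c (s, true))}

/-- The messages of the next iteration are functions of the class counts of their slots, and so
inherit independence and a limit law from them. -/
theorem JointLimit.next (hD : ∀ t d, D < d → L t d = 0) (hη : ∀ t, 0 ≤ η t) {y y' : Fin T → ℝ}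
    (hy : ∀ t, y t ∈ Set.Icc (0 : ℝ) 1) {ℓ : ℕ} (h : ∀ B, JointLimit L D η K y ℓ B)
    (hy' : ∀ t, y' t = 1 - (poissonPi (classRate L D η y)).real (decodableCounts t)) :
    JointLimit L D η K y' (ℓ + 1) 0 := by
  classical
  intro k ε hε
  rcases Nat.eq_zero_or_pos T with rfl | hT
  · -- without users there is nothing to decode
    filter_upwards [eventually_ge_atTop (max D 1)] with N hN M M' c τ v
    exact (τ ⟨0, by omega⟩).elim0
  have hν := classRate_nonneg (L := L) (D := D) hD hη hy
  set ν := classRate L D η y with hνdef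
  set C : Option (Fin T × Bool) → Set (Fin T × Bool → ℕ) := fun o =>
    o.elim {fun _ => 0} fun i => if i.2 = true then (decodableCounts i.1)ᶜ else decodableCounts i.1
    with hC
  filter_upwards [JointLimit.sets hD hη hy h ⟨0, hT⟩ C (2 * k) hε] with N hN
  intro M M' c τ v hdisj hMk hM'k hcB
  have hc0 : ∀ n ∈ M, c n = fun _ => 0 := by
    intro n hn
    funext i
    rw [Finset.sum_eq_zero_iff] at hcB
    exact (Finset.sum_eq_zero_iff.1 (hcB n hn)) i (Finset.mem_univ i)
  set j : Fin N → Option (Fin T × Bool) := fun n => if n ∈ M then none else some (τ n, v n) with hj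
  have hnM : ∀ m ∈ M', m ∉ M := fun m hm hmM => Finset.disjoint_left.1 hdisj hmM hm
  have h1 := hN (M ∪ M') j ((Finset.card_union_le _ _).trans (by omega))
  have h2 : ∏ n ∈ M, (poissonPi ν).real (C (j n)) =
      ∏ n ∈ M, poissonWeight (classRate L D η y') (c n) := by
    refine Finset.prod_congr rfl fun n hn => ?_
    simp only [hj, hn, if_true, hC, Option.elim]
    rw [poissonPi_real_singleton hν, hc0 n hn, poissonWeight_zero, poissonWeight_zero, hνdef,
      sum_classRate, sum_classRate]
  have h3 : ∏ n ∈ M', (poissonPi ν).real (C (j n)) = ∏ m ∈ M', erasureLaw y' (τ m) (v m) := by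
    refine Finset.prod_congr rfl fun n hn => ?_
    simp only [hj, hnM n hn, if_false, hC, Option.elim, erasureLaw]
    cases v n
    · simp [hy']
    · simp only [if_true]
      rw [hy', MeasureTheory.probReal_compl_eq_one_sub (Set.to_countable _).measurableSet]
  rw [Finset.prod_union hdisj, h2, h3] at h1
  refine h1.trans (frameProb_mono fun f hf => ⟨fun n hn i => ?_, fun m hm => ?_⟩)
  · have h4 := hf n (Finset.mem_union_left _ hn)
    simp only [hj, hn, if_true, hC, Option.elim, Set.mem_singleton_iff] at h4
    rw [hc0 n hn]
    exact (cavityCount_eq_zero_iff (ℓ + 1) f n).2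
      ((cavityCount_eq_zero_iff ℓ f n).1 fun i => congrFun h4 i) i
  · have h4 := hf m (Finset.mem_union_right _ hm)
    simp only [hj, hnM m hm, if_false, hC, Option.elim] at h4
    rw [cavityErased_succ]
    cases hv : v m
    · rw [hv] at h4
      simpa [decodableCounts] using h4
    · rw [hv] at h4
      simpa [decodableCounts] using h4

end Iteration

/-! ### Density evolution with Poisson right degrees -/

section Poisson

open MeasureTheory ProbabilityTheory

/-- The Poisson distribution with mean `r`. -/
noncomputable def poissonLaw (r : ℝ) : PMF ℕ := (poissonMeasure r.toNNReal).toPMF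

theorem poissonLaw_apply (r : ℝ) (d : ℕ) (hr : 0 ≤ r) :
    poissonLaw r d = ENNReal.ofReal (Real.exp (-r) * r ^ d / (d ! : ℝ)) := by
  rw [poissonLaw, Measure.toPMF_apply, poissonMeasure_singleton, Real.coe_toNNReal _ hr]

theorem poissonLaw_toReal {r : ℝ} (hr : 0 ≤ r) (d : ℕ) :
    (poissonLaw r d).toReal = Real.exp (-r) * r ^ d / (d ! : ℝ) := by
  rw [poissonLaw_apply r d hr, ENNReal.toReal_ofReal (by positivity)]

theorem gen_poissonLaw {r : ℝ} (hr : 0 ≤ r) (k : ℕ) (x : ℝ) :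
    gen (poissonLaw r) k x = r ^ k * Real.exp (r * (x - 1)) := by
  have h := (add_left_injective k).tsum_eq
    (f := fun d : ℕ => (poissonLaw r d).toReal * (d.descFactorial k : ℝ) * x ^ (d - k)) ?_
  · rw [gen, ← h]
    have h1 : ∀ j : ℕ, (poissonLaw r (j + k)).toReal * ((j + k).descFactorial k : ℝ) *
        x ^ (j + k - k) = r ^ k * Real.exp (-r) * ((r * x) ^ j / (j ! : ℝ)) := by
      intro j
      have h2 : ((j ! : ℕ) : ℝ) * ((j + k).descFactorial k : ℝ) = ((j + k)! : ℕ) := by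
        have := Nat.factorial_mul_descFactorial (Nat.le_add_left k j)
        rw [Nat.add_sub_cancel] at this
        exact_mod_cast this
      have h3 : ((j + k)! : ℝ) ≠ 0 := by positivity
      have h4 : (j ! : ℝ) ≠ 0 := by positivity
      rw [poissonLaw_toReal hr, Nat.add_sub_cancel]
      field_simp
      rw [← h2]
      ring
    rw [tsum_congr h1, tsum_mul_left, (NormedSpace.expSeries_div_hasSum_exp (r * x)).tsum_eq,
      ← Real.exp_eq_exp_ℝ, mul_assoc, ← Real.exp_add]
    ring_nf
  · intro d hd
    by_cases hk : k ≤ d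
    · exact ⟨d - k, Nat.sub_add_cancel hk⟩
    · exact absurd (by simp [Nat.descFactorial_of_lt (not_le.1 hk)]) hd

theorem hasEdges_poissonLaw {r : ℝ} (hr : 0 < r) : HasEdges (poissonLaw r) := by
  have h : ∑' d : ℕ, (d : ℝ≥0∞) * poissonLaw r d = ENNReal.ofReal r := by
    have h1 : ∀ d : ℕ, ((d + 1 : ℕ) : ℝ≥0∞) * poissonLaw r (d + 1) =
        ENNReal.ofReal r * poissonLaw r d := by
      intro d
      rw [poissonLaw_apply _ _ hr.le, poissonLaw_apply _ _ hr.le, ← ENNReal.ofReal_natCast,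
        ← ENNReal.ofReal_mul (by positivity), ← ENNReal.ofReal_mul hr.le, Nat.factorial_succ]
      congr 1
      have h4 : (d ! : ℝ) ≠ 0 := by positivity
      push_cast
      field_simp
      ring
    rw [← tsum_shift, tsum_congr h1, ENNReal.tsum_mul_left, PMF.tsum_coe, mul_one]
  rw [HasEdges, h]
  exact ⟨(ENNReal.ofReal_pos.2 hr).ne', ENNReal.ofReal_ne_top⟩

variable {T : ℕ} {L : Fin T → PMF ℕ} {D : ℕ} {η : Fin T → ℝ} {K : ℕ → Fin T → ℕ}

theorem gen_one_eq_sum (hD : ∀ t d, D < d → L t d = 0) (t : Fin T) (x : ℝ) :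
    gen (L t) 1 x = ∑ d ∈ Finset.range (D + 1), (L t d).toReal * (d * x ^ (d - 1)) := by
  rw [gen, tsum_eq_sum (s := Finset.range (D + 1))]
  · exact Finset.sum_congr rfl fun d _ => by
      rw [Nat.descFactorial_one]
      ring
  · intro d hd
    rw [hD t d (by simp at hd; omega)]
    simp

theorem mean_eq_gen (hD : ∀ t d, D < d → L t d = 0) (t : Fin T) :
    ∑ d ∈ Finset.range (D + 1), (L t d).toReal * d = gen (L t) 1 1 := by
  simp [gen_one_eq_sum hD]

theorem classRate_true (hD : ∀ t d, D < d → L t d = 0) (y : Fin T → ℝ) (s : Fin T) :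
    classRate L D η y (s, true) = η s * gen (L s) 1 (y s) := by
  simp [classRate, allErasedLaw, gen_one_eq_sum hD]

/-- The limit law of the counts gives the density evolution recursion with Poisson distributed
right degrees. -/
theorem one_sub_poissonPi_decodableCounts (hD : ∀ t d, D < d → L t d = 0)
    (hL : ∀ t, HasEdges (L t)) (hη : ∀ t, 0 < η t) {y : Fin T → ℝ}
    (hy : ∀ t, y t ∈ Set.Icc (0 : ℝ) 1) (t : Fin T) :
    1 - (poissonPi (classRate L D η y)).real (decodableCounts t) =
      deMap L (fun s => poissonLaw (η s * gen (L s) 1 1)) y t := by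
  classical
  have hν := classRate_nonneg (L := L) (D := D) hD (fun t => (hη t).le) hy
  have hμ : ∀ s, 0 < η s * gen (L s) 1 1 := fun s => mul_pos (hη s) (hL s).gen_one_one_pos
  have hrate : ∀ s, η s * gen (L s) 1 1 * edgeGen (L s) (y s) = classRate L D η y (s, true) := by
    intro s
    have := (hL s).gen_one_one_pos.ne'
    rw [classRate_true hD, edgeGen]
    field_simp
  have hset : decodableCounts t = ⋃ v ∈ (finite_decodable_shift t).toFinset,
      {c : Fin T × Bool → ℕ | ∀ s, c (s, true) = v s} := by
    ext c
    simp only [decodableCounts, Set.mem_iUnion, Set.Finite.mem_toFinset, Set.mem_ofPred_eq,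
      exists_prop]
    constructor
    · intro h
      exact ⟨fun s => c (s, true), h, fun _ => rfl⟩
    · rintro ⟨v, hv, hcv⟩
      simpa only [hcv] using hv
  have hmeas : (poissonPi (classRate L D η y)).real (decodableCounts t) =
      ∑ v ∈ (finite_decodable_shift t).toFinset,
        poissonWeight (fun s => classRate L D η y (s, true)) v := by
    rw [hset, measureReal_biUnion_finset]
    · exact Finset.sum_congr rfl fun v _ => poissonPi_real_fst _ hν v
    · intro v _ w _ hvw
      rw [Function.onFun, Set.disjoint_left]
      intro c hc hc'
      exact hvw (funext fun s => (hc s).symm.trans (hc' s))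
    · exact fun v _ => (Set.to_countable _).measurableSet
  rw [hmeas, sum_decodable_shift t _ _ (by simp), deMap]
  congr 1
  rw [Finset.mul_sum]
  refine Finset.sum_congr rfl fun c _ => ?_
  rw [poissonWeight, ← Finset.mul_prod_erase _ _ (Finset.mem_univ t)]
  congr 1
  · rw [edgeGen, gen_poissonLaw (hμ t).le, gen_poissonLaw (hμ t).le, ← hrate t,
      Function.update_self]
    have := (hμ t).ne'
    simp only [sub_self, mul_zero, Real.exp_zero, mul_one, pow_one, pow_zero, Nat.factorial_zero,
      Nat.cast_one, div_one]
    rw [mul_div_cancel_left₀ _ this]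
    congr 1
    ring
  · refine Finset.prod_congr rfl fun s hs => ?_
    rw [Function.update_of_ne (Finset.ne_of_mem_erase hs), gen_poissonLaw (hμ s).le, ← hrate s,
      mul_pow, show η s * gen (L s) 1 1 * (1 - edgeGen (L s) (y s) - 1) =
        -(η s * gen (L s) 1 1 * edgeGen (L s) (y s)) by ring]
    ring

end Poisson

section FrameLimit

variable {T : ℕ} {L : Fin T → PMF ℕ} {D : ℕ} {η : Fin T → ℝ} {K : ℕ → Fin T → ℕ}

theorem exists_degree_bound (h : ∀ t, (L t).support.Finite) :
    ∃ D, ∀ t d, D < d → L t d = 0 := by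
  choose B hB using fun t => (h t).bddAbove
  refine ⟨∑ t, B t, fun t d hd => ?_⟩
  by_contra hne
  have h1 : d ≤ B t := hB t ((PMF.mem_support_iff _ _).2 hne)
  have h2 : B t ≤ ∑ t, B t := Finset.single_le_sum (fun _ _ => Nat.zero_le _) (Finset.mem_univ t)
  omega

/-- The joint limit law holds at every iteration with the erasure probabilities of the tree
ensemble with Poisson right degrees, by induction on the iteration and, within an iteration, on
the total of the counts. -/
theorem jointLimit (hD : ∀ t d, D < d → L t d = 0) (hL : ∀ t, HasEdges (L t))
    (hη : ∀ t, 0 < η t)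
    (hK : ∀ t, Tendsto (fun N : ℕ => (K N t : ℝ) / (N : ℝ)) atTop (𝓝 (η t)))
    (hR : ∀ t, HasEdges (poissonLaw (η t * gen (L t) 1 1))) (ℓ : ℕ) :
    ∀ B, JointLimit L D η K
      (treeErasure L (fun t => poissonLaw (η t * gen (L t) 1 1)) hL hR ℓ) ℓ B := by
  have hη' : ∀ t, 0 ≤ η t := fun t => (hη t).le
  have hy := fun ℓ => treeErasure_mem_Icc L (fun t => poissonLaw (η t * gen (L t) 1 1)) hL hR ℓ
  suffices h0 : JointLimit L D η K
      (treeErasure L (fun t => poissonLaw (η t * gen (L t) 1 1)) hL hR ℓ) ℓ 0 by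
    intro B
    induction B with
    | zero => exact h0
    | succ B ih => exact ih.succ hD hη' hK (hy ℓ)
  induction ℓ with
  | zero => exact JointLimit.zero hD hK (treeErasure_zero L _ hL hR)
  | succ ℓ ih =>
    have hall : ∀ B, JointLimit L D η K
        (treeErasure L (fun t => poissonLaw (η t * gen (L t) 1 1)) hL hR ℓ) ℓ B := by
      intro B
      induction B with
      | zero => exact ih
      | succ B ih' => exact ih'.succ hD hη' hK (hy ℓ)
    refine JointLimit.next hD hη' (hy ℓ) hall fun t => ?_
    rw [treeErasure_succ, one_sub_poissonPi_decodableCounts hD hL hη (hy ℓ)]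

/-- The cavity messages have the erasure probability of the tree ensemble in the limit. -/
theorem JointLimit.cavityErased (hD : ∀ t d, D < d → L t d = 0) {y : Fin T → ℝ} {ℓ : ℕ}
    (h : JointLimit L D η K y ℓ 0) (t : Fin T) {ε : ℝ} (hε : 0 < ε) :
    ∀ᶠ N : ℕ in atTop, ∀ n : Fin N,
      |frameProb L (K N) N (fun f => cavityErased ℓ f n t) - y t| ≤ ε := by
  filter_upwards [h 1 ε hε, eventually_ge_atTop D] with N hN hND
  intro n
  have h1 := fun v => hN ∅ {n} (fun _ _ => 0) (fun _ => t) v (Finset.disjoint_empty_left _)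
    (by simp) (by simp) (by simp)
  have h2 := h1 fun _ => true
  have h3 := h1 fun _ => false
  have e2 : frameProb L (K N) N (JointEvent ℓ ∅ {n} (fun _ _ => 0) (fun _ => t) fun _ => true) ≤
      frameProb L (K N) N (fun f => IrsaNoma.cavityErased ℓ f n t) :=
    frameProb_mono fun f hf => (hf.2 n (by simp)).2 rfl
  have e3 : frameProb L (K N) N (JointEvent ℓ ∅ {n} (fun _ _ => 0) (fun _ => t) fun _ => false) ≤
      frameProb L (K N) N (fun f => ¬ IrsaNoma.cavityErased ℓ f n t) :=
    frameProb_mono fun f hf h => by simpa using (hf.2 n (by simp)).1 h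
  simp [erasureLaw] at h2 h3
  have h4 := frameProb_add_not (K := K N) hD hND (fun f => IrsaNoma.cavityErased ℓ f n t)
  rw [abs_le]
  constructor <;> linarith

/-- The degrees of a slot have the Poisson distribution in the limit. -/
theorem JointLimit.degree (hD : ∀ t d, D < d → L t d = 0) (hL : ∀ t, HasEdges (L t))
    (hη : ∀ t, 0 < η t) {y : Fin T → ℝ} (hy : ∀ t, y t = 1)
    (h : ∀ B, JointLimit L D η K y 0 B) (t : Fin T) (d : ℕ) {ε : ℝ} (hε : 0 < ε) :
    ∀ᶠ N : ℕ in atTop, ∀ n : Fin N,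
      |frameProb L (K N) N (fun f => pattern f n Set.univ t = d) -
        (poissonLaw (η t * gen (L t) 1 1) d).toReal| ≤ ε := by
  have hy' : ∀ t, y t ∈ Set.Icc (0 : ℝ) 1 := fun t => by simp [hy t]
  have hη' : ∀ t, 0 ≤ η t := fun t => (hη t).le
  have hν := classRate_nonneg (L := L) (D := D) hD hη' hy'
  set C : Set (Fin T × Bool → ℕ) := {c | c (t, true) = d} with hC
  have hπ : (poissonPi (classRate L D η y)).real C =
      (poissonLaw (η t * gen (L t) 1 1) d).toReal := by
    classical
    have hset : C = Set.pi Set.univ fun i => if i = (t, true) then {d} else Set.univ := by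
      ext c
      rw [hC]
      simp only [Set.mem_ofPred_eq, Set.mem_pi, Set.mem_univ, forall_true_left]
      constructor
      · intro h i
        split_ifs with hi
        · exact hi ▸ h
        · trivial
      · intro h
        simpa using h (t, true)
    rw [hset, MeasureTheory.measureReal_def, poissonPi, MeasureTheory.Measure.pi_pi,
      Finset.prod_eq_single (t, true)]
    · rw [if_pos rfl, ← MeasureTheory.measureReal_def,
        ProbabilityTheory.poissonMeasure_real_singleton, Real.coe_toNNReal _ (hν _),
        classRate_true hD, hy, poissonLaw_toReal]
      exact mul_nonneg (hη' t) (hL t).gen_one_one_pos.le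
    · intro i _ hi
      rw [if_neg hi, MeasureTheory.measure_univ]
    · simp
  have hcount : ∀ {N : ℕ} (f : Frame (K N) N) (n : Fin N),
      cavityCount 0 f n (t, true) = pattern f n Set.univ t := by
    intro N f n
    classical
    unfold cavityCount pattern
    congr 1
    ext w
    simp [InClass, UserErased, IrsaNoma.cavityErased]
  filter_upwards [JointLimit.sets hD hη' hy' h t (fun b : Bool => if b = true then C else Cᶜ) 1 hε,
    eventually_ge_atTop D] with N hN hND
  intro n
  have h1 := hN {n} (fun _ => true) (by simp)
  have h2 := hN {n} (fun _ => false) (by simp)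
  have hcompl := MeasureTheory.probReal_compl_eq_one_sub (μ := poissonPi (classRate L D η y))
    (Set.to_countable C).measurableSet
  rw [hπ] at hcompl
  simp only [Finset.prod_singleton, Finset.mem_singleton, forall_eq, if_true, Bool.false_eq_true,
    if_false, hC, Set.mem_compl_iff, Set.mem_ofPred_eq, hcount] at h1 h2
  have h4 := frameProb_add_not (K := K N) hD hND (fun f => pattern f n Set.univ t = d)
  rw [abs_le]
  constructor <;> linarith

theorem tendsto_rightDegree {t : Fin T} {d : ℕ} {x : ℝ}
    (h : ∀ ε : ℝ, 0 < ε → ∀ᶠ N : ℕ in atTop, ∀ n : Fin N,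
      |frameProb L (K N) N (fun f => pattern f n Set.univ t = d) - x| ≤ ε) :
    Tendsto (fun N : ℕ => rightDegree L (K N) N t d) atTop (𝓝 x) := by
  rw [Metric.tendsto_atTop']
  intro ε hε
  obtain ⟨N₀, hN₀⟩ := eventually_atTop.1 (h (ε / 2) (by positivity))
  refine ⟨N₀, fun N hN => ?_⟩
  have hN0 : (0 : ℝ) < N := by exact_mod_cast (by omega : 0 < N)
  have hsum : rightDegree L (K N) N t d - x =
      (∑ n : Fin N, (frameProb L (K N) N (fun f => pattern f n Set.univ t = d) - x)) / N := by
    classical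
    have h1 : frameExp L (K N) N (fun f => ((Finset.univ.filter
        (fun n : Fin N => pattern f n Set.univ t = d)).card : ℝ)) =
        ∑ n : Fin N, frameProb L (K N) N (fun f => pattern f n Set.univ t = d) := by
      unfold frameProb
      rw [← frameExp_sum]
      congr 1
      funext f
      rw [Finset.natCast_card_filter]
      congr!
    rw [Finset.sum_sub_distrib, ← h1, rightDegree, Finset.sum_const, Finset.card_univ,
      Fintype.card_fin, nsmul_eq_mul, sub_div, mul_div_cancel_left₀ _ hN0.ne']
  rw [Real.dist_eq, hsum, abs_div, abs_of_pos hN0, div_lt_iff₀ hN0]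
  calc |∑ n : Fin N, (frameProb L (K N) N (fun f => pattern f n Set.univ t = d) - x)|
      ≤ ∑ n : Fin N, ε / 2 :=
        (Finset.abs_sum_le_sum_abs _ _).trans (Finset.sum_le_sum fun n _ => hN₀ N hN.le n)
    _ = ε / 2 * N := by simp [mul_comm]
    _ < ε * N := by
        refine mul_lt_mul_of_pos_right ?_ hN0
        linarith

/-- Given the slots of a user, the message of belief propagation from one of them to the user
agrees with the cavity message up to an event of probability of order `1 / N`. -/
theorem abs_slotErased_sub_cavityErased_le (hD : ∀ t d, D < d → L t d = 0) {K : Fin T → ℕ}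
    {N : ℕ} (hN : D ≤ N) {κ : ℝ} (hκ : 0 ≤ κ) (hK : (Fintype.card (User K) : ℝ) ≤ κ * N) (ℓ : ℕ)
    (u : User K) {S : Finset (Fin N)} (hS : S.card ≤ D) {n : Fin N} (hn : n ∈ S) :
    |frameProb L K N (fun f => slotErased (Function.update f u S) ℓ u n) -
      frameProb L K N (fun f => cavityErased ℓ f n u.1)| ≤ interferenceBound D κ ℓ 1 / N := by
  have hiff : ∀ f : Frame K N, ¬ Interferes ℓ f u S {n} →
      (slotErased (Function.update f u S) ℓ u n ↔ cavityErased ℓ f n u.1) := by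
    intro f hf
    unfold Interferes at hf
    push Not at hf
    obtain ⟨h1, h2, h3⟩ := hf n (Finset.mem_singleton_self n)
    have hdel : deleteUsers {u} (Function.update f u S) = Function.update f u ∅ := by
      rw [deleteUsers_singleton, Function.update_idem]
    rw [cavityErased_update_iff' h1 h2, ← hdel]
    refine slotErased_iff_cavityErased (X := S) (Finset.mem_singleton_self u) (by simpa) ?_ ?_ ?_
    · intro y hy hyu
      exact absurd (Finset.mem_singleton.1 hy) hyu
    · intro y hy
      rw [Finset.mem_singleton.1 hy, Function.update_self]
    · rw [hdel]
      exact fun h => h3 h.succ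
  have hI := frameProb_interferes_le hD hN hκ hK ℓ u hS {n}
  rw [Finset.card_singleton] at hI
  have hI' : frameProb L K N (fun f => Interferes ℓ f u S {n}) ≤ interferenceBound D κ ℓ 1 / N :=
    hI
  have h1 : frameProb L K N (fun f => slotErased (Function.update f u S) ℓ u n) ≤
      frameProb L K N (fun f => cavityErased ℓ f n u.1) +
        frameProb L K N (fun f => Interferes ℓ f u S {n}) := by
    refine (frameProb_mono fun f hf => ?_).trans (frameProb_or_le _ _)
    by_cases h : Interferes ℓ f u S {n}
    · exact Or.inr h
    · exact Or.inl ((hiff f h).1 hf)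
  have h2 : frameProb L K N (fun f => cavityErased ℓ f n u.1) ≤
      frameProb L K N (fun f => slotErased (Function.update f u S) ℓ u n) +
        frameProb L K N (fun f => Interferes ℓ f u S {n}) := by
    refine (frameProb_mono fun f hf => ?_).trans (frameProb_or_le _ _)
    by_cases h : Interferes ℓ f u S {n}
    · exact Or.inr h
    · exact Or.inl ((hiff f h).2 hf)
  rw [abs_le]
  constructor <;> linarith

theorem frameExp_card_edges {K : Fin T → ℕ} {N : ℕ} (t : Fin T)
    (p : User K × Fin N → Frame K N → Prop) [∀ f, DecidablePred fun e => e.1.1 = t ∧ p e f] :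
    frameExp L K N (fun f => ((Finset.univ.filter fun e => e.1.1 = t ∧ p e f).card : ℝ)) =
      ∑ e : User K × Fin N with e.1.1 = t, frameProb L K N (p e) := by
  classical
  unfold frameProb
  rw [← frameExp_sum]
  congr 1
  funext f
  rw [Finset.sum_boole, Finset.filter_filter]
  congr!

/-- The probability that `u` sends in `n` and receives an erasure from `n` is close to the product
of the probability that `u` sends in `n` and the limit `x` of the cavity messages. -/
theorem abs_frameProb_mem_and_slotErased_sub_le (hD : ∀ t d, D < d → L t d = 0) {K : Fin T → ℕ}
    {N : ℕ} (hN : D ≤ N) {κ : ℝ} (hκ : 0 ≤ κ) (hK : (Fintype.card (User K) : ℝ) ≤ κ * N) (ℓ : ℕ)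
    (u : User K) (n : Fin N) {x ε : ℝ}
    (hx : |frameProb L K N (fun f => cavityErased ℓ f n u.1) - x| ≤ ε) :
    |frameProb L K N (fun f => n ∈ f u ∧ slotErased f ℓ u n) - gen (L u.1) 1 1 / N * x| ≤
      gen (L u.1) 1 1 / N * (ε + interferenceBound D κ ℓ 1 / N) := by
  classical
  have hm : ∑ S : Finset (Fin N) with n ∈ S, userWeight L u.1 S = gen (L u.1) 1 1 / N := by
    have h := sum_userWeight_mem hD hN u.1 n (fun _ => 1)
    simpa only [mul_one, mean_eq_gen hD] using h
  have hp : frameProb L K N (fun f => n ∈ f u ∧ slotErased f ℓ u n) =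
      ∑ S : Finset (Fin N) with n ∈ S, userWeight L u.1 S *
        frameProb L K N (fun f => slotErased (Function.update f u S) ℓ u n) := by
    rw [frameProb_resample hD hN u, Finset.sum_filter]
    refine Finset.sum_congr rfl fun S _ => ?_
    split_ifs with h
    · simp [h]
    · simp [h, frameProb, frameExp]
  rw [hp, ← hm, Finset.sum_mul, ← Finset.sum_sub_distrib, Finset.sum_mul]
  refine (Finset.abs_sum_le_sum_abs _ _).trans (Finset.sum_le_sum fun S hS => ?_)
  rw [← mul_sub, abs_mul, abs_of_nonneg (userWeight_nonneg _ _)]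
  rcases le_or_gt S.card D with hc | hc
  · refine mul_le_mul_of_nonneg_left ?_ (userWeight_nonneg _ _)
    have h := abs_slotErased_sub_cavityErased_le hD hN hκ hK ℓ u hc (Finset.mem_filter.1 hS).2
    have h' := abs_sub_le (frameProb L K N fun f => slotErased (Function.update f u S) ℓ u n)
      (frameProb L K N fun f => cavityErased ℓ f n u.1) x
    linarith
  · simp [userWeight_eq_zero hD u.1 hc]

theorem frameProb_mem_eq (hD : ∀ t d, D < d → L t d = 0) {K : Fin T → ℕ} {N : ℕ} (hN : D ≤ N)
    (u : User K) (n : Fin N) :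
    frameProb L K N (fun f => n ∈ f u) = gen (L u.1) 1 1 / N := by
  classical
  have h := sum_userWeight_mem hD hN u.1 n (fun _ => 1)
  simp only [mul_one, mean_eq_gen hD] at h
  rw [frameProb_resample hD hN u, ← h, Finset.sum_filter]
  refine Finset.sum_congr rfl fun S _ => ?_
  simp only [Function.update_self]
  split_ifs with hS
  · have h1 := frameExp_one (L := L) (K := K) hD hN
    simp [frameProb, h1, hS]
  · simp [frameProb, frameExp, hS]

/-- The average erasure probability over the edges of the frame converges to a common limit of
the cavity messages. -/
theorem tendsto_avgErasure (hD : ∀ t d, D < d → L t d = 0) (hL : ∀ t, HasEdges (L t))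
    (hη : ∀ t, 0 < η t)
    (hK : ∀ t, Tendsto (fun N : ℕ => (K N t : ℝ) / (N : ℝ)) atTop (𝓝 (η t))) (ℓ : ℕ) (t : Fin T)
    {x : ℝ} (h : ∀ ε : ℝ, 0 < ε → ∀ᶠ N : ℕ in atTop, ∀ n : Fin N,
      |frameProb L (K N) N (fun f => cavityErased ℓ f n t) - x| ≤ ε) :
    Tendsto (fun N : ℕ => avgErasure L (K N) N ℓ t) atTop (𝓝 x) := by
  classical
  have hm := (hL t).gen_one_one_pos
  set κ := ∑ t, η t + 1 with hκd
  have hκ : 0 ≤ κ := by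
    have := Finset.sum_nonneg fun t (_ : t ∈ Finset.univ) => (hη t).le
    linarith
  set β := interferenceBound D κ ℓ 1
  have hβ : ∀ ε : ℝ, 0 < ε → ∀ᶠ N : ℕ in atTop, β / N < ε := fun ε hε =>
    (tendsto_const_div_atTop_nhds_zero_nat β).eventually_lt_const hε
  rw [Metric.tendsto_nhds]
  intro ε hε
  filter_upwards [h (ε / 3) (by positivity), hβ (ε / 3) (by positivity), eventually_ge_atTop D,
    eventually_gt_atTop 0, eventually_card_user_le hK, (hK t).eventually_const_lt (hη t)]
    with N h1 h2 hN hN0 hU hKt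
  have hN0' : (0 : ℝ) < N := by exact_mod_cast hN0
  have hK0 : 0 < K N t := Nat.pos_of_ne_zero fun h0 => by simp [h0] at hKt
  set E := Finset.univ.filter fun e : User (K N) × Fin N => e.1.1 = t with hE
  have hE0 : (0 : ℝ) < E.card := by
    rw [Nat.cast_pos, Finset.card_pos]
    exact ⟨(⟨t, ⟨0, hK0⟩⟩, ⟨0, hN0⟩), by simp [hE]⟩
  have hden : frameExp L (K N) N (fun f => (edgeCount f t : ℝ)) =
      E.card * (gen (L t) 1 1 / N) := by
    unfold edgeCount
    rw [frameExp_card_edges t fun e f => e.2 ∈ f e.1, ← nsmul_eq_mul]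
    refine Finset.sum_eq_card_nsmul fun e he => ?_
    rw [frameProb_mem_eq hD hN, (Finset.mem_filter.1 he).2]
  have hnum : frameExp L (K N) N (fun f => (erasedCount f ℓ t : ℝ)) =
      ∑ e ∈ E, frameProb L (K N) N (fun f => e.2 ∈ f e.1 ∧ slotErased f ℓ e.1 e.2) := by
    unfold erasedCount
    exact frameExp_card_edges t fun e f => e.2 ∈ f e.1 ∧ slotErased f ℓ e.1 e.2
  have hpos : 0 < E.card * (gen (L t) 1 1 / N) := by positivity
  rw [Real.dist_eq, avgErasure, hden, hnum, div_sub' hpos.ne', abs_div, abs_of_pos hpos,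
    div_lt_iff₀ hpos, mul_assoc, ← nsmul_eq_mul, ← Finset.sum_const, ← Finset.sum_sub_distrib]
  calc |∑ e ∈ E, (frameProb L (K N) N (fun f => e.2 ∈ f e.1 ∧ slotErased f ℓ e.1 e.2) -
          gen (L t) 1 1 / N * x)|
      ≤ ∑ e ∈ E, gen (L t) 1 1 / N * (ε / 3 + β / N) := by
        refine (Finset.abs_sum_le_sum_abs _ _).trans (Finset.sum_le_sum fun e he => ?_)
        obtain rfl := (Finset.mem_filter.1 he).2
        exact abs_frameProb_mem_and_slotErased_sub_le hD hN hκ hU ℓ e.1 e.2 (h1 e.2)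
    _ = (ε / 3 + β / N) * (E.card * (gen (L t) 1 1 / N)) := by
        rw [Finset.sum_const, nsmul_eq_mul]
        ring
    _ < ε * (E.card * (gen (L t) 1 1 / N)) := by
        refine mul_lt_mul_of_pos_right ?_ hpos
        linarith

end FrameLimit

end IrsaNoma

theorem mainTheorem2 {T : ℕ} (L : Fin T → PMF ℕ) (hL : ∀ t, IrsaNoma.HasEdges (L t)) :
    -- the random frame with left degrees from `L`, as the number of slots grows
    ((∀ t, (L t).support.Finite) →
      ∀ (η : Fin T → ℝ), (∀ t, 0 < η t) → ∀ (K : ℕ → Fin T → ℕ),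
        (∀ t, Tendsto (fun N : ℕ => (K N t : ℝ) / (N : ℝ)) atTop (𝓝 (η t))) →
        ∃ (R : Fin T → PMF ℕ) (y : ℕ → Fin T → ℝ),
          (∀ t d, Tendsto (fun N : ℕ => IrsaNoma.rightDegree L (K N) N t d) atTop
            (𝓝 (R t d).toReal)) ∧
          (∀ t, IrsaNoma.HasEdges (R t)) ∧
          (∀ t, IrsaNoma.gen (R t) 1 1 = η t * IrsaNoma.gen (L t) 1 1) ∧
          (∀ ℓ t, Tendsto (fun N : ℕ => IrsaNoma.avgErasure L (K N) N ℓ t) atTop (𝓝 (y ℓ t))) ∧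
          (∀ t, y 0 t = 1) ∧
          (∀ ℓ t, y (ℓ + 1) t = IrsaNoma.deMap L R (y ℓ) t)) ∧
    -- arbitrary pairs of left and right degree distributions
    (∀ (R : Fin T → PMF ℕ) (hR : ∀ t, IrsaNoma.HasEdges (R t)),
      (∀ t, IrsaNoma.treeErasure L R hL hR 0 t = 1) ∧
      (∀ ℓ t, IrsaNoma.treeErasure L R hL hR (ℓ + 1) t =
        IrsaNoma.deMap L R (IrsaNoma.treeErasure L R hL hR ℓ) t)) ∧
    -- modified peeling decoding recovers the same users as belief propagation
    (∀ (K : Fin T → ℕ) (N : ℕ) (f : IrsaNoma.Frame K N),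
      (∀ ℓ, IrsaNoma.peelRounds f ℓ = IrsaNoma.bpResolved f ℓ) ∧
      (∃ A, IrsaNoma.IsPeelingOutput f A) ∧
      (∀ A, IrsaNoma.IsPeelingOutput f A →
        ∃ ℓ₀ : ℕ, ∀ ℓ, ℓ₀ ≤ ℓ → IrsaNoma.bpResolved f ℓ = A)) ∧
    -- the recursion for two types
    (∀ (L₂ R₂ : Fin 2 → PMF ℕ) (y : Fin 2 → ℝ) (t : Fin 2),
      IrsaNoma.deMap L₂ R₂ y t =
        1 - IrsaNoma.edgeGen (R₂ t) (1 - IrsaNoma.edgeGen (L₂ t) (y t)) *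
          (IrsaNoma.gen (R₂ t.rev) 0 (1 - IrsaNoma.edgeGen (L₂ t.rev) (y t.rev)) +
            IrsaNoma.edgeGen (L₂ t.rev) (y t.rev) *
              IrsaNoma.gen (R₂ t.rev) 1 (1 - IrsaNoma.edgeGen (L₂ t.rev) (y t.rev)))) := by

  refine ⟨fun hfin η hη K hK => ?_, fun R hR => ?_, fun K N f => ?_, fun L₂ R₂ y t => ?_⟩
  · obtain ⟨D, hD⟩ := IrsaNoma.exists_degree_bound hfin
    have hμ : ∀ t, 0 < η t * IrsaNoma.gen (L t) 1 1 :=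
      fun t => mul_pos (hη t) (hL t).gen_one_one_pos
    have hR : ∀ t, IrsaNoma.HasEdges (IrsaNoma.poissonLaw (η t * IrsaNoma.gen (L t) 1 1)) :=
      fun t => IrsaNoma.hasEdges_poissonLaw (hμ t)
    have hJ := IrsaNoma.jointLimit hD hL hη hK hR
    refine ⟨_, IrsaNoma.treeErasure L _ hL hR, fun t d => ?_, hR, fun t => ?_, fun ℓ t => ?_,
      IrsaNoma.treeErasure_zero L _ hL hR, IrsaNoma.treeErasure_succ L _ hL hR⟩
    · exact IrsaNoma.tendsto_rightDegree fun ε hε => IrsaNoma.JointLimit.degree hD hL hη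
        (IrsaNoma.treeErasure_zero L _ hL hR) (hJ 0) t d hε
    · rw [IrsaNoma.gen_poissonLaw (hμ t).le, sub_self, mul_zero, Real.exp_zero, mul_one, pow_one]
    · exact IrsaNoma.tendsto_avgErasure hD hL hη hK ℓ t fun ε hε =>
        (hJ ℓ 0).cavityErased hD t hε
  · exact ⟨IrsaNoma.treeErasure_zero L R hL hR, IrsaNoma.treeErasure_succ L R hL hR⟩
  · refine ⟨IrsaNoma.peelRounds_eq_bpResolved f, IrsaNoma.exists_isPeelingOutput f, fun A hA => ?_⟩
    exact hA.eq_bpResolved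
  · exact IrsaNoma.deMap_two L₂ R₂ y t
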